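/- Let $0<q<1$, $a\in\mathbb{R}$, and write $\llbracket x\rrbracket=q^x-q^{-x}$, $[x]=\llbracket x\rrbracket/(q-q^{-1})$, $t=\llbracket a\rrbracket$. **Algebras.** Let $U_q(\mathfrak{su}(2))$ be the Hopf algebra generated by $k^{\pm1},e,f$ with $ke=q^2ek$, $kf=q^{-2}fk$, $[e,f]=\frac{k-k^{-1}}{q-q^{-1}}$ and $\Delta(k)=k\otimes k$, $\Delta(e)=e\otimes1+k\otimes e$, $\Delta(f)=1\otimes f+f\otimes k^{-1}$. Let $\mathcal A=\mathcal O_q(SU(2))$ be the Hopf algebra generated by $\alpha,\alpha^*,\gamma,\gamma^*$ with $\alpha^*\alpha+\gamma^*\gamma=1$, $\alpha\alpha^*+q^2\gamma\gamma^*=1$, $\gamma^*\gamma=\gamma\gamma^*$, $\alpha\gamma=q\gamma\alpha$, $\alpha\gamma^*=q\gamma^*\alpha$, $\gamma^*\alpha^*=q\alpha^*\gamma^*$, $\gamma\alpha^*=q\alpha^*\gamma$, whose coproduct and counit are those for which $u=\begin{bmatrix}\alpha&-q\gamma^*\\ \gamma&\alpha^*\end{bmatrix}$ is a matrix corepresentation.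 They are paired by $(u,k)=\begin{bmatrix}q&0\\0&q^{-1}\end{bmatrix}$, $(u,e)=\begin{bmatrix}0&q^{1/2}\\0&0\end{bmatrix}$, $(u,f)=\begin{bmatrix}0&0\\q^{-1/2}&0\end{bmatrix}$; this maps $U_q(\mathfrak{su}(2))$ into the convolution algebra $\mathcal U=\mathrm{Hom}(\mathcal A,\mathbb C)$. For $h\in\mathcal U$ and $c\in\mathcal A$ put $c\lhd h=h(c_{(1)})c_{(2)}$. Let $$B_t=q^{-1/2}(e-fk)-\sqrt{-1}\,(q-q^{-1})^{-1}t\,k,\qquad \mathcal O_q(S_t^2)=\{c\in\mathcal A\mid c\lhd B_t=\epsilon(B_t)c\},$$ so that $\mathcal O_q(S_t^2)$ is a subalgebra and a right coideal of $\mathcal A$. The operator $c\mapsto c\lhd(\sqrt{-1}B_t)$ on $\mathcal A$ is diagonalizable with eigenvalues $[a+n]$, $n\in\mathbb Z$. Let $\Phi_n\in\mathcal U$ be the functional that equals $\epsilon$ on the eigenspace for $[a+n]$ and is zero on the other eigenspaces, and let $\mathcal I_c=\bigoplus_{n\in\mathbb Z}\mathbb C\Phi_n\subset\mathcal U$. The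 algebra $\mathcal O_q(S_t^2)\bowtie\mathcal I_c$ is the vector space $\mathcal O_q(S_t^2)\otimes\mathcal I_c$, with elements written $bx$, in which the product is determined by those of $\mathcal O_q(S_t^2)$ and $\mathcal I_c$ and by the exchange relation $xb=b_{(1)}(x\lhd b_{(2)})$, where $(x\lhd c)(d)=x(cd)$. Let $\mathrm{Rep}(\mathcal O_q(S_t^2)\bowtie\mathcal I_c)$ be the category of its nondegenerate representations on complex vector spaces, with the intertwining linear maps as morphisms. Every object of it is also an $\mathcal O_q(S_t^2)$-module and an $\mathcal I_c$-representation. **Representations.** The trivial representation $\mathbb 1=\mathbb C$ is given by the counit $bx\mapsto\epsilon(b)x(1)$. Put $X=\alpha^2+q\gamma^2-\sqrt{-1}qt\gamma\alpha$, $X^*=(\alpha^*)^2+q(\gamma^*)^2+\sqrt{-1}qt\alpha^*\gamma^*$, $Y=\gamma\alpha^*-\alpha\gamma^*+\sqrt{-1}qt\gamma\gamma^*$ and, for $b\in\mathbb R$, $A_b=q^{-1}X+qX^*+\sqrt{-1}\llbracket b\rrbracket Y$; these are elements of $\mathcal O_q(S_t^2)$. For $\lambda\in\mathbb C$ and $b=a+m$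 with $m\in\mathbb Z$, let $\mathcal M_{\lambda,b}$ be the universal representation generated by a vector $e_b$ with $\Phi_me_b=e_b$ and $A_be_b=\lambda e_b$, and let $\mathcal L_{\lambda,b}$ be its quotient by the sum of all its proper subrepresentations. Let $\mathcal D_2^{\pm}=\mathcal L_{q+q^{-1},a\pm2}$, and let $p\colon\mathcal M_{q+q^{-1},a}\to\mathbb 1$ be the morphism with $p(e_a)=1$. **Proposition.** There is no splitting $\lambda\colon\mathbb 1\to\mathcal M_{q+q^{-1},a}$ in $\mathrm{Rep}(\mathcal O_q(S_t^2)\bowtie\mathcal I_c)$, that is, there is no morphism $\lambda$ with $p\circ\lambda=\mathrm{id}_{\mathbb 1}$. This holds even though $\mathcal M_{q+q^{-1},a}\cong(\mathcal D_2^+\oplus\mathcal D_2^-)\oplus\mathbb 1$ as $\mathcal I_c$-representations. -/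

import Mathlib

open scoped TensorProduct

noncomputable section

namespace QuantumSL2R

/-! ### Numerical conventions -/

/-- `q ^ x` as a complex number, for real `x`. -/
def qpow (q : Set.Ioo (0 : ℝ) 1) (x : ℝ) : ℂ := (((q : ℝ) ^ x : ℝ) : ℂ)

/-- The parameter `q` as a complex number. -/
def qc (q : Set.Ioo (0 : ℝ) 1) : ℂ := ((q : ℝ) : ℂ)

/-- `⟦x⟧ = q ^ x - q ^ (-x)`. -/
def dbr (q : Set.Ioo (0 : ℝ) 1) (x : ℝ) : ℂ := qpow q x - qpow q (-x)

/-- `[x] = (q ^ x - q ^ (-x)) / (q - q⁻¹)`. -/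
def br (q : Set.Ioo (0 : ℝ) 1) (x : ℝ) : ℂ := dbr q x / (qc q - (qc q)⁻¹)

theorem qc_ne_zero (q : Set.Ioo (0 : ℝ) 1) : qc q ≠ 0 := by
  have h := q.2.1
  simp only [qc, ne_eq, Complex.ofReal_eq_zero]
  exact h.ne'

theorem qc_sub_inv_ne_zero (q : Set.Ioo (0 : ℝ) 1) : qc q - (qc q)⁻¹ ≠ 0 := by
  obtain ⟨q, h0, h1⟩ := q
  have h2 : q - q⁻¹ ≠ 0 := by
    have h3 : 1 < q⁻¹ := (one_lt_inv₀ h0).2 h1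
    have h4 : q - q⁻¹ < 0 := by linarith
    exact h4.ne
  simp only [qc]
  exact_mod_cast h2

/-- The function `x ↦ [x]` is injective. -/
theorem br_injective (q : Set.Ioo (0 : ℝ) 1) : Function.Injective (br q) := by
  intro x y h
  have h1 : dbr q x = dbr q y := by
    simpa [br, div_left_inj' (qc_sub_inv_ne_zero q)] using h
  have h2 : ((q : ℝ) ^ x - (q : ℝ) ^ (-x) : ℝ) = (q : ℝ) ^ y - (q : ℝ) ^ (-y) := by
    simp only [dbr, qpow] at h1
    exact_mod_cast h1
  have key : ∀ u v : ℝ, u < v →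
      ((q : ℝ) ^ v - (q : ℝ) ^ (-v) : ℝ) < (q : ℝ) ^ u - (q : ℝ) ^ (-u) := by
    intro u v huv
    have a1 := Real.rpow_lt_rpow_of_exponent_gt q.2.1 q.2.2 huv
    have a2 := Real.rpow_lt_rpow_of_exponent_gt q.2.1 q.2.2 (neg_lt_neg huv)
    linarith
  rcases lt_trichotomy x y with hxy | hxy | hxy
  · exact absurd h2 (key x y hxy).ne'
  · exact hxy
  · exact absurd h2 (key y x hxy).ne

/-! ### The bialgebra `O_q(SU(2))` -/

/-- The generators `α, α*, γ, γ*`. -/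
inductive Gen : Type
  | al | als | ga | gas

/-- The defining relations of `O_q(SU(2))`, together with their adjoints. -/
inductive SURel (q : Set.Ioo (0 : ℝ) 1) : FreeAlgebra ℂ Gen → FreeAlgebra ℂ Gen → Prop
  | unit₁ : SURel q (FreeAlgebra.ι ℂ .als * FreeAlgebra.ι ℂ .al
      + FreeAlgebra.ι ℂ .gas * FreeAlgebra.ι ℂ .ga) 1
  | unit₂ : SURel q (FreeAlgebra.ι ℂ .al * FreeAlgebra.ι ℂ .als
      + (qc q) ^ 2 • (FreeAlgebra.ι ℂ .ga * FreeAlgebra.ι ℂ .gas)) 1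
  | normal : SURel q (FreeAlgebra.ι ℂ .gas * FreeAlgebra.ι ℂ .ga)
      (FreeAlgebra.ι ℂ .ga * FreeAlgebra.ι ℂ .gas)
  | comm₁ : SURel q (FreeAlgebra.ι ℂ .al * FreeAlgebra.ι ℂ .ga)
      (qc q • (FreeAlgebra.ι ℂ .ga * FreeAlgebra.ι ℂ .al))
  | comm₂ : SURel q (FreeAlgebra.ι ℂ .al * FreeAlgebra.ι ℂ .gas)
      (qc q • (FreeAlgebra.ι ℂ .gas * FreeAlgebra.ι ℂ .al))
  | comm₁_star : SURel q (FreeAlgebra.ι ℂ .gas * FreeAlgebra.ι ℂ .als)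
      (qc q • (FreeAlgebra.ι ℂ .als * FreeAlgebra.ι ℂ .gas))
  | comm₂_star : SURel q (FreeAlgebra.ι ℂ .ga * FreeAlgebra.ι ℂ .als)
      (qc q • (FreeAlgebra.ι ℂ .als * FreeAlgebra.ι ℂ .ga))

/-- The algebra `O_q(SU(2))`. -/
def OqSU2 (q : Set.Ioo (0 : ℝ) 1) : Type := RingQuot (SURel q)

instance (q : Set.Ioo (0 : ℝ) 1) : Ring (OqSU2 q) := inferInstanceAs (Ring (RingQuot (SURel q)))

instance (q : Set.Ioo (0 : ℝ) 1) : Algebra ℂ (OqSU2 q) :=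
  inferInstanceAs (Algebra ℂ (RingQuot (SURel q)))

/-- The class of a generator in `O_q(SU(2))`. -/
def gen (q : Set.Ioo (0 : ℝ) 1) (g : Gen) : OqSU2 q :=
  RingQuot.mkAlgHom ℂ (SURel q) (FreeAlgebra.ι ℂ g)

/-- The universal property of `O_q(SU(2))`. -/
def liftA (q : Set.Ioo (0 : ℝ) 1) {R : Type} [Ring R] [Algebra ℂ R] (f : Gen → R)
    (h₁ : f .als * f .al + f .gas * f .ga = 1)
    (h₂ : f .al * f .als + (qc q) ^ 2 • (f .ga * f .gas) = 1)
    (h₃ : f .gas * f .ga = f .ga * f .gas)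
    (h₄ : f .al * f .ga = qc q • (f .ga * f .al))
    (h₅ : f .al * f .gas = qc q • (f .gas * f .al))
    (h₆ : f .gas * f .als = qc q • (f .als * f .gas))
    (h₇ : f .ga * f .als = qc q • (f .als * f .ga)) : OqSU2 q →ₐ[ℂ] R :=
  RingQuot.liftAlgHom ℂ ⟨FreeAlgebra.lift ℂ f, by
    intro x y h
    cases h
    · simpa using h₁
    all_goals simp [*]⟩

@[simp] theorem liftA_gen (q : Set.Ioo (0 : ℝ) 1) {R : Type} [Ring R] [Algebra ℂ R] (f : Gen → R)
    (h₁ h₂ h₃ h₄ h₅ h₆ h₇) (g : Gen) :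
    liftA q f h₁ h₂ h₃ h₄ h₅ h₆ h₇ (gen q g) = f g := by
  unfold liftA gen
  exact (RingQuot.liftAlgHom_mkAlgHom_apply ℂ _ _ _).trans (by simp)

theorem algHom_ext {q : Set.Ioo (0 : ℝ) 1} {R : Type} [Ring R] [Algebra ℂ R]
    {f g : OqSU2 q →ₐ[ℂ] R} (h : ∀ x, f (gen q x) = g (gen q x)) : f = g := by
  apply RingQuot.ringQuot_ext'
  apply FreeAlgebra.hom_ext
  funext x
  exact h x

theorem rel₁ (q : Set.Ioo (0 : ℝ) 1) :
    gen q .als * gen q .al + gen q .gas * gen q .ga = 1 := by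
  simpa using! RingQuot.mkAlgHom_rel ℂ (SURel.unit₁ (q := q))
theorem rel₂ (q : Set.Ioo (0 : ℝ) 1) :
    gen q .al * gen q .als + (qc q) ^ 2 • (gen q .ga * gen q .gas) = 1 := by
  simpa using! RingQuot.mkAlgHom_rel ℂ (SURel.unit₂ (q := q))
theorem rel₃ (q : Set.Ioo (0 : ℝ) 1) : gen q .gas * gen q .ga = gen q .ga * gen q .gas := by
  simpa using! RingQuot.mkAlgHom_rel ℂ (SURel.normal (q := q))
theorem rel₄ (q : Set.Ioo (0 : ℝ) 1) :
    gen q .al * gen q .ga = qc q • (gen q .ga * gen q .al) := by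
  simpa using! RingQuot.mkAlgHom_rel ℂ (SURel.comm₁ (q := q))
theorem rel₅ (q : Set.Ioo (0 : ℝ) 1) :
    gen q .al * gen q .gas = qc q • (gen q .gas * gen q .al) := by
  simpa using! RingQuot.mkAlgHom_rel ℂ (SURel.comm₂ (q := q))
theorem rel₆ (q : Set.Ioo (0 : ℝ) 1) :
    gen q .gas * gen q .als = qc q • (gen q .als * gen q .gas) := by
  simpa using! RingQuot.mkAlgHom_rel ℂ (SURel.comm₁_star (q := q))
theorem rel₇ (q : Set.Ioo (0 : ℝ) 1) :
    gen q .ga * gen q .als = qc q • (gen q .als * gen q .ga) := by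
  simpa using! RingQuot.mkAlgHom_rel ℂ (SURel.comm₂_star (q := q))

/-- The values of the comultiplication on the generators. -/
def comulGen (q : Set.Ioo (0 : ℝ) 1) : Gen → OqSU2 q ⊗[ℂ] OqSU2 q
  | .al => gen q .al ⊗ₜ gen q .al - qc q • (gen q .gas ⊗ₜ gen q .ga)
  | .als => gen q .als ⊗ₜ gen q .als - qc q • (gen q .ga ⊗ₜ gen q .gas)
  | .ga => gen q .ga ⊗ₜ gen q .al + gen q .als ⊗ₜ gen q .ga
  | .gas => gen q .gas ⊗ₜ gen q .als + gen q .al ⊗ₜ gen q .gas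

/-- The values of the counit on the generators. -/
def counitGen : Gen → ℂ
  | .al => 1
  | .als => 1
  | .ga => 0
  | .gas => 0

/-- The counit of `O_q(SU(2))`. -/
def counitA (q : Set.Ioo (0 : ℝ) 1) : OqSU2 q →ₐ[ℂ] ℂ :=
  liftA q counitGen (by simp [counitGen]) (by simp [counitGen]) (by simp [counitGen])
    (by simp [counitGen]) (by simp [counitGen]) (by simp [counitGen]) (by simp [counitGen])

theorem rel₁' (q : Set.Ioo (0 : ℝ) 1) :
    gen q .als * gen q .al = 1 - gen q .ga * gen q .gas := by
  rw [← rel₃, ← rel₁ q]; abel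
theorem rel₂' (q : Set.Ioo (0 : ℝ) 1) :
    gen q .al * gen q .als = 1 - (qc q) ^ 2 • (gen q .ga * gen q .gas) := by
  rw [← rel₂ q]; abel

theorem smul_tmul_out {M N : Type} [AddCommGroup M] [Module ℂ M]
    [AddCommGroup N] [Module ℂ N] (r : ℂ) (m : M) (n : N) :
    (r • m) ⊗ₜ[ℂ] n = r • (m ⊗ₜ[ℂ] n) := rfl

set_option linter.unusedSimpArgs false in
theorem comulGen_rel (q : Set.Ioo (0 : ℝ) 1) :
    comulGen q .als * comulGen q .al + comulGen q .gas * comulGen q .ga = 1 ∧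
    comulGen q .al * comulGen q .als + (qc q) ^ 2 • (comulGen q .ga * comulGen q .gas) = 1 ∧
    comulGen q .gas * comulGen q .ga = comulGen q .ga * comulGen q .gas ∧
    comulGen q .al * comulGen q .ga = qc q • (comulGen q .ga * comulGen q .al) ∧
    comulGen q .al * comulGen q .gas = qc q • (comulGen q .gas * comulGen q .al) ∧
    comulGen q .gas * comulGen q .als = qc q • (comulGen q .als * comulGen q .gas) ∧
    comulGen q .ga * comulGen q .als = qc q • (comulGen q .als * comulGen q .ga) := by
  refine ⟨?_, ?_, ?_, ?_, ?_, ?_, ?_⟩ <;>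
  · simp only [comulGen, mul_add, add_mul, mul_sub, sub_mul, smul_mul_assoc, mul_smul_comm,
      Algebra.TensorProduct.tmul_mul_tmul, rel₁', rel₂', rel₃, rel₄, rel₅, rel₆, rel₇,
      TensorProduct.tmul_smul, smul_tmul_out, TensorProduct.tmul_sub,
      TensorProduct.sub_tmul, Algebra.TensorProduct.one_def]
    module

/-- The comultiplication of `O_q(SU(2))`:
`Δ(α) = α ⊗ α - q γ* ⊗ γ`, `Δ(γ) = γ ⊗ α + α* ⊗ γ`, and the adjoint formulas. -/
def comulA (q : Set.Ioo (0 : ℝ) 1) : OqSU2 q →ₐ[ℂ] OqSU2 q ⊗[ℂ] OqSU2 q :=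
  liftA q (comulGen q) (comulGen_rel q).1 (comulGen_rel q).2.1 (comulGen_rel q).2.2.1
    (comulGen_rel q).2.2.2.1 (comulGen_rel q).2.2.2.2.1 (comulGen_rel q).2.2.2.2.2.1
    (comulGen_rel q).2.2.2.2.2.2

set_option linter.unusedSimpArgs false in
instance (q : Set.Ioo (0 : ℝ) 1) : Bialgebra ℂ (OqSU2 q) :=
  Bialgebra.ofAlgHom (comulA q) (counitA q)
    (by
      apply algHom_ext
      intro g
      cases g <;>
      · simp [comulA, comulGen, TensorProduct.tmul_add, TensorProduct.add_tmul,
          TensorProduct.tmul_sub, TensorProduct.sub_tmul, TensorProduct.tmul_smul,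
          smul_tmul_out]
        try module)
    (by
      apply algHom_ext
      intro g
      cases g <;> simp [comulA, comulGen, counitA, counitGen])
    (by
      apply algHom_ext
      intro g
      cases g <;> simp [comulA, comulGen, counitA, counitGen])

theorem comul_eq (q : Set.Ioo (0 : ℝ) 1) (c : OqSU2 q) :
    Coalgebra.comul (R := ℂ) c = comulA q c := rfl

theorem counit_eq (q : Set.Ioo (0 : ℝ) 1) (c : OqSU2 q) :
    Coalgebra.counit (R := ℂ) c = counitA q c := rfl

/-! ### The dual algebra and the pairing with `U_q(su(2))` -/

/-- The algebra `𝓤` of all linear functionals on `O_q(SU(2))`, with the convolution product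
`(x y)(c) = x(c₍₁₎) y(c₍₂₎)`.  The unitary pairing `h ↦ (·, h)` maps `U_q(su(2))` into it. -/
abbrev Dual (q : Set.Ioo (0 : ℝ) 1) : Type := WithConv (OqSU2 q →ₗ[ℂ] ℂ)

/-- The values of the pairing with `k` on the generators. -/
def kGen (q : Set.Ioo (0 : ℝ) 1) : Gen → ℂ
  | .al => qc q
  | .als => (qc q)⁻¹
  | .ga => 0
  | .gas => 0

/-- The values of the pairing with `k⁻¹` on the generators. -/
def kInvGen (q : Set.Ioo (0 : ℝ) 1) : Gen → ℂ
  | .al => (qc q)⁻¹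
  | .als => qc q
  | .ga => 0
  | .gas => 0

/-- The values of the pairing with `e` on the generators: `(-q γ*, e) = q ^ (1/2)`, the other
entries of the fundamental matrix pair to zero. -/
def eGen (q : Set.Ioo (0 : ℝ) 1) : Gen → ℂ
  | .gas => -(qpow q (1 / 2) * (qc q)⁻¹)
  | _ => 0

/-- The values of the pairing with `f` on the generators: `(γ, f) = q ^ (-1/2)`, the other
entries of the fundamental matrix pair to zero. -/
def fGen (q : Set.Ioo (0 : ℝ) 1) : Gen → ℂ
  | .ga => qpow q (-(1 / 2))
  | _ => 0

/-- The character `(·, k)`. -/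
def kHom (q : Set.Ioo (0 : ℝ) 1) : OqSU2 q →ₐ[ℂ] ℂ :=
  liftA q (kGen q) (by simp [kGen, qc_ne_zero]) (by simp [kGen, qc_ne_zero]) (by simp [kGen])
    (by simp [kGen]) (by simp [kGen]) (by simp [kGen]) (by simp [kGen])

/-- The character `(·, k⁻¹)`. -/
def kInvHom (q : Set.Ioo (0 : ℝ) 1) : OqSU2 q →ₐ[ℂ] ℂ :=
  liftA q (kInvGen q) (by simp [kInvGen, qc_ne_zero]) (by simp [kInvGen, qc_ne_zero])
    (by simp [kInvGen]) (by simp [kInvGen]) (by simp [kInvGen]) (by simp [kInvGen])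
    (by simp [kInvGen])

/-- As `Δ(e) = e ⊗ 1 + k ⊗ e`, the map `c ↦ [[(c, k), (c, e)], [0, (c, 1)]]` is multiplicative. -/
def eMat (q : Set.Ioo (0 : ℝ) 1) : OqSU2 q →ₐ[ℂ] Matrix (Fin 2) (Fin 2) ℂ :=
  liftA q (fun g => !![kGen q g, eGen q g; 0, counitGen g])
    (by ext i j; fin_cases i <;> fin_cases j <;> simp [kGen, eGen, counitGen, qc_ne_zero])
    (by ext i j; fin_cases i <;> fin_cases j <;> simp [kGen, eGen, counitGen, qc_ne_zero])
    (by ext i j; fin_cases i <;> fin_cases j <;> simp [kGen, eGen, counitGen])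
    (by ext i j; fin_cases i <;> fin_cases j <;> simp [kGen, eGen, counitGen])
    (by ext i j; fin_cases i <;> fin_cases j <;> simp [kGen, eGen, counitGen])
    (by ext i j; fin_cases i <;> fin_cases j <;> simp [kGen, eGen, counitGen, qc_ne_zero])
    (by ext i j; fin_cases i <;> fin_cases j <;> simp [kGen, eGen, counitGen])

/-- As `Δ(f) = 1 ⊗ f + f ⊗ k⁻¹`, the map `c ↦ [[(c, 1), (c, f)], [0, (c, k⁻¹)]]` is
multiplicative. -/
def fMat (q : Set.Ioo (0 : ℝ) 1) : OqSU2 q →ₐ[ℂ] Matrix (Fin 2) (Fin 2) ℂ :=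
  liftA q (fun g => !![counitGen g, fGen q g; 0, kInvGen q g])
    (by ext i j; fin_cases i <;> fin_cases j <;> simp [kInvGen, fGen, counitGen, qc_ne_zero])
    (by ext i j; fin_cases i <;> fin_cases j <;> simp [kInvGen, fGen, counitGen, qc_ne_zero])
    (by ext i j; fin_cases i <;> fin_cases j <;> simp [kInvGen, fGen, counitGen])
    (by ext i j; fin_cases i <;> fin_cases j <;>
      simp [kInvGen, fGen, counitGen, qc_ne_zero, mul_comm])
    (by ext i j; fin_cases i <;> fin_cases j <;> simp [kInvGen, fGen, counitGen])
    (by ext i j; fin_cases i <;> fin_cases j <;> simp [kInvGen, fGen, counitGen])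
    (by ext i j; fin_cases i <;> fin_cases j <;>
      simp [kInvGen, fGen, counitGen, mul_comm])

/-- The element `k` of `U_q(su(2)) ⊆ 𝓤`. -/
def kU (q : Set.Ioo (0 : ℝ) 1) : Dual q := WithConv.toConv (kHom q).toLinearMap

/-- The element `e` of `U_q(su(2)) ⊆ 𝓤`. -/
def eU (q : Set.Ioo (0 : ℝ) 1) : Dual q :=
  WithConv.toConv (Matrix.entryLinearMap ℂ ℂ (0 : Fin 2) (1 : Fin 2) ∘ₗ (eMat q).toLinearMap)

/-- The element `f` of `U_q(su(2)) ⊆ 𝓤`. -/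
def fU (q : Set.Ioo (0 : ℝ) 1) : Dual q :=
  WithConv.toConv (Matrix.entryLinearMap ℂ ℂ (0 : Fin 2) (1 : Fin 2) ∘ₗ (fMat q).toLinearMap)

/-- The element `q ^ (-1/2) (e - f k)`. -/
def pU (q : Set.Ioo (0 : ℝ) 1) : Dual q := qpow q (-(1 / 2)) • (eU q - fU q * kU q)

/-- The element `B_t = q ^ (-1/2) (e - f k) - √-1 (q - q⁻¹)⁻¹ t k` for `t = ⟦a⟧`. -/
def Bt (q : Set.Ioo (0 : ℝ) 1) (a : ℝ) : Dual q :=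
  pU q - (Complex.I * (qc q - (qc q)⁻¹)⁻¹ * dbr q a) • kU q

/-- The right action `c ◁ h = (c₍₁₎, h) c₍₂₎` of `h ∈ 𝓤` on `O_q(SU(2))`. -/
def actR (q : Set.Ioo (0 : ℝ) 1) (h : Dual q) : OqSU2 q →ₗ[ℂ] OqSU2 q :=
  (TensorProduct.lid ℂ (OqSU2 q)).toLinearMap ∘ₗ h.ofConv.rTensor (OqSU2 q) ∘ₗ Coalgebra.comul

/-- The right translate `x ◁ c`, where `(x ◁ c)(d) = x(c d)`, of a functional `x` by `c`. -/
def transl {q : Set.Ioo (0 : ℝ) 1} (x : Dual q) (c : OqSU2 q) : Dual q :=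
  WithConv.toConv (x.ofConv ∘ₗ LinearMap.mulLeft ℂ c)

/-- Upper triangular two-dimensional representations of `O_q(SU(2))`. -/
theorem upper_tri {q : Set.Ioo (0 : ℝ) 1} (F : OqSU2 q →ₐ[ℂ] Matrix (Fin 2) (Fin 2) ℂ)
    (k l : OqSU2 q →ₐ[ℂ] ℂ) (h10 : ∀ g, F (gen q g) 1 0 = 0)
    (h00 : ∀ g, F (gen q g) 0 0 = k (gen q g)) (h11 : ∀ g, F (gen q g) 1 1 = l (gen q g))
    (c : OqSU2 q) : F c 1 0 = 0 ∧ F c 0 0 = k c ∧ F c 1 1 = l c := by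
  obtain ⟨c, rfl⟩ := RingQuot.mkAlgHom_surjective ℂ (SURel q) c
  induction c using FreeAlgebra.induction with
  | grade0 r =>
    rw [AlgHom.commutes]
    have h1 := F.commutes r
    have h2 := k.commutes r
    have h3 := l.commutes r
    refine ⟨?_, ?_, ?_⟩
    · exact (congrFun (congrFun h1 1) 0).trans (by simp [Matrix.algebraMap_eq_diagonal])
    · exact (congrFun (congrFun h1 0) 0).trans
        ((by simp [Matrix.algebraMap_eq_diagonal] : _ = r).trans h2.symm)
    · exact (congrFun (congrFun h1 1) 1).trans
        ((by simp [Matrix.algebraMap_eq_diagonal] : _ = r).trans h3.symm)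
  | grade1 g => exact ⟨h10 g, h00 g, h11 g⟩
  | mul c d hc hd =>
    obtain ⟨c1, c2, c3⟩ := hc
    obtain ⟨d1, d2, d3⟩ := hd
    rw [map_mul (RingQuot.mkAlgHom ℂ (SURel q))]
    refine ⟨?_, ?_, ?_⟩
    · refine (congrFun (congrFun (map_mul F _ _) 1) 0).trans ?_
      simp [Matrix.mul_apply, Fin.sum_univ_two, c1, d1]
    · refine (congrFun (congrFun (map_mul F _ _) 0) 0).trans (Eq.trans ?_ (map_mul k _ _).symm)
      simp [Matrix.mul_apply, Fin.sum_univ_two, c2, d2, d1]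
    · refine (congrFun (congrFun (map_mul F _ _) 1) 1).trans (Eq.trans ?_ (map_mul l _ _).symm)
      simp [Matrix.mul_apply, Fin.sum_univ_two, c3, d3, c1]
  | add c d hc hd =>
    obtain ⟨c1, c2, c3⟩ := hc
    obtain ⟨d1, d2, d3⟩ := hd
    rw [map_add (RingQuot.mkAlgHom ℂ (SURel q))]
    refine ⟨?_, ?_, ?_⟩
    · refine (congrFun (congrFun (map_add F _ _) 1) 0).trans ?_
      simp [c1, d1]
    · refine (congrFun (congrFun (map_add F _ _) 0) 0).trans (Eq.trans ?_ (map_add k _ _).symm)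
      simp [c2, d2]
    · refine (congrFun (congrFun (map_add F _ _) 1) 1).trans (Eq.trans ?_ (map_add l _ _).symm)
      simp [c3, d3]

@[simp] theorem counitA_gen (q : Set.Ioo (0 : ℝ) 1) (g : Gen) :
    counitA q (gen q g) = counitGen g := by simp [counitA]
@[simp] theorem comulA_gen (q : Set.Ioo (0 : ℝ) 1) (g : Gen) :
    comulA q (gen q g) = comulGen q g := by simp [comulA]
@[simp] theorem kHom_gen (q : Set.Ioo (0 : ℝ) 1) (g : Gen) :
    kHom q (gen q g) = kGen q g := by simp [kHom]
@[simp] theorem kInvHom_gen (q : Set.Ioo (0 : ℝ) 1) (g : Gen) :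
    kInvHom q (gen q g) = kInvGen q g := by simp [kInvHom]

theorem kU_apply (q : Set.Ioo (0 : ℝ) 1) (c : OqSU2 q) : kU q c = kHom q c := rfl
theorem eU_apply (q : Set.Ioo (0 : ℝ) 1) (c : OqSU2 q) : eU q c = eMat q c 0 1 := rfl
theorem fU_apply (q : Set.Ioo (0 : ℝ) 1) (c : OqSU2 q) : fU q c = fMat q c 0 1 := rfl

theorem eU_gen (q : Set.Ioo (0 : ℝ) 1) (g : Gen) : eU q (gen q g) = eGen q g := by
  simp [eU_apply, eMat]
theorem fU_gen (q : Set.Ioo (0 : ℝ) 1) (g : Gen) : fU q (gen q g) = fGen q g := by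
  simp [fU_apply, fMat]

theorem eU_mul (q : Set.Ioo (0 : ℝ) 1) (c d : OqSU2 q) :
    eU q (c * d) = kHom q c * eU q d + eU q c * counitA q d := by
  have h := upper_tri (eMat q) (kHom q) (counitA q) (by simp [eMat]) (by simp [eMat])
    (by simp [eMat])
  simp only [eU_apply, map_mul, Matrix.mul_apply, Fin.sum_univ_two, (h c).2.1, (h d).2.2]

theorem fU_mul (q : Set.Ioo (0 : ℝ) 1) (c d : OqSU2 q) :
    fU q (c * d) = counitA q c * fU q d + fU q c * kInvHom q d := by
  have h := upper_tri (fMat q) (counitA q) (kInvHom q) (by simp [fMat]) (by simp [fMat])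
    (by simp [fMat])
  simp only [fU_apply, map_mul, Matrix.mul_apply, Fin.sum_univ_two, (h c).2.1, (h d).2.2]

/-- `k⁻¹ k = 1`. -/
theorem kInv_k (q : Set.Ioo (0 : ℝ) 1) (c : OqSU2 q) :
    LinearMap.mul' ℂ ℂ (TensorProduct.map (kInvHom q).toLinearMap (kHom q).toLinearMap
      (comulA q c)) = counitA q c := by
  have h : ((Algebra.TensorProduct.lmul' ℂ (S := ℂ)).comp
      ((Algebra.TensorProduct.map (kInvHom q) (kHom q)).comp (comulA q))) = counitA q := by
    apply algHom_ext
    intro g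
    cases g <;> simp [comulGen, kGen, kInvGen, counitGen, qc_ne_zero]
  exact congrArg (fun F : OqSU2 q →ₐ[ℂ] ℂ => F c) h

/-- `1 k = k`. -/
theorem one_k (q : Set.Ioo (0 : ℝ) 1) (c : OqSU2 q) :
    LinearMap.mul' ℂ ℂ (TensorProduct.map (counitA q).toLinearMap (kHom q).toLinearMap
      (comulA q c)) = kHom q c := by
  have h : ((Algebra.TensorProduct.lmul' ℂ (S := ℂ)).comp
      ((Algebra.TensorProduct.map (counitA q) (kHom q)).comp (comulA q))) = kHom q := by
    apply algHom_ext
    intro g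
    cases g <;> simp [comulGen, kGen, counitGen]
  exact congrArg (fun F : OqSU2 q →ₐ[ℂ] ℂ => F c) h

/-- `Δ(f k) = k ⊗ f k + f k ⊗ 1`. -/
theorem fkU_mul (q : Set.Ioo (0 : ℝ) 1) (c d : OqSU2 q) :
    (fU q * kU q) (c * d) = kHom q c * (fU q * kU q) d + (fU q * kU q) c * counitA q d := by
  have key : ∀ X Y : OqSU2 q ⊗[ℂ] OqSU2 q,
      LinearMap.mul' ℂ ℂ (TensorProduct.map (fU q).ofConv (kU q).ofConv (X * Y)) =
      LinearMap.mul' ℂ ℂ (TensorProduct.map (counitA q).toLinearMap (kHom q).toLinearMap X) *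
      LinearMap.mul' ℂ ℂ (TensorProduct.map (fU q).ofConv (kU q).ofConv Y) +
      LinearMap.mul' ℂ ℂ (TensorProduct.map (fU q).ofConv (kU q).ofConv X) *
      LinearMap.mul' ℂ ℂ (TensorProduct.map (kInvHom q).toLinearMap (kHom q).toLinearMap Y) := by
    intro X Y
    induction X using TensorProduct.induction_on with
    | zero => simp
    | add X₁ X₂ h₁ h₂ => rw [add_mul, map_add, map_add, h₁, h₂]; simp only [map_add]; ring
    | tmul c₁ c₂ =>
      induction Y using TensorProduct.induction_on with
      | zero => simp
      | add Y₁ Y₂ h₁ h₂ => rw [mul_add, map_add, map_add, h₁, h₂]; simp only [map_add]; ring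
      | tmul d₁ d₂ =>
        simp only [Algebra.TensorProduct.tmul_mul_tmul, TensorProduct.map_tmul,
          LinearMap.mul'_apply, fU_mul, kU_apply, map_mul, AlgHom.toLinearMap_apply]
        ring
  simp only [LinearMap.convMul_apply, comul_eq]
  rw [map_mul (comulA q), key, one_k, kInv_k]

/-- `Δ(P) = k ⊗ P + P ⊗ 1` for `P = q ^ (-1/2) (e - f k)`. -/
theorem pU_mul (q : Set.Ioo (0 : ℝ) 1) (c d : OqSU2 q) :
    pU q (c * d) = kHom q c * pU q d + pU q c * counitA q d := by
  have h : ∀ c, pU q c = qpow q (-(1 / 2)) * (eU q c - (fU q * kU q) c) := fun c => rfl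
  rw [h, h, h, eU_mul, fkU_mul]
  ring

theorem qpow_half (q : Set.Ioo (0 : ℝ) 1) : qpow q (-(1 / 2)) * qpow q (1 / 2) = 1 := by
  have h : (q : ℝ) ^ (-(1 / 2) : ℝ) * (q : ℝ) ^ ((1 / 2) : ℝ) = 1 := by
    rw [← Real.rpow_add q.2.1]; simp
  simp only [qpow]
  exact_mod_cast h

theorem qpow_half_sq (q : Set.Ioo (0 : ℝ) 1) :
    qpow q (-(1 / 2)) * qpow q (-(1 / 2)) = (qc q)⁻¹ := by
  have h : (q : ℝ) ^ (-(1 / 2) : ℝ) * (q : ℝ) ^ (-(1 / 2) : ℝ) = (q : ℝ)⁻¹ := by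
    rw [← Real.rpow_add q.2.1, ← Real.rpow_neg_one]; norm_num
  simp only [qpow, qc]
  exact_mod_cast h

/-- The values of `P = q ^ (-1/2) (e - f k)` on the generators. -/
def pGen (q : Set.Ioo (0 : ℝ) 1) : Gen → ℂ
  | .al => 0
  | .als => 0
  | .ga => -1
  | .gas => -(qc q)⁻¹

theorem pU_gen (q : Set.Ioo (0 : ℝ) 1) (g : Gen) : pU q (gen q g) = pGen q g := by
  have h : ∀ c, pU q c = qpow q (-(1 / 2)) * (eU q c - (fU q * kU q) c) := fun c => rfl
  have h1 := qpow_half q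
  have h2 := qpow_half_sq q
  rw [h, eU_gen, LinearMap.convMul_apply, comul_eq]
  cases g <;> simp only [comulA_gen, comulGen, map_add, map_sub, map_smul, TensorProduct.map_tmul,
    LinearMap.mul'_apply, fU_gen, kU_apply, kHom_gen, fGen, kGen, eGen, pGen, smul_eq_mul,
    zero_mul, mul_zero, sub_zero, add_zero]
  · linear_combination (-(qc q)) * h2 - mul_inv_cancel₀ (qc_ne_zero q)
  · linear_combination (-(qc q)⁻¹) * h1

theorem pU_one (q : Set.Ioo (0 : ℝ) 1) : pU q 1 = 0 := by
  have h := pU_mul q 1 1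
  simp only [mul_one, map_one, one_mul] at h
  simpa using! h

theorem Bt_apply (q : Set.Ioo (0 : ℝ) 1) (a : ℝ) (c : OqSU2 q) :
    Bt q a c = pU q c - Complex.I * br q a * kHom q c := by
  have h : Bt q a c =
    pU q c - (Complex.I * (qc q - (qc q)⁻¹)⁻¹ * dbr q a) * kHom q c := rfl
  rw [h, br]
  ring

/-- `ε(B_t) = -√-1 [a]`. -/
theorem Bt_one (q : Set.Ioo (0 : ℝ) 1) (a : ℝ) : Bt q a 1 = -(Complex.I * br q a) := by
  rw [Bt_apply, pU_one, map_one]; ring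

theorem actR_eq (q : Set.Ioo (0 : ℝ) 1) (h : Dual q) (c : OqSU2 q) :
    actR q h c = TensorProduct.lid ℂ (OqSU2 q) (h.ofConv.rTensor (OqSU2 q) (comulA q c)) := rfl

/-- The action of an element `h ∈ 𝓤` with `Δ(h) = k ⊗ h + p ⊗ 1` on a product. -/
theorem actR_mul {q : Set.Ioo (0 : ℝ) 1} (h k p : Dual q)
    (H : ∀ c d, h (c * d) = k c * h d + p c * counitA q d) (c d : OqSU2 q) :
    actR q h (c * d) = actR q k c * actR q h d + actR q p c * d := by
  have key : ∀ X Y : OqSU2 q ⊗[ℂ] OqSU2 q,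
      TensorProduct.lid ℂ (OqSU2 q) (h.ofConv.rTensor (OqSU2 q) (X * Y)) =
      TensorProduct.lid ℂ (OqSU2 q) (k.ofConv.rTensor (OqSU2 q) X) *
      TensorProduct.lid ℂ (OqSU2 q) (h.ofConv.rTensor (OqSU2 q) Y) +
      TensorProduct.lid ℂ (OqSU2 q) (p.ofConv.rTensor (OqSU2 q) X) *
      TensorProduct.lid ℂ (OqSU2 q) ((counitA q).toLinearMap.rTensor (OqSU2 q) Y) := by
    intro X Y
    induction X using TensorProduct.induction_on with
    | zero => simp
    | add X₁ X₂ h₁ h₂ =>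
      rw [add_mul, map_add, map_add, h₁, h₂]; simp only [map_add, add_mul]; abel
    | tmul c₁ c₂ =>
      induction Y using TensorProduct.induction_on with
      | zero => simp
      | add Y₁ Y₂ h₁ h₂ =>
        rw [mul_add, map_add, map_add, h₁, h₂]; simp only [map_add, mul_add]; abel
      | tmul d₁ d₂ =>
        simp only [Algebra.TensorProduct.tmul_mul_tmul, LinearMap.rTensor_tmul, H,
          TensorProduct.lid_tmul, AlgHom.toLinearMap_apply, smul_mul_smul_comm, add_smul]
  have hd : TensorProduct.lid ℂ (OqSU2 q)
      ((counitA q).toLinearMap.rTensor (OqSU2 q) (comulA q d)) = d := by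
    have h1 := Coalgebra.rTensor_counit_comul (R := ℂ) d
    have h2 : (counitA q).toLinearMap.rTensor (OqSU2 q) (comulA q d) = 1 ⊗ₜ[ℂ] d := h1
    rw [h2]; simp
  rw [actR_eq, map_mul (comulA q), key, hd]
  rfl

theorem Bt_mul (q : Set.Ioo (0 : ℝ) 1) (a : ℝ) (c d : OqSU2 q) :
    Bt q a (c * d) = kU q c * Bt q a d + pU q c * counitA q d := by
  rw [Bt_apply, Bt_apply, pU_mul, kU_apply, map_mul]; ring

theorem actR_Bt (q : Set.Ioo (0 : ℝ) 1) (a : ℝ) (c : OqSU2 q) :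
    actR q (Bt q a) c = actR q (pU q) c - (Complex.I * br q a) • actR q (kU q) c := by
  have h : ∀ X : OqSU2 q ⊗[ℂ] OqSU2 q,
      TensorProduct.lid ℂ (OqSU2 q) ((Bt q a).ofConv.rTensor (OqSU2 q) X) =
      TensorProduct.lid ℂ (OqSU2 q) ((pU q).ofConv.rTensor (OqSU2 q) X) -
      (Complex.I * br q a) •
        TensorProduct.lid ℂ (OqSU2 q) ((kU q).ofConv.rTensor (OqSU2 q) X) := by
    intro X
    induction X using TensorProduct.induction_on with
    | zero => simp
    | add X₁ X₂ h₁ h₂ => simp only [map_add, h₁, h₂, smul_add]; abel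
    | tmul c₁ c₂ =>
      simp only [LinearMap.rTensor_tmul, TensorProduct.lid_tmul, Bt_apply, kU_apply]
      module
  exact h _

/-- The Podleś sphere `O_q(S_t²) = {c ∈ O_q(SU(2)) | c ◁ B_t = ε(B_t) c}`, where `t = ⟦a⟧` and
`ε(h) = h(1)` for `h ∈ 𝓤`. -/
def podles (q : Set.Ioo (0 : ℝ) 1) (a : ℝ) : Subalgebra ℂ (OqSU2 q) where
  carrier := {c | actR q (Bt q a) c = Bt q a 1 • c}
  add_mem' := by
    intro c d hc hd
    simp only [Set.mem_ofPred_eq] at *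
    rw [map_add, hc, hd, smul_add]
  mul_mem' := by
    intro c d hc hd
    simp only [Set.mem_ofPred_eq] at *
    rw [actR_mul _ _ _ (Bt_mul q a), hd, mul_smul_comm, ← smul_mul_assoc, ← add_mul,
      ← smul_mul_assoc, ← hc, actR_Bt, Bt_one]
    congr 1
    module
  algebraMap_mem' := by
    intro r
    simp only [Set.mem_ofPred_eq]
    rw [Algebra.algebraMap_eq_smul_one, map_smul, actR_eq, map_one,
      Algebra.TensorProduct.one_def, LinearMap.rTensor_tmul, TensorProduct.lid_tmul, smul_comm]

/-! ### Generators of the Podleś sphere and the elements `A_b` -/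

/-- `X = α² + q γ² - √-1 q t γ α` with `t = ⟦a⟧`. -/
def podX (q : Set.Ioo (0 : ℝ) 1) (a : ℝ) : OqSU2 q :=
  gen q .al * gen q .al + qc q • (gen q .ga * gen q .ga)
    - (Complex.I * qc q * dbr q a) • (gen q .ga * gen q .al)

/-- `X* = (α*)² + q (γ*)² + √-1 q t α* γ*`. -/
def podXs (q : Set.Ioo (0 : ℝ) 1) (a : ℝ) : OqSU2 q :=
  gen q .als * gen q .als + qc q • (gen q .gas * gen q .gas)
    + (Complex.I * qc q * dbr q a) • (gen q .als * gen q .gas)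

/-- `Y = γ α* - α γ* + √-1 q t γ γ*`. -/
def podY (q : Set.Ioo (0 : ℝ) 1) (a : ℝ) : OqSU2 q :=
  gen q .ga * gen q .als - gen q .al * gen q .gas
    + (Complex.I * qc q * dbr q a) • (gen q .ga * gen q .gas)

/-- The element `A_b = q⁻¹ X + q X* + √-1 ⟦b⟧ Y`.  On vectors on which `√-1 B_t` acts as `[b]` it
acts as the self-adjoint central element `Ω = q⁻¹ X + q X* + √-1 (q - q⁻¹) Y (√-1 B_t)`. -/
def casA (q : Set.Ioo (0 : ℝ) 1) (a b : ℝ) : OqSU2 q :=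
  (qc q)⁻¹ • podX q a + qc q • podXs q a + (Complex.I * dbr q b) • podY q a

theorem actR_gen (q : Set.Ioo (0 : ℝ) 1) (h : Dual q) (g : Gen) :
    actR q h (gen q g) = TensorProduct.lid ℂ (OqSU2 q)
      (h.ofConv.rTensor (OqSU2 q) (comulGen q g)) := by
  rw [actR_eq, comulA_gen]

theorem actR_kU_gen (q : Set.Ioo (0 : ℝ) 1) (g : Gen) :
    actR q (kU q) (gen q g) =
      (match g with | .al => qc q | .als => (qc q)⁻¹ | .ga => (qc q)⁻¹ | .gas => qc q) •
        gen q g := by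
  rw [actR_gen]
  cases g <;> simp [comulGen, kU, kGen]

theorem actR_pU_al (q : Set.Ioo (0 : ℝ) 1) : actR q (pU q) (gen q .al) = gen q .ga := by
  rw [actR_gen]
  simp [comulGen, pU_gen, pGen, qc_ne_zero, smul_smul]
theorem actR_pU_als (q : Set.Ioo (0 : ℝ) 1) :
    actR q (pU q) (gen q .als) = qc q • gen q .gas := by
  rw [actR_gen]
  simp [comulGen, pU_gen, pGen]
theorem actR_pU_ga (q : Set.Ioo (0 : ℝ) 1) : actR q (pU q) (gen q .ga) = -gen q .al := by
  rw [actR_gen]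
  simp [comulGen, pU_gen, pGen]
theorem actR_pU_gas (q : Set.Ioo (0 : ℝ) 1) :
    actR q (pU q) (gen q .gas) = -((qc q)⁻¹ • gen q .als) := by
  rw [actR_gen]
  simp [comulGen, pU_gen, pGen]

theorem dbr_eq (q : Set.Ioo (0 : ℝ) 1) (a : ℝ) : dbr q a = br q a * (qc q - (qc q)⁻¹) := by
  rw [br, div_mul_cancel₀ _ (qc_sub_inv_ne_zero q)]

theorem podX_mem (q : Set.Ioo (0 : ℝ) 1) (a : ℝ) : podX q a ∈ podles q a := by
  change actR q (Bt q a) (podX q a) = Bt q a 1 • podX q a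
  simp only [podX, map_add, map_sub, map_smul, actR_mul _ _ _ (Bt_mul q a), actR_Bt, actR_kU_gen,
    actR_pU_al, actR_pU_ga, Bt_one, dbr_eq, smul_mul_assoc, mul_smul_comm, mul_sub, mul_neg,
    neg_mul]
  match_scalars <;> field_simp [qc_ne_zero q] <;> ring_nf

theorem podXs_mem (q : Set.Ioo (0 : ℝ) 1) (a : ℝ) : podXs q a ∈ podles q a := by
  change actR q (Bt q a) (podXs q a) = Bt q a 1 • podXs q a
  simp only [podXs, map_add, map_smul, actR_mul _ _ _ (Bt_mul q a), actR_Bt, actR_kU_gen,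
    actR_pU_als, actR_pU_gas, Bt_one, dbr_eq, smul_mul_assoc, mul_smul_comm, mul_sub, mul_neg,
    neg_mul]
  match_scalars <;> field_simp [qc_ne_zero q] <;> ring_nf

theorem podY_mem (q : Set.Ioo (0 : ℝ) 1) (a : ℝ) : podY q a ∈ podles q a := by
  change actR q (Bt q a) (podY q a) = Bt q a 1 • podY q a
  simp only [podY, map_add, map_sub, map_smul, actR_mul _ _ _ (Bt_mul q a), actR_Bt, actR_kU_gen,
    actR_pU_al, actR_pU_ga,
    actR_pU_als, actR_pU_gas, Bt_one, dbr_eq, smul_mul_assoc, mul_smul_comm, mul_sub, mul_neg,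
    neg_mul]
  match_scalars <;> field_simp [qc_ne_zero q] <;> ring_nf

/-- `A_b` as an element of the Podleś sphere. -/
def casB (q : Set.Ioo (0 : ℝ) 1) (a b : ℝ) : podles q a :=
  ⟨casA q a b, add_mem (add_mem (Subalgebra.smul_mem _ (podX_mem q a) _)
    (Subalgebra.smul_mem _ (podXs_mem q a) _)) (Subalgebra.smul_mem _ (podY_mem q a) _)⟩

theorem counitA_casA (q : Set.Ioo (0 : ℝ) 1) (a b : ℝ) :
    counitA q (casA q a b) = qc q + (qc q)⁻¹ := by
  simp only [casA, podX, podXs, podY, map_add, map_sub, map_smul, map_mul, counitA_gen, counitGen,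
    smul_eq_mul]
  ring

/-! ### The algebra `I_c` -/

/-- The operator `c ↦ c ◁ (√-1 B_t)` on `O_q(SU(2))`; it is diagonalizable with eigenvalues
`[a + n]`, `n ∈ ℤ`. -/
def weightOp (q : Set.Ioo (0 : ℝ) 1) (a : ℝ) : Module.End ℂ (OqSU2 q) :=
  actR q (Complex.I • Bt q a)

theorem weightOp_apply (q : Set.Ioo (0 : ℝ) 1) (a : ℝ) (c : OqSU2 q) :
    weightOp q a c = Complex.I • actR q (Bt q a) c := by
  simp [weightOp, actR, LinearMap.rTensor_smul]

/-- The weights `[a + n]`. -/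
def wt (q : Set.Ioo (0 : ℝ) 1) (a : ℝ) (n : ℤ) : ℂ := br q (a + n)

theorem wt_injective (q : Set.Ioo (0 : ℝ) 1) (a : ℝ) : Function.Injective (wt q a) := by
  intro m n h
  have h1 := br_injective q h
  exact_mod_cast add_left_cancel h1

theorem exists_weightProj (q : Set.Ioo (0 : ℝ) 1) (a : ℝ) (n : ℤ) :
    ∃ x : Dual q, ∀ (m : ℤ) (c : OqSU2 q), weightOp q a c = wt q a m • c →
      x c = if m = n then counitA q c else 0 := by
  have hind : iSupIndep fun m : ℤ => (weightOp q a).eigenspace (wt q a m) :=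
    (Module.End.eigenspaces_iSupIndep (weightOp q a)).comp (wt_injective q a)
  have hinj := hind.dfinsupp_lsum_injective
  obtain ⟨h, hh⟩ := LinearMap.exists_leftInverse_of_injective _ (LinearMap.ker_eq_bot.2 hinj)
  refine ⟨WithConv.toConv ((counitA q).toLinearMap ∘ₗ
    (((weightOp q a).eigenspace (wt q a n)).subtype ∘ₗ DFinsupp.lapply n) ∘ₗ h), ?_⟩
  intro m c hc
  have hc' : c ∈ (weightOp q a).eigenspace (wt q a m) := Module.End.mem_eigenspace_iff.2 hc
  have h1 := LinearMap.congr_fun hh (DFinsupp.single m ⟨c, hc'⟩)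
  simp only [LinearMap.comp_apply, LinearMap.id_apply, DFinsupp.lsum_single,
    Submodule.subtype_apply] at h1
  simp only [LinearMap.comp_apply, h1, DFinsupp.lapply_apply, Submodule.subtype_apply,
    AlgHom.toLinearMap_apply]
  by_cases hmn : m = n
  · subst hmn; simp
  · simp [hmn, DFinsupp.single_eq_of_ne (Ne.symm hmn)]

/-- The spectral projection `Φ_n ∈ 𝓘 ⊆ 𝓤` of `√-1 B_t` for the eigenvalue `[a + n]`, that is, the
functional that equals `ε` on the eigenspace `{c | c ◁ (√-1 B_t) = [a + n] c}` and vanishes on the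
other eigenspaces.  (It is unique, as `O_q(SU(2))` is the direct sum of these eigenspaces.) -/
def weightProj (q : Set.Ioo (0 : ℝ) 1) (a : ℝ) (n : ℤ) : Dual q := (exists_weightProj q a n).choose

theorem weightProj_spec (q : Set.Ioo (0 : ℝ) 1) (a : ℝ) (n m : ℤ) (c : OqSU2 q)
    (hc : weightOp q a c = wt q a m • c) :
    weightProj q a n c = if m = n then counitA q c else 0 :=
  (exists_weightProj q a n).choose_spec m c hc

/-- `I_c = ⨁ₙ ℂ Φ_n ⊆ 𝓘 ⊆ 𝓤`. -/
def Ic (q : Set.Ioo (0 : ℝ) 1) (a : ℝ) : Submodule ℂ (Dual q) :=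
  Submodule.span ℂ (Set.range (weightProj q a))

/-- `Φ_n` as an element of `I_c`. -/
def projI (q : Set.Ioo (0 : ℝ) 1) (a : ℝ) (n : ℤ) : Ic q a :=
  ⟨weightProj q a n, Submodule.subset_span ⟨n, rfl⟩⟩

theorem weightProj_podles (q : Set.Ioo (0 : ℝ) 1) (a : ℝ) (n : ℤ) (b : OqSU2 q)
    (hb : b ∈ podles q a) : weightProj q a n b = if 0 = n then counitA q b else 0 := by
  apply weightProj_spec
  have hb' : actR q (Bt q a) b = Bt q a 1 • b := hb
  rw [weightOp_apply, hb', Bt_one, wt, smul_smul]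
  congr 1
  simp only [Int.cast_zero, add_zero]
  linear_combination (-br q a) * Complex.I_mul_I

theorem weightProj_one (q : Set.Ioo (0 : ℝ) 1) (a : ℝ) (n : ℤ) :
    weightProj q a n 1 = if 0 = n then 1 else 0 := by
  rw [weightProj_podles q a n 1 (one_mem _), map_one]

theorem Ic_apply_podles (q : Set.Ioo (0 : ℝ) 1) (a : ℝ) (x : Dual q) (hx : x ∈ Ic q a)
    (b : OqSU2 q) (hb : b ∈ podles q a) : x b = x 1 * counitA q b := by
  induction hx using Submodule.span_induction with
  | mem x hx =>
    obtain ⟨n, rfl⟩ := hx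
    rw [weightProj_podles q a n b hb, weightProj_one]
    split_ifs <;> simp
  | zero => simp
  | add x y _ _ hx hy =>
    simp only [WithConv.ofConv_add, LinearMap.add_apply, hx, hy]; ring
  | smul r x _ hx => simp only [WithConv.ofConv_smul, LinearMap.smul_apply, hx, smul_eq_mul]; ring

/-! ### The double `O_q(S_t²) ⋈ I_c` -/

/-- The defining relations of the unital algebra generated by `O_q(S_t²)` and `I_c`: the relations
of the two algebras, and the exchange relation `x b = b₍₁₎ (x ◁ b₍₂₎)`, which for `x = h ∈ U_q(su(2))`
reads `h b = (h₍₁₎ ▷ b) h₍₂₎`. -/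
inductive DRel (q : Set.Ioo (0 : ℝ) 1) (a : ℝ) :
    FreeAlgebra ℂ (podles q a ⊕ Ic q a) → FreeAlgebra ℂ (podles q a ⊕ Ic q a) → Prop
  | b_scalar (r : ℂ) : DRel q a (FreeAlgebra.ι ℂ (Sum.inl (algebraMap ℂ (podles q a) r)))
      (algebraMap ℂ _ r)
  | b_add (b c : podles q a) : DRel q a (FreeAlgebra.ι ℂ (Sum.inl (b + c)))
      (FreeAlgebra.ι ℂ (Sum.inl b) + FreeAlgebra.ι ℂ (Sum.inl c))
  | b_mul (b c : podles q a) : DRel q a (FreeAlgebra.ι ℂ (Sum.inl (b * c)))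
      (FreeAlgebra.ι ℂ (Sum.inl b) * FreeAlgebra.ι ℂ (Sum.inl c))
  | x_smul (r : ℂ) (x : Ic q a) : DRel q a (FreeAlgebra.ι ℂ (Sum.inr (r • x)))
      (r • FreeAlgebra.ι ℂ (Sum.inr x))
  | x_add (x y : Ic q a) : DRel q a (FreeAlgebra.ι ℂ (Sum.inr (x + y)))
      (FreeAlgebra.ι ℂ (Sum.inr x) + FreeAlgebra.ι ℂ (Sum.inr y))
  | x_mul (x y z : Ic q a) (h : (z : Dual q) = (x : Dual q) * (y : Dual q)) :
      DRel q a (FreeAlgebra.ι ℂ (Sum.inr z))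
        (FreeAlgebra.ι ℂ (Sum.inr x) * FreeAlgebra.ι ℂ (Sum.inr y))
  | exchange (x : Ic q a) (b : podles q a) (n : ℕ) (b₁ : Fin n → podles q a)
      (b₂ : Fin n → OqSU2 q) (y : Fin n → Ic q a)
      (hb : Coalgebra.comul (R := ℂ) (b : OqSU2 q) = ∑ i, (b₁ i : OqSU2 q) ⊗ₜ[ℂ] b₂ i)
      (hy : ∀ i, (y i : Dual q) = transl (x : Dual q) (b₂ i)) :
      DRel q a (FreeAlgebra.ι ℂ (Sum.inr x) * FreeAlgebra.ι ℂ (Sum.inl b))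
        (∑ i, FreeAlgebra.ι ℂ (Sum.inl (b₁ i)) * FreeAlgebra.ι ℂ (Sum.inr (y i)))

/-- The unital algebra generated by `O_q(S_t²)` and `I_c` subject to the exchange relation; as a
vector space it is `O_q(S_t²) ⊕ (O_q(S_t²) ⊗ I_c)`. -/
def DAlg (q : Set.Ioo (0 : ℝ) 1) (a : ℝ) : Type := RingQuot (DRel q a)

instance (q : Set.Ioo (0 : ℝ) 1) (a : ℝ) : Ring (DAlg q a) :=
  inferInstanceAs (Ring (RingQuot (DRel q a)))

instance (q : Set.Ioo (0 : ℝ) 1) (a : ℝ) : Algebra ℂ (DAlg q a) :=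
  inferInstanceAs (Algebra ℂ (RingQuot (DRel q a)))

/-- The map `O_q(S_t²) → DAlg`. -/
def incB (q : Set.Ioo (0 : ℝ) 1) (a : ℝ) (b : podles q a) : DAlg q a :=
  RingQuot.mkAlgHom ℂ (DRel q a) (FreeAlgebra.ι ℂ (Sum.inl b))

/-- The map `I_c → DAlg`. -/
def incI (q : Set.Ioo (0 : ℝ) 1) (a : ℝ) (x : Ic q a) : DAlg q a :=
  RingQuot.mkAlgHom ℂ (DRel q a) (FreeAlgebra.ι ℂ (Sum.inr x))

/-- The algebra `C_c(SL_q(2,ℝ)_t) = O_q(S_t²) ⋈ I_c`, realized as the ideal of `DAlg` generated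
by `I_c`; by the exchange relation it is the span of the products `b x` with `b ∈ O_q(S_t²)` and
`x ∈ I_c`. -/
def Cc (q : Set.Ioo (0 : ℝ) 1) (a : ℝ) : NonUnitalSubalgebra ℂ (DAlg q a) where
  carrier := (Submodule.span (DAlg q a) (Set.range (incI q a)) : Submodule (DAlg q a) (DAlg q a))
  add_mem' := fun hx hy => add_mem hx hy
  zero_mem' := zero_mem _
  mul_mem' := fun {x _} _ hy => Submodule.smul_mem _ x hy
  smul_mem' := fun r x hx => by
    have h := Submodule.smul_mem _ (algebraMap ℂ (DAlg q a) r) hx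
    rwa [smul_eq_mul, ← Algebra.smul_def] at h

/-- An element of `I_c` as an element of `O_q(S_t²) ⋈ I_c`. -/
def incIc (q : Set.Ioo (0 : ℝ) 1) (a : ℝ) (x : Ic q a) : Cc q a :=
  ⟨incI q a x, Submodule.subset_span ⟨x, rfl⟩⟩

/-- The counit `ε`, given by `b ↦ ε(b)` on `O_q(S_t²)` and `x ↦ x(1)` on `I_c`. -/
def counitD (q : Set.Ioo (0 : ℝ) 1) (a : ℝ) : DAlg q a →ₐ[ℂ] ℂ :=
  RingQuot.liftAlgHom ℂ ⟨FreeAlgebra.lift ℂ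
    (Sum.elim (fun b : podles q a => counitA q b) (fun x : Ic q a => (x : Dual q) 1)), by
    intro u v h
    cases h with
    | b_scalar r => simp
    | b_add b c => simp
    | b_mul b c => simp
    | x_smul r x => simp
    | x_add x y => simp
    | x_mul x y z h =>
      simp only [FreeAlgebra.lift_ι_apply, Sum.elim_inr, map_mul, h, LinearMap.convMul_apply,
        comul_eq, map_one, Algebra.TensorProduct.one_def, TensorProduct.map_tmul,
        LinearMap.mul'_apply]
    | exchange x b n b₁ b₂ y hb hy =>
      simp only [FreeAlgebra.lift_ι_apply, Sum.elim_inr, Sum.elim_inl, map_mul, map_sum, hy]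
      have h1 := Coalgebra.rTensor_counit_comul (R := ℂ) (b : OqSU2 q)
      rw [hb, map_sum] at h1
      have h2 := congrArg (TensorProduct.lid ℂ (OqSU2 q)) h1
      simp only [map_sum, LinearMap.rTensor_tmul, TensorProduct.lid_tmul, one_smul,
        counit_eq] at h2
      rw [← Ic_apply_podles q a x x.2 b b.2, ← h2]
      simp [transl]⟩

@[simp] theorem counitD_incB (q : Set.Ioo (0 : ℝ) 1) (a : ℝ) (b : podles q a) :
    counitD q a (incB q a b) = counitA q b := by
  unfold counitD incB
  exact (RingQuot.liftAlgHom_mkAlgHom_apply ℂ _ _ _).trans (by simp)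

@[simp] theorem counitD_incI (q : Set.Ioo (0 : ℝ) 1) (a : ℝ) (x : Ic q a) :
    counitD q a (incI q a x) = (x : Dual q) 1 := by
  unfold counitD incI
  exact (RingQuot.liftAlgHom_mkAlgHom_apply ℂ _ _ _).trans (by simp)

/-! ### The category of nondegenerate representations -/

/-- A nondegenerate representation of `O_q(S_t²) ⋈ I_c` on a complex vector space. -/
structure NRep (q : Set.Ioo (0 : ℝ) 1) (a : ℝ) : Type 1 where
  /-- The underlying vector space. -/
  V : Type
  [grp : AddCommGroup V]
  [mod : Module ℂ V]
  /-- The action. -/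
  ρ : Cc q a →ₙₐ[ℂ] Module.End ℂ V
  nondeg : Submodule.span ℂ {w : V | ∃ d v, w = ρ d v} = ⊤

attribute [instance] NRep.grp NRep.mod

/-- A morphism of representations is a linear map that intertwines the actions. -/
@[ext]
structure NRep.Hom {q : Set.Ioo (0 : ℝ) 1} {a : ℝ} (M N : NRep q a) : Type where
  /-- The underlying linear map. -/
  lin : M.V →ₗ[ℂ] N.V
  comm : ∀ (d : Cc q a) (v : M.V), lin (M.ρ d v) = N.ρ d (lin v)

/-- The category `Rep(O_q(S_t²) ⋈ I_c)` of nondegenerate representations. -/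
instance (q : Set.Ioo (0 : ℝ) 1) (a : ℝ) : CategoryTheory.Category (NRep q a) where
  Hom M N := NRep.Hom M N
  id M := ⟨LinearMap.id, fun _ _ => rfl⟩
  comp f g := ⟨g.lin ∘ₗ f.lin, fun d v => by simp [f.comm, g.comm]⟩

/-- The restriction of a module over `DAlg` to `O_q(S_t²) ⋈ I_c`, in case the module is generated
by a vector `v` with `Φ_m v = v`; such a restriction is nondegenerate. -/
def ofCyclic (q : Set.Ioo (0 : ℝ) 1) (a : ℝ) (V : Type) [AddCommGroup V] [Module ℂ V]
    [Module (DAlg q a) V] [IsScalarTower ℂ (DAlg q a) V] (m : ℤ) (v : V)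
    (hm : incI q a (projI q a m) • v = v) (hv : ∀ w : V, ∃ d : DAlg q a, w = d • v) :
    NRep q a where
  V := V
  ρ := ((Algebra.lsmul ℂ ℂ V : DAlg q a →ₐ[ℂ] Module.End ℂ V) : DAlg q a →ₙₐ[ℂ] _).comp
    (NonUnitalSubalgebraClass.subtype (Cc q a))
  nondeg := by
    rw [eq_top_iff]
    intro w _
    obtain ⟨d, rfl⟩ := hv w
    apply Submodule.subset_span
    refine ⟨⟨d * incI q a (projI q a m), Submodule.smul_mem _ d
      (Submodule.subset_span ⟨_, rfl⟩)⟩, v, ?_⟩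
    change d • v = (d * incI q a (projI q a m)) • v
    rw [mul_smul, hm]

/-! ### The trivial representation -/

/-- The one-dimensional space `ℂ`, on which `DAlg` acts through the counit. -/
def Triv (_q : Set.Ioo (0 : ℝ) 1) (_a : ℝ) : Type := ℂ

instance (q : Set.Ioo (0 : ℝ) 1) (a : ℝ) : AddCommGroup (Triv q a) :=
  inferInstanceAs (AddCommGroup ℂ)

instance (q : Set.Ioo (0 : ℝ) 1) (a : ℝ) : Module ℂ (Triv q a) := inferInstanceAs (Module ℂ ℂ)

instance (q : Set.Ioo (0 : ℝ) 1) (a : ℝ) : Module (DAlg q a) (Triv q a) :=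
  Module.compHom ℂ (counitD q a : DAlg q a →+* ℂ)

/-- The unit vector of the trivial representation. -/
def Triv.one (q : Set.Ioo (0 : ℝ) 1) (a : ℝ) : Triv q a := (1 : ℂ)

theorem triv_smul (q : Set.Ioo (0 : ℝ) 1) (a : ℝ) (d : DAlg q a) (z : Triv q a) :
    d • z = counitD q a d • z := rfl

instance (q : Set.Ioo (0 : ℝ) 1) (a : ℝ) : IsScalarTower ℂ (DAlg q a) (Triv q a) where
  smul_assoc r d z := by
    rw [triv_smul, triv_smul, map_smul, smul_assoc]

/-- The trivial representation `𝟙`. -/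
def trivialRep (q : Set.Ioo (0 : ℝ) 1) (a : ℝ) : NRep q a :=
  ofCyclic q a (Triv q a) 0 (Triv.one q a)
    (by
      rw [triv_smul, counitD_incI]
      change weightProj q a 0 1 • Triv.one q a = _
      rw [weightProj_one]; simp)
    (fun w => ⟨algebraMap ℂ (DAlg q a) (show ℂ from w), by
      refine Eq.trans ?_ (congrArg (fun z : ℂ => z • Triv.one q a)
        ((counitD q a).commutes (show ℂ from w)).symm)
      exact (mul_one (show ℂ from w)).symm⟩)

/-! ### The modules `M_{λ,b}` and `L_{λ,b}` -/

/-- The left ideal generated by `Φ_m - 1` and `A_{a+m} - λ`. -/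
def relIdeal (q : Set.Ioo (0 : ℝ) 1) (a : ℝ) (l : ℂ) (m : ℤ) :
    Submodule (DAlg q a) (DAlg q a) :=
  Submodule.span (DAlg q a) {incI q a (projI q a m) - 1,
    incB q a (casB q a (a + m)) - algebraMap ℂ (DAlg q a) l}

/-- The underlying module of `M_{λ,b}`, `b = a + m`: the universal module generated by a vector
`e_b` with `Φ_m e_b = e_b` (weight `[b]`) and `A_b e_b = λ e_b`. -/
abbrev MMod (q : Set.Ioo (0 : ℝ) 1) (a : ℝ) (l : ℂ) (m : ℤ) : Type := DAlg q a ⧸ relIdeal q a l m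

/-- The generating vector `e_b` of `M_{λ,b}`. -/
def eVec (q : Set.Ioo (0 : ℝ) 1) (a : ℝ) (l : ℂ) (m : ℤ) : MMod q a l m :=
  Submodule.Quotient.mk 1

theorem projI_eVec (q : Set.Ioo (0 : ℝ) 1) (a : ℝ) (l : ℂ) (m : ℤ) :
    incI q a (projI q a m) • eVec q a l m = eVec q a l m := by
  rw [eVec, ← Submodule.Quotient.mk_smul, Submodule.Quotient.eq, smul_eq_mul, mul_one]
  exact Submodule.subset_span (by simp)

theorem eVec_cyclic (q : Set.Ioo (0 : ℝ) 1) (a : ℝ) (l : ℂ) (m : ℤ) (w : MMod q a l m) :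
    ∃ d : DAlg q a, w = d • eVec q a l m := by
  obtain ⟨d, rfl⟩ := Submodule.Quotient.mk_surjective _ w
  exact ⟨d, by rw [eVec, ← Submodule.Quotient.mk_smul, smul_eq_mul, mul_one]⟩

/-- The representation `M_{λ,b}`, `b = a + m`. -/
def MRep (q : Set.Ioo (0 : ℝ) 1) (a : ℝ) (l : ℂ) (m : ℤ) : NRep q a :=
  ofCyclic q a (MMod q a l m) m (eVec q a l m) (projI_eVec q a l m) (eVec_cyclic q a l m)

/-- The sum of all proper submodules of `M_{λ,b}`. -/
def maxSub (q : Set.Ioo (0 : ℝ) 1) (a : ℝ) (l : ℂ) (m : ℤ) :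
    Submodule (DAlg q a) (MMod q a l m) :=
  sSup {N | N ≠ ⊤}

/-- The representation `L_{λ,b}`, `b = a + m`: the irreducible quotient of `M_{λ,b}`. -/
def LRep (q : Set.Ioo (0 : ℝ) 1) (a : ℝ) (l : ℂ) (m : ℤ) : NRep q a :=
  ofCyclic q a (MMod q a l m ⧸ maxSub q a l m) m (Submodule.Quotient.mk (eVec q a l m))
    (by rw [← Submodule.Quotient.mk_smul, projI_eVec])
    (fun w => by
      obtain ⟨w, rfl⟩ := Submodule.Quotient.mk_surjective _ w
      obtain ⟨d, rfl⟩ := eVec_cyclic q a l m w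
      exact ⟨d, by rw [← Submodule.Quotient.mk_smul]⟩)

/-- The discrete series representation `D₂⁺ = L_{q+q⁻¹, a+2}`. -/
def D2plus (q : Set.Ioo (0 : ℝ) 1) (a : ℝ) : NRep q a := LRep q a (qc q + (qc q)⁻¹) 2

/-- The discrete series representation `D₂⁻ = L_{q+q⁻¹, a-2}`. -/
def D2minus (q : Set.Ioo (0 : ℝ) 1) (a : ℝ) : NRep q a := LRep q a (qc q + (qc q)⁻¹) (-2)

/-- The representation `M_{q+q⁻¹, a}`. -/
def Mcrit (q : Set.Ioo (0 : ℝ) 1) (a : ℝ) : NRep q a := MRep q a (qc q + (qc q)⁻¹) 0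

/-- The module map `M_{q+q⁻¹, a} → 𝟙` with `e_a ↦ 1`. -/
def augLin (q : Set.Ioo (0 : ℝ) 1) (a : ℝ) :
    MMod q a (qc q + (qc q)⁻¹) 0 →ₗ[DAlg q a] Triv q a :=
  (relIdeal q a (qc q + (qc q)⁻¹) 0).liftQ (LinearMap.toSpanSingleton _ _ (Triv.one q a)) (by
    rw [relIdeal, Submodule.span_le]
    intro d hd
    simp only [Set.mem_insert_iff, Set.mem_singleton_iff] at hd
    rw [SetLike.mem_coe, LinearMap.mem_ker, LinearMap.toSpanSingleton_apply, triv_smul]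
    rcases hd with rfl | rfl
    · rw [map_sub, counitD_incI, map_one (counitD q a)]
      change (weightProj q a 0 1 - 1) • _ = _
      rw [weightProj_one]; simp
    · rw [map_sub, counitD_incB, AlgHom.commutes]
      change (counitA q (casA q a _) - (qc q + (qc q)⁻¹)) • _ = _
      rw [counitA_casA]; simp)

theorem augLin_eVec (q : Set.Ioo (0 : ℝ) 1) (a : ℝ) :
    augLin q a (eVec q a _ 0) = Triv.one q a := by
  rw [augLin, eVec, Submodule.liftQ_apply]; simp

/-- The canonical morphism `M_{q+q⁻¹, a} → 𝟙` with `e_a ↦ 1`. -/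
def aug (q : Set.Ioo (0 : ℝ) 1) (a : ℝ) : Mcrit q a ⟶ trivialRep q a :=
  (⟨(augLin q a).restrictScalars ℂ, fun d v => (augLin q a).map_smul (d : DAlg q a) v⟩ :
    NRep.Hom (Mcrit q a) (trivialRep q a))

/-- The action of `I_c` on a representation of `O_q(S_t²) ⋈ I_c`. -/
def NRep.actI {q : Set.Ioo (0 : ℝ) 1} {a : ℝ} (M : NRep q a) (x : Ic q a) : Module.End ℂ M.V :=
  M.ρ (incIc q a x)

end QuantumSL2R

end

open CategoryTheory QuantumSL2R

open scoped TensorProduct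

noncomputable section

namespace QuantumSL2R

set_option linter.unusedSimpArgs false
set_option linter.unnecessarySeqFocus false

/-! Weight vectors are moved by explicit ladder elements. For a parameter `s` put E_s = sX - s⁻¹X* -
√-1(q + q⁻¹)Y - t (`ladA`), an element of the Podleś sphere. Take s = q^(a+n) to raise a vector of
weight [a+n] by two steps, and s = -q^(-(a+n)) to lower it (`weight_ladB_smul`). These elements
intertwine the operators A_b (`casA_mul_ladA`). On a vector of weight [a+n] with A-eigenvalue q +
q⁻¹, a step to [a+n'] followed by the step back is multiplication by (⟦a+n'⟧ - t)(⟦a+n⟧ - t)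
(`IsLadder.step_back`). At each weight, X, X* and Y are combinations of 1, A, E and the opposite E
(`generators_mem_ladder_span`). Together they generate the Podleś sphere (`podles_eq_podGen`). So a
cyclic module on such a vector is spanned by the two ladders starting there, and its generating
weight space is at most a line.

It must also be shown that the ladders in M = M_{q+q⁻¹,a} do not collapse. The double acts on
O_q(SU(2)) by left multiplication and left translation (`regRep`). The vector 1 has weight [a], and
the left ideal generated by A_a - (q + q⁻¹) is stable. The character k takes the value q + q⁻¹ on
A_a, so it vanishes on this ideal, and b e_a = 0 forces k(b) = 0 (`kHom_eq_zero_of_smul_eVec`).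
Since k(E_s) = ⟦a+n±2⟧ - ⟦a⟧, the product of ladder elements from weight [a] never vanishes under k.
Hence M has exactly the weights [a+2j], j ∈ ℤ, each once.

A splitting would send 1 to c e_a. The raising element at weight [a] has counit 0, so it kills 1,
but it does not kill e_a. Thus c = 0, a contradiction.

For the `Ic` statement, in M_{q+q⁻¹,a±2} the step back towards weight [a] generates a proper
submodule, because the return factor contains ⟦a⟧ - t = 0. The quotient therefore has weights [a±2],
[a±4], ... once each (`exists_basis_LMod`). With the weight [a] of the trivial representation these
are the weights of M, and weight bases can be matched. -/

/-! ### The weight parameters `σ_n = q ^ (a + n)` -/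

/-- The complex number `σ_n = q ^ (a + n)`. -/
def sig (q : Set.Ioo (0 : ℝ) 1) (a : ℝ) (n : ℤ) : ℂ := qpow q (a + n)

/-- The direction-dependent parameter: `σ_n` for raising and `-σ_n⁻¹` for lowering. -/
def par (q : Set.Ioo (0 : ℝ) 1) (a : ℝ) (u : Bool) (n : ℤ) : ℂ :=
  if u then sig q a n else -(sig q a n)⁻¹

/-- The sign of a direction. -/
def dir (u : Bool) : ℤ := if u then 1 else -1

@[simp] theorem dir_not (u : Bool) : dir (!u) = -dir u := by cases u <;> rfl

theorem qpow_ne_zero (q : Set.Ioo (0 : ℝ) 1) (x : ℝ) : qpow q x ≠ 0 := by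
  simp only [qpow, ne_eq, Complex.ofReal_eq_zero]
  exact (Real.rpow_pos_of_pos q.2.1 x).ne'

theorem sig_ne_zero (q : Set.Ioo (0 : ℝ) 1) (a : ℝ) (n : ℤ) : sig q a n ≠ 0 := qpow_ne_zero q _

theorem qpow_add (q : Set.Ioo (0 : ℝ) 1) (x y : ℝ) : qpow q (x + y) = qpow q x * qpow q y := by
  simp only [qpow, Real.rpow_add q.2.1, Complex.ofReal_mul]

theorem qpow_neg (q : Set.Ioo (0 : ℝ) 1) (x : ℝ) : qpow q (-x) = (qpow q x)⁻¹ := by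
  simp only [qpow, Real.rpow_neg q.2.1.le, Complex.ofReal_inv]

theorem qpow_intCast (q : Set.Ioo (0 : ℝ) 1) (n : ℤ) : qpow q n = qc q ^ n := by
  simp [qpow, qc, Real.rpow_intCast]

theorem sig_add (q : Set.Ioo (0 : ℝ) 1) (a : ℝ) (n m : ℤ) :
    sig q a (n + m) = qc q ^ m * sig q a n := by
  rw [sig, sig, ← qpow_intCast, mul_comm, ← qpow_add]
  congr 1
  push_cast
  ring

theorem par_ne_zero (q : Set.Ioo (0 : ℝ) 1) (a : ℝ) (u : Bool) (n : ℤ) : par q a u n ≠ 0 := by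
  have := sig_ne_zero q a n
  cases u <;> simp [par, this]

theorem par_add (q : Set.Ioo (0 : ℝ) 1) (a : ℝ) (u : Bool) (n m : ℤ) :
    par q a u (n + dir u * m) = qc q ^ m * par q a u n := by
  cases u
  · simp only [par, dir, Bool.false_eq_true, if_false, sig_add, mul_inv, neg_mul, one_mul,
      zpow_neg, inv_inv]
    ring
  · simp [par, dir, sig_add]

theorem par_add_dir (q : Set.Ioo (0 : ℝ) 1) (a : ℝ) (u : Bool) (n : ℤ) :
    par q a u (n + dir u) = qc q * par q a u n := by
  simpa using par_add q a u n 1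

theorem par_not (q : Set.Ioo (0 : ℝ) 1) (a : ℝ) (u : Bool) (n : ℤ) :
    par q a (!u) n = -(par q a u n)⁻¹ := by
  cases u <;> simp [par]

theorem dbr_add_intCast (q : Set.Ioo (0 : ℝ) 1) (a : ℝ) (n : ℤ) :
    dbr q (a + n) = sig q a n - (sig q a n)⁻¹ := by
  rw [dbr, qpow_neg, sig]

theorem par_sub_inv (q : Set.Ioo (0 : ℝ) 1) (a : ℝ) (u : Bool) (n : ℤ) :
    par q a u n - (par q a u n)⁻¹ = dbr q (a + n) := by
  rw [dbr_add_intCast]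
  cases u <;> simp [par, sub_eq_add_neg, add_comm]

theorem sig_add_inv_ne_zero (q : Set.Ioo (0 : ℝ) 1) (a : ℝ) (n : ℤ) :
    sig q a n + (sig q a n)⁻¹ ≠ 0 := by
  have h := Real.rpow_pos_of_pos q.2.1 (a + n)
  have h2 : ((q : ℝ) ^ (a + n) + ((q : ℝ) ^ (a + n))⁻¹) ≠ 0 := by positivity
  simp only [sig, qpow]
  exact_mod_cast h2

theorem par_add_inv_ne_zero (q : Set.Ioo (0 : ℝ) 1) (a : ℝ) (u : Bool) (n : ℤ) :
    par q a u n + (par q a u n)⁻¹ ≠ 0 := by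
  have := sig_add_inv_ne_zero q a n
  cases u
  · simp only [par, Bool.false_eq_true, if_false, inv_neg, inv_inv, ← neg_add, ne_eq, neg_eq_zero]
    rwa [add_comm]
  · simpa [par] using this

/-- The eigenvalue attached to a parameter `s`, so that `[x]` is attached to `q ^ x`. -/
def wtC (q : Set.Ioo (0 : ℝ) 1) (s : ℂ) : ℂ := (s - s⁻¹) / (qc q - (qc q)⁻¹)

theorem wtC_par (q : Set.Ioo (0 : ℝ) 1) (a : ℝ) (u : Bool) (n : ℤ) :
    wtC q (par q a u n) = wt q a n := by
  rw [wtC, par_sub_inv, wt, br]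

theorem dbr_injective (q : Set.Ioo (0 : ℝ) 1) : Function.Injective (dbr q) := by
  intro x y h
  apply br_injective q
  rw [br, br, h]

/-! ### Raising and lowering elements of `O_q(SU(2))` -/

/-- The element `α + √-1 s⁻¹ γ` (for `i = true`) or `α* + √-1 q s γ*` (for `i = false`). -/
def stepA (q : Set.Ioo (0 : ℝ) 1) (i : Bool) (s : ℂ) : OqSU2 q :=
  if i then gen q .al + (Complex.I * s⁻¹) • gen q .ga
  else gen q .als + (Complex.I * qc q * s) • gen q .gas

theorem counitA_stepA (q : Set.Ioo (0 : ℝ) 1) (i : Bool) (s : ℂ) :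
    counitA q (stepA q i s) = 1 := by
  cases i <;> simp [stepA, counitGen]

/-- Since B_t has coproduct k ⊗ B_t + P ⊗ 1, the operator acts on the span of αc and γc (or α*c and
γ*c) by a 2×2 matrix. The step elements are its eigenvectors. Replacing s by -s⁻¹ leaves the weight
of c unchanged, so the same formula gives raising and lowering. -/
theorem weightOp_stepA_mul (q : Set.Ioo (0 : ℝ) 1) (a : ℝ) (i : Bool) {s : ℂ} (hs : s ≠ 0)
    {c : OqSU2 q} (hc : weightOp q a c = wtC q s • c) :
    weightOp q a (stepA q i s * c) = wtC q (qc q * s) • (stepA q i s * c) := by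
  have hB : actR q (Bt q a) c = (-(Complex.I * wtC q s)) • c := by
    have h := congrArg (fun x => (-Complex.I) • x) hc
    simp only [weightOp_apply, smul_smul] at h
    simpa using h
  have hq := qc_ne_zero q
  have hq2 : qc q ^ 2 - 1 ≠ 0 := by
    have h := mul_ne_zero hq (qc_sub_inv_ne_zero q)
    rwa [mul_sub, mul_inv_cancel₀ hq, ← pow_two] at h
  have hI := Complex.I_sq
  rw [weightOp_apply]
  cases i
  · simp only [stepA, Bool.false_eq_true, if_false, add_mul, smul_mul_assoc, map_add, map_smul,
      actR_mul _ _ _ (Bt_mul q a), hB, actR_kU_gen, actR_pU_als, actR_pU_gas, mul_smul_comm,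
      neg_mul, smul_mul_assoc]
    match_scalars <;> simp only [wtC] <;> field_simp <;> ring_nf <;> simp only [hI] <;> ring
  · simp only [stepA, if_true, add_mul, smul_mul_assoc, map_add, map_smul,
      actR_mul _ _ _ (Bt_mul q a), hB, actR_kU_gen, actR_pU_al, actR_pU_ga, mul_smul_comm,
      neg_mul, smul_mul_assoc]
    match_scalars <;> simp only [wtC] <;> field_simp <;> ring_nf <;> simp only [hI] <;> ring

/-- The coefficients of the generators in the elements `stepA`. -/
def stepCoef (q : Set.Ioo (0 : ℝ) 1) (s : ℂ) : Gen → ℂ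
  | .al => s / (s + s⁻¹)
  | .als => s⁻¹ / (s + s⁻¹)
  | .ga => -Complex.I / (s + s⁻¹)
  | .gas => -(Complex.I * (qc q)⁻¹) / (s + s⁻¹)

/-- The family of step elements to which a generator belongs. -/
def stepIdx : Gen → Bool
  | .al => true
  | .als => false
  | .ga => true
  | .gas => false

/-- The steps at s and at -s⁻¹ form a linear system in two generators, invertible because s + s⁻¹ ≠
0. Multiplication by a generator is thus a sum of a raising and a lowering step. -/
theorem gen_eq_stepA (q : Set.Ioo (0 : ℝ) 1) (g : Gen) {s : ℂ} (hs : s ≠ 0) (hs' : s + s⁻¹ ≠ 0) :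
    gen q g = stepCoef q s g • stepA q (stepIdx g) s +
      stepCoef q (-s⁻¹) g • stepA q (stepIdx g) (-s⁻¹) := by
  have hq := qc_ne_zero q
  have h2 : -s⁻¹ + (-s⁻¹)⁻¹ ≠ 0 := by
    rw [inv_neg, inv_inv, ← neg_add, neg_ne_zero, add_comm]; exact hs'
  have h3 : s ^ 2 + 1 ≠ 0 := by
    have h := mul_ne_zero hs hs'
    rwa [mul_add, mul_inv_cancel₀ hs, ← pow_two] at h
  have h4 : 1 + s ^ 2 ≠ 0 := by rwa [add_comm]
  have h5 : -1 - s ^ 2 ≠ 0 := by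
    rw [← neg_add', neg_ne_zero]; exact h4
  have h6 : -1 + -(s ^ 2) ≠ 0 := by rwa [← sub_eq_add_neg]
  have hI := Complex.I_sq
  cases g <;> simp only [stepIdx, stepA, if_true, Bool.false_eq_true, if_false, stepCoef] <;>
    match_scalars <;> field_simp <;> ring_nf <;> simp only [hI] <;> field_simp <;> ring

/-! ### Generators of the Podleś sphere -/

theorem als_mul_ga (q : Set.Ioo (0 : ℝ) 1) :
    gen q .als * gen q .ga = (qc q)⁻¹ • (gen q .ga * gen q .als) := by
  rw [rel₇, smul_smul, inv_mul_cancel₀ (qc_ne_zero q), one_smul]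

theorem als_mul_gas (q : Set.Ioo (0 : ℝ) 1) :
    gen q .als * gen q .gas = (qc q)⁻¹ • (gen q .gas * gen q .als) := by
  rw [rel₆, smul_smul, inv_mul_cancel₀ (qc_ne_zero q), one_smul]

/-- This is used with t = -s⁻¹: a forward step followed by a backward one is rewritten so that the
backward step acts first, which allows induction on the length of a path. -/
theorem stepA_swap (q : Set.Ioo (0 : ℝ) 1) (i j : Bool) {s t : ℂ} (hs : s ≠ 0) (ht : t ≠ 0)
    (hd : qc q ^ 2 * t - s ≠ 0) : ∃ x y : ℂ,
    stepA q i (t / qc q) * stepA q j s =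
      x • (stepA q i (s / qc q) * stepA q j t) + y • (stepA q j (s / qc q) * stepA q i t) := by
  have hq := qc_ne_zero q
  have hI := Complex.I_sq
  cases i <;> cases j
  · refine ⟨1, 0, ?_⟩
    simp only [stepA, Bool.false_eq_true, if_false, add_mul, mul_add, smul_mul_assoc,
      mul_smul_comm, als_mul_gas]
    match_scalars <;> field_simp <;> ring
  · refine ⟨1 - (t - s) / (qc q ^ 2 * t - s), (t - s) / (qc q ^ 2 * t - s), ?_⟩
    simp only [stepA, Bool.false_eq_true, if_false, if_true, add_mul, mul_add, smul_mul_assoc,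
      mul_smul_comm, als_mul_ga, rel₁', rel₂', rel₃, rel₅]
    match_scalars <;> field_simp <;> ring_nf <;>
      (simp only [hI]; ring1)
  · refine ⟨s * (qc q ^ 2 - 1) / (qc q ^ 2 * t - s), 1 - s * (qc q ^ 2 - 1) / (qc q ^ 2 * t - s), ?_⟩
    simp only [stepA, Bool.false_eq_true, if_false, if_true, add_mul, mul_add, smul_mul_assoc,
      mul_smul_comm, als_mul_ga, rel₁', rel₂', rel₃, rel₅]
    match_scalars <;> field_simp <;> ring_nf <;>
      first | (simp only [hI]; ring1) | (field_simp; ring1)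
  · refine ⟨1, 0, ?_⟩
    simp only [stepA, if_true, add_mul, mul_add, smul_mul_assoc,
      mul_smul_comm, rel₄]
    match_scalars <;> field_simp <;> ring

/-- The subalgebra generated by `X`, `X*` and `Y`. -/
def podGen (q : Set.Ioo (0 : ℝ) 1) (a : ℝ) : Subalgebra ℂ (OqSU2 q) :=
  Algebra.adjoin ℂ {podX q a, podXs q a, podY q a}

theorem podX_mem_podGen (q : Set.Ioo (0 : ℝ) 1) (a : ℝ) : podX q a ∈ podGen q a :=
  Algebra.subset_adjoin (by simp)
theorem podXs_mem_podGen (q : Set.Ioo (0 : ℝ) 1) (a : ℝ) : podXs q a ∈ podGen q a :=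
  Algebra.subset_adjoin (by simp)
theorem podY_mem_podGen (q : Set.Ioo (0 : ℝ) 1) (a : ℝ) : podY q a ∈ podGen q a :=
  Algebra.subset_adjoin (by simp)

/-- A loop of length two at the weight `[a]` lies in the algebra generated by `X`, `X*`, `Y`. -/
theorem stepA_loop_mem (q : Set.Ioo (0 : ℝ) 1) (a : ℝ) (i j : Bool) {s : ℂ} (hs : s ≠ 0)
    (h : s - s⁻¹ = dbr q a) :
    stepA q i (-s⁻¹ / qc q) * stepA q j s ∈ podGen q a := by
  have hq := qc_ne_zero q
  have hI := Complex.I_sq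
  have X := podX_mem_podGen q a
  have Xs := podXs_mem_podGen q a
  have Y := podY_mem_podGen q a
  cases i <;> cases j
  · convert Xs using 1
    simp only [podXs, ← h, stepA, Bool.false_eq_true, if_false, add_mul, mul_add, smul_mul_assoc,
      mul_smul_comm, als_mul_gas]
    match_scalars <;> field_simp <;> ring_nf <;>
      (simp only [hI]; ring1)
  · convert add_mem (one_mem (podGen q a))
      (Subalgebra.smul_mem _ Y (Complex.I * (s * qc q)⁻¹)) using 1
    simp only [podY, ← h, stepA, Bool.false_eq_true, if_false, if_true, add_mul, mul_add,
      smul_mul_assoc, mul_smul_comm, als_mul_ga, rel₁', rel₂', rel₃, rel₅]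
    match_scalars <;> field_simp <;> ring_nf <;>
      (simp only [hI]; ring1)
  · convert add_mem (one_mem (podGen q a))
      (Subalgebra.smul_mem _ Y (-(Complex.I * qc q * s))) using 1
    simp only [podY, ← h, stepA, Bool.false_eq_true, if_false, if_true, add_mul, mul_add,
      smul_mul_assoc, mul_smul_comm, als_mul_ga, rel₁', rel₂', rel₃, rel₅]
    match_scalars <;> field_simp <;> ring_nf <;>
      linear_combination -hI
  · convert X using 1
    simp only [podX, ← h, stepA, if_true, add_mul, mul_add, smul_mul_assoc,
      mul_smul_comm, rel₄]
    match_scalars <;> field_simp <;> ring_nf <;>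
      (simp only [hI]; ring1)

/-- The span of the monotone paths of `k` steps in direction `u`, multiplied by the algebra
generated by `X`, `X*`, `Y`. -/
def pathSpan (q : Set.Ioo (0 : ℝ) 1) (a : ℝ) (u : Bool) : ℕ → Submodule ℂ (OqSU2 q)
  | 0 => Subalgebra.toSubmodule (podGen q a)
  | k + 1 => Submodule.span ℂ {c | ∃ (i : Bool) (d : OqSU2 q), d ∈ pathSpan q a u k ∧
      c = stepA q i (par q a u (dir u * k)) * d}

theorem stepA_mul_mem_pathSpan {q : Set.Ioo (0 : ℝ) 1} {a : ℝ} (u i : Bool) {k : ℕ} {d : OqSU2 q}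
    (hd : d ∈ pathSpan q a u k) :
    stepA q i (par q a u (dir u * k)) * d ∈ pathSpan q a u (k + 1) :=
  Submodule.subset_span ⟨i, d, hd, rfl⟩

theorem podGen_le_podles (q : Set.Ioo (0 : ℝ) 1) (a : ℝ) : podGen q a ≤ podles q a := by
  rw [podGen, Algebra.adjoin_le_iff]
  rintro c (rfl | rfl | rfl)
  exacts [podX_mem q a, podXs_mem q a, podY_mem q a]

theorem mem_podles_iff {q : Set.Ioo (0 : ℝ) 1} {a : ℝ} {c : OqSU2 q} :
    c ∈ podles q a ↔ weightOp q a c = wt q a 0 • c := by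
  have h : wt q a 0 = br q a := by simp [wt]
  change actR q (Bt q a) c = Bt q a 1 • c ↔ _
  rw [weightOp_apply, Bt_one, h]
  constructor
  · intro h
    rw [h, smul_smul]
    congr 1
    linear_combination (-br q a) * Complex.I_mul_I
  · intro h
    have h2 := congrArg (fun x => (-Complex.I) • x) h
    simp only [smul_smul, neg_mul, Complex.I_mul_I, neg_neg, one_smul] at h2
    exact h2

theorem pathSpan_le_eigenspace (q : Set.Ioo (0 : ℝ) 1) (a : ℝ) (u : Bool) (k : ℕ) :
    pathSpan q a u k ≤ (weightOp q a).eigenspace (wt q a (dir u * k)) := by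
  induction k with
  | zero =>
    intro c hc
    rw [Module.End.mem_eigenspace_iff]
    simpa using mem_podles_iff.1 (podGen_le_podles q a hc)
  | succ k ih =>
    rw [pathSpan, Submodule.span_le]
    rintro _ ⟨i, d, hd, rfl⟩
    have h := Module.End.mem_eigenspace_iff.1 (ih hd)
    rw [SetLike.mem_coe, Module.End.mem_eigenspace_iff]
    rw [← wtC_par q a u] at h
    have h2 := weightOp_stepA_mul q a i (par_ne_zero q a u (dir u * k)) h
    rw [← par_add_dir, wtC_par] at h2
    rw [h2]
    congr 2
    push_cast
    ring

/-- `stepA_swap` carries the backward step down the path until it meets the first forward step.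
There the two form a loop at weight [a], which `stepA_loop_mem` puts into the algebra generated by
X, X*, Y. -/
theorem stepA_back_mem_pathSpan (q : Set.Ioo (0 : ℝ) 1) (a : ℝ) (u i : Bool) (k : ℕ)
    {d : OqSU2 q} (hd : d ∈ pathSpan q a u (k + 1)) :
    stepA q i (par q a (!u) (dir u * (k + 1 : ℕ))) * d ∈ pathSpan q a u k := by
  induction k generalizing d i with
  | zero =>
    rw [pathSpan] at hd
    induction hd using Submodule.span_induction with
    | mem c hc =>
      obtain ⟨j, d, hd, rfl⟩ := hc
      have h := stepA_loop_mem q a i j (par_ne_zero q a u 0) (by simpa using par_sub_inv q a u 0)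
      rw [← mul_assoc]
      refine (podGen q a).mul_mem ?_ hd
      convert h using 3
      · rw [← par_not]
        have := par_add_dir q a (!u) (dir u)
        rw [dir_not, add_neg_cancel] at this
        rw [this, mul_div_cancel_left₀ _ (qc_ne_zero q)]
        simp
      · simp
    | zero => simp
    | add x y _ _ hx hy => rw [mul_add]; exact add_mem hx hy
    | smul r x _ hx => rw [mul_smul_comm]; exact Submodule.smul_mem _ _ hx
  | succ k ih =>
    rw [pathSpan] at hd
    induction hd using Submodule.span_induction with
    | mem c hc =>
      obtain ⟨j, d, hd, rfl⟩ := hc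
      set n : ℤ := dir u * (k + 1 : ℕ) with hn
      -- With σ = q^(a+n) > 0 the two parameters are σ and -σ⁻¹, so both terms of the difference
      -- have the same sign.
      have hne : qc q ^ 2 * par q a (!u) n - par q a u n ≠ 0 := by
        have hp := Real.rpow_pos_of_pos q.2.1 (a + n)
        have hq := q.2.1
        have e1 : ((q : ℝ) ^ 2 * -((q : ℝ) ^ (a + n))⁻¹ - (q : ℝ) ^ (a + n)) ≠ 0 := by
          have : 0 < (q : ℝ) ^ 2 * ((q : ℝ) ^ (a + n))⁻¹ := by positivity
          linarith
        have e2 : ((q : ℝ) ^ 2 * (q : ℝ) ^ (a + n) - -((q : ℝ) ^ (a + n))⁻¹) ≠ 0 := by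
          have : 0 < (q : ℝ) ^ 2 * (q : ℝ) ^ (a + n) + ((q : ℝ) ^ (a + n))⁻¹ := by positivity
          linarith
        cases u
        · simp only [par, sig, qpow, qc, Bool.not_false, if_true, Bool.false_eq_true, if_false]
          exact_mod_cast e2
        · simp only [par, sig, qpow, qc, Bool.not_true, if_true, Bool.false_eq_true, if_false]
          exact_mod_cast e1
      obtain ⟨x, y, hxy⟩ := stepA_swap q i j (par_ne_zero q a u n) (par_ne_zero q a (!u) n) hne
      have e3 : par q a (!u) (dir u * (k + 1 + 1 : ℕ)) = par q a (!u) n / qc q := by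
        have := par_add_dir q a (!u) (dir u * (k + 1 + 1 : ℕ))
        have e : dir u * (k + 1 + 1 : ℕ) + dir (!u) = n := by
          rw [dir_not, hn]; push_cast; ring
        rw [e] at this
        rw [this, mul_div_cancel_left₀ _ (qc_ne_zero q)]
      have e4 : par q a u n / qc q = par q a u (dir u * k) := by
        have := par_add_dir q a u (dir u * k)
        have e : dir u * k + dir u = n := by
          rw [hn]; push_cast; ring
        rw [e] at this
        rw [this, mul_div_cancel_left₀ _ (qc_ne_zero q)]
      rw [← mul_assoc, e3, hxy, add_mul, smul_mul_assoc, smul_mul_assoc, mul_assoc, mul_assoc, e4]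
      exact add_mem (Submodule.smul_mem _ _ (stepA_mul_mem_pathSpan u i (ih j hd)))
        (Submodule.smul_mem _ _ (stepA_mul_mem_pathSpan u j (ih i hd)))
    | zero => simp
    | add x y _ _ hx hy => rw [mul_add]; exact add_mem hx hy
    | smul r x _ hx => rw [mul_smul_comm]; exact Submodule.smul_mem _ _ hx

/-- A subspace which contains `1` and is stable under left multiplication by the generators is
everything. -/
theorem eq_top_of_gen_mul_mem {q : Set.Ioo (0 : ℝ) 1} (S : Submodule ℂ (OqSU2 q))
    (h1 : (1 : OqSU2 q) ∈ S) (hg : ∀ g, ∀ c ∈ S, gen q g * c ∈ S) : S = ⊤ := by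
  let mk : FreeAlgebra ℂ Gen →ₐ[ℂ] OqSU2 q := RingQuot.mkAlgHom ℂ (SURel q)
  have key : ∀ w : FreeAlgebra ℂ Gen, ∀ c ∈ S, mk w * c ∈ S := by
    intro w
    induction w using FreeAlgebra.induction with
    | grade0 r =>
      intro c hc
      rw [AlgHom.commutes, ← Algebra.smul_def]
      exact S.smul_mem r hc
    | grade1 g => exact hg g
    | mul v w hv hw =>
      intro c hc
      rw [map_mul, mul_assoc]
      exact hv _ (hw _ hc)
    | add v w hv hw =>
      intro c hc
      rw [map_add, add_mul]
      exact add_mem (hv _ hc) (hw _ hc)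
  rw [eq_top_iff]
  intro c _
  obtain ⟨w, hw⟩ : ∃ w, mk w = c := RingQuot.mkAlgHom_surjective ℂ (SURel q) c
  rw [← hw, ← mul_one (mk w)]
  exact key w 1 h1

/-- Monotone paths suffice: a generator splits into a forward step, which lengthens the path, and a
backward step, which shortens it. -/
theorem iSup_pathSpan (q : Set.Ioo (0 : ℝ) 1) (a : ℝ) :
    ⨆ p : Bool × ℕ, pathSpan q a p.1 p.2 = ⊤ := by
  apply eq_top_of_gen_mul_mem
  · exact Submodule.mem_iSup_of_mem (true, 0) (one_mem (podGen q a))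
  · intro g c hc
    induction hc using Submodule.iSup_induction' with
    | zero => simp
    | add x y _ _ hx hy => rw [mul_add]; exact add_mem hx hy
    | mem p c hc =>
      obtain ⟨u, k⟩ := p
      rw [gen_eq_stepA q g (par_ne_zero q a u (dir u * k)) (par_add_inv_ne_zero q a u _),
        add_mul, smul_mul_assoc, smul_mul_assoc, ← par_not]
      refine add_mem (Submodule.smul_mem _ _ (Submodule.mem_iSup_of_mem (u, k + 1)
        (stepA_mul_mem_pathSpan u _ hc))) (Submodule.smul_mem _ _ ?_)
      cases k with
      | zero =>
        -- Paths of length zero are common to both directions, so a backward step from weight [a]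
        -- starts a path in the opposite direction.
        refine Submodule.mem_iSup_of_mem (!u, 1) ?_
        have := stepA_mul_mem_pathSpan (q := q) (a := a) (!u) (stepIdx g) (k := 0) hc
        simpa using this
      | succ k => exact Submodule.mem_iSup_of_mem (u, k) (stepA_back_mem_pathSpan q a u _ k hc)

theorem iSup_eigenspace (q : Set.Ioo (0 : ℝ) 1) (a : ℝ) :
    ⨆ n : ℤ, (weightOp q a).eigenspace (wt q a n) = ⊤ := by
  rw [eq_top_iff, ← iSup_pathSpan q a]
  exact iSup_le fun p => (pathSpan_le_eigenspace q a p.1 p.2).trans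
    (le_iSup (fun n : ℤ => (weightOp q a).eigenspace (wt q a n)) (dir p.1 * p.2))

/-- The Podleś sphere is generated by `X`, `X*` and `Y`. -/
theorem podles_eq_podGen (q : Set.Ioo (0 : ℝ) 1) (a : ℝ) : podles q a = podGen q a := by
  refine le_antisymm ?_ (podGen_le_podles q a)
  set R : Submodule ℂ (OqSU2 q) := ⨆ (n : ℤ) (_ : n ≠ 0), (weightOp q a).eigenspace (wt q a n)
  have htop : Subalgebra.toSubmodule (podGen q a) ⊔ R = ⊤ := by
    rw [eq_top_iff, ← iSup_pathSpan q a]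
    refine iSup_le fun p => ?_
    obtain ⟨u, k⟩ := p
    cases k with
    | zero => exact le_sup_left
    | succ k =>
      refine ((pathSpan_le_eigenspace q a u (k + 1)).trans ?_).trans le_sup_right
      refine le_iSup₂_of_le (dir u * (k + 1 : ℕ)) ?_ le_rfl
      cases u <;> simp [dir] <;> omega
  intro b hb
  -- Only paths of length zero have weight [a], so an element of the Podleś sphere equals its
  -- length-zero part `c`. The remainder `r` has weight [a] and lies in the sum of the other weight
  -- spaces, hence vanishes.
  obtain ⟨c, hc, r, hr, hcr⟩ := Submodule.mem_sup.1 (htop ▸ Submodule.mem_top : b ∈ _ ⊔ R)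
  have hind : iSupIndep fun m : ℤ => (weightOp q a).eigenspace (wt q a m) :=
    (Module.End.eigenspaces_iSupIndep (weightOp q a)).comp (wt_injective q a)
  have hr0 : r ∈ (weightOp q a).eigenspace (wt q a 0) := by
    rw [Module.End.mem_eigenspace_iff, ← mem_podles_iff, ← add_sub_cancel_left c r, hcr]
    exact sub_mem hb (podGen_le_podles q a hc)
  have h0 : r = 0 := by
    simpa using (Submodule.disjoint_def.1 (hind 0)) r hr0 hr
  rw [← hcr, h0, add_zero]
  exact hc

/-! ### The functionals `Φ_m` -/

/-- Linear maps on `O_q(SU(2))` agree if they agree on weight vectors. -/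
theorem linearMap_ext_weight (q : Set.Ioo (0 : ℝ) 1) (a : ℝ) {V : Type} [AddCommGroup V]
    [Module ℂ V] {f g : OqSU2 q →ₗ[ℂ] V}
    (h : ∀ (n : ℤ) (c : OqSU2 q), weightOp q a c = wt q a n • c → f c = g c) : f = g := by
  have h2 : (⊤ : Submodule ℂ (OqSU2 q)) ≤ LinearMap.eqLocus f g := by
    rw [← iSup_eigenspace q a]
    exact iSup_le fun n c hc => h n c (Module.End.mem_eigenspace_iff.1 hc)
  ext c
  exact h2 (Submodule.mem_top : c ∈ ⊤)

theorem dual_ext_weight (q : Set.Ioo (0 : ℝ) 1) (a : ℝ) {x y : Dual q}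
    (h : ∀ (n : ℤ) (c : OqSU2 q), weightOp q a c = wt q a n • c → x c = y c) : x = y := by
  have := linearMap_ext_weight q a (f := x.ofConv) (g := y.ofConv) h
  exact congrArg WithConv.toConv this

theorem transl_apply {q : Set.Ioo (0 : ℝ) 1} (x : Dual q) (c d : OqSU2 q) :
    transl x c d = x (c * d) := rfl

theorem transl_mul {q : Set.Ioo (0 : ℝ) 1} (x : Dual q) (c d : OqSU2 q) :
    transl x (c * d) = transl (transl x c) d := by
  simp only [transl, LinearMap.mulLeft_mul]
  rfl

theorem transl_add {q : Set.Ioo (0 : ℝ) 1} (x y : Dual q) (c : OqSU2 q) :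
    transl (x + y) c = transl x c + transl y c := rfl

theorem transl_smul {q : Set.Ioo (0 : ℝ) 1} (r : ℂ) (x : Dual q) (c : OqSU2 q) :
    transl (r • x) c = r • transl x c := rfl

theorem transl_one {q : Set.Ioo (0 : ℝ) 1} (x : Dual q) : transl x 1 = x := by
  simp only [transl, LinearMap.mulLeft_one]
  rfl

theorem weightProj_stepA_mul (q : Set.Ioo (0 : ℝ) 1) (a : ℝ) (i u : Bool) (m n : ℤ)
    {c : OqSU2 q} (hc : weightOp q a c = wt q a n • c) :
    weightProj q a m (stepA q i (par q a u n) * c) =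
      if n + dir u = m then counitA q c else 0 := by
  have h := weightOp_stepA_mul q a i (par_ne_zero q a u n) (by rwa [wtC_par])
  rw [← par_add_dir, wtC_par] at h
  rw [weightProj_spec q a m _ _ h, map_mul, counitA_stepA, one_mul]

/-- To reach weight m by one step, one starts at m - 1 and goes up or at m + 1 and goes down. The
coefficients are those of `gen_eq_stepA`, since step elements have counit 1. -/
theorem transl_weightProj_gen (q : Set.Ioo (0 : ℝ) 1) (a : ℝ) (m : ℤ) (g : Gen) :
    transl (weightProj q a m) (gen q g) =
      stepCoef q (par q a true (m - 1)) g • weightProj q a (m - 1) +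
      stepCoef q (par q a false (m + 1)) g • weightProj q a (m + 1) := by
  apply dual_ext_weight q a
  intro n c hc
  rw [transl_apply, gen_eq_stepA q g (par_ne_zero q a true n) (par_add_inv_ne_zero q a true n),
    add_mul, smul_mul_assoc, smul_mul_assoc, ← par_not]
  rw [map_add, map_smul, map_smul, weightProj_stepA_mul q a _ _ m n hc,
    weightProj_stepA_mul q a _ _ m n hc]
  change _ = stepCoef q (par q a true (m - 1)) g • weightProj q a (m - 1) c +
    stepCoef q (par q a false (m + 1)) g • weightProj q a (m + 1) c
  rw [weightProj_spec q a _ _ c hc, weightProj_spec q a _ _ c hc]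
  have e1 : n + dir true = m ↔ n = m - 1 := by simp only [dir, if_true]; omega
  have e2 : n + dir (!true) = m ↔ n = m + 1 := by
    simp only [dir, Bool.not_true, Bool.false_eq_true, if_false]; omega
  simp only [e1, e2]
  congr 1
  · by_cases h : n = m - 1
    · simp [h]
    · simp [h]
  · by_cases h : n = m + 1
    · simp [h]
    · simp [h]

theorem transl_gen_mem_Ic (q : Set.Ioo (0 : ℝ) 1) (a : ℝ) (g : Gen) {x : Dual q}
    (hx : x ∈ Ic q a) : transl x (gen q g) ∈ Ic q a := by
  induction hx using Submodule.span_induction with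
  | mem x hx =>
    obtain ⟨m, rfl⟩ := hx
    rw [transl_weightProj_gen]
    exact add_mem (Submodule.smul_mem _ _ (Submodule.subset_span ⟨_, rfl⟩))
      (Submodule.smul_mem _ _ (Submodule.subset_span ⟨_, rfl⟩))
  | zero => exact zero_mem _
  | add x y _ _ hx hy => exact add_mem hx hy
  | smul r x _ hx => exact Submodule.smul_mem _ r hx

/-- A functional which vanishes on the weight space of `c` vanishes on the first leg of `Δ(c)`. -/
theorem actR_eq_zero_of_weight (q : Set.Ioo (0 : ℝ) 1) (a : ℝ) {x : Dual q} {n : ℤ}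
    (hx : ∀ c, weightOp q a c = wt q a n • c → x c = 0) {c : OqSU2 q}
    (hc : weightOp q a c = wt q a n • c) : actR q x c = 0 := by
  set T : OqSU2 q →ₗ[ℂ] OqSU2 q := weightOp q a - wt q a n • LinearMap.id with hT
  have hTc : T c = 0 := by simp [hT, hc]
  -- Over a field, a functional that kills the kernel of `T` factors through `T`.
  obtain ⟨f, hf⟩ : ∃ f : OqSU2 q →ₗ[ℂ] ℂ, f ∘ₗ T = x.ofConv := by
    have h : x.ofConv ∈ (LinearMap.ker T).dualAnnihilator := by
      rw [Submodule.mem_dualAnnihilator]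
      intro d hd
      apply hx
      rw [LinearMap.mem_ker] at hd
      simpa [hT, sub_eq_zero] using hd
    rw [← LinearMap.range_dualMap_eq_dualAnnihilator_ker] at h
    obtain ⟨f, hf⟩ := h
    exact ⟨f, hf⟩
  -- By coassociativity, acting on c before the coproduct is the same as acting on the first leg
  -- after it.
  have hcoassoc : ∀ d, T.rTensor (OqSU2 q) (Coalgebra.comul (R := ℂ) d) =
      Coalgebra.comul (R := ℂ) (T d) := by
    have key : ∀ h : Dual q, ∀ d, (actR q h).rTensor (OqSU2 q) (Coalgebra.comul (R := ℂ) d) =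
        Coalgebra.comul (R := ℂ) (actR q h d) := by
      intro h d
      have h1 := Coalgebra.coassoc_apply (R := ℂ) d
      have h2 := congrArg ((TensorProduct.lid ℂ (OqSU2 q ⊗[ℂ] OqSU2 q)).toLinearMap ∘ₗ
        (h.ofConv.rTensor (OqSU2 q ⊗[ℂ] OqSU2 q))) h1
      refine Eq.trans ?_ (h2.trans ?_)
      · generalize (Coalgebra.comul (R := ℂ) d) = Z
        induction Z using TensorProduct.induction_on with
        | zero => simp
        | add x y hx hy => simp only [map_add, hx, hy]
        | tmul x y =>
          simp only [LinearMap.rTensor_tmul, actR, LinearMap.comp_apply]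
          generalize (Coalgebra.comul (R := ℂ) x) = Z
          induction Z using TensorProduct.induction_on with
          | zero => simp
          | add x y hx hy => simp only [map_add, TensorProduct.add_tmul, hx, hy]
          | tmul x z => simp [TensorProduct.smul_tmul']
      · simp only [actR, LinearMap.comp_apply]
        generalize (Coalgebra.comul (R := ℂ) d) = Z
        induction Z using TensorProduct.induction_on with
        | zero => simp
        | add x y hx hy => simp only [map_add, hx, hy]
        | tmul x y => simp
    intro d
    rw [hT, LinearMap.rTensor_sub, LinearMap.rTensor_smul, LinearMap.rTensor_id]
    simp only [LinearMap.sub_apply, LinearMap.smul_apply, LinearMap.id_apply, map_sub, map_smul]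
    rw [weightOp, key]
  have h3 : actR q x c = TensorProduct.lid ℂ (OqSU2 q) (f.rTensor (OqSU2 q)
      (T.rTensor (OqSU2 q) (Coalgebra.comul (R := ℂ) c))) := by
    rw [← LinearMap.rTensor_comp_apply, hf]
    rfl
  rw [h3, hcoassoc, hTc]
  simp

theorem conv_apply {q : Set.Ioo (0 : ℝ) 1} (x y : Dual q) (c : OqSU2 q) :
    (x * y) c = y (actR q x c) := by
  rw [LinearMap.convMul_apply]
  simp only [actR, LinearMap.comp_apply]
  generalize (Coalgebra.comul (R := ℂ) c) = Z
  induction Z using TensorProduct.induction_on with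
  | zero => simp
  | add x y hx hy => simp only [map_add, hx, hy]
  | tmul x y => simp

/-- The right action of Φ_m is the projection onto the m-th weight space, so the Φ_m are orthogonal
idempotents. -/
theorem weightProj_mul (q : Set.Ioo (0 : ℝ) 1) (a : ℝ) (m n : ℤ) :
    weightProj q a m * weightProj q a n = if m = n then weightProj q a n else 0 := by
  apply dual_ext_weight q a
  intro k c hc
  rw [conv_apply]
  by_cases hk : k = m
  · subst hk
    -- On the weight space of `c` the functional Φ_k agrees with ε, and ε acts as the identity.
    have h : actR q (weightProj q a k - WithConv.toConv (counitA q).toLinearMap) c = 0 := by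
      refine actR_eq_zero_of_weight q a (n := k) (fun d hd => ?_) hc
      have := weightProj_spec q a k k d hd
      rw [if_pos rfl] at this
      change weightProj q a k d - counitA q d = 0
      rw [this, sub_self]
    have h2 : actR q (weightProj q a k) c = c := by
      have e : actR q (WithConv.toConv (counitA q).toLinearMap) c = c := by
        have h1 := Coalgebra.rTensor_counit_comul (R := ℂ) c
        have h2 : (counitA q).toLinearMap.rTensor (OqSU2 q) (comulA q c) = 1 ⊗ₜ[ℂ] c := h1
        rw [actR_eq]
        change TensorProduct.lid ℂ (OqSU2 q) ((counitA q).toLinearMap.rTensor _ _) = c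
        rw [h2]
        simp
      rw [← sub_eq_zero]
      nth_rewrite 2 [← e]
      rw [← h]
      simp [actR, LinearMap.rTensor_sub]
    rw [h2]
    by_cases hkn : k = n
    · simp [hkn]
    · rw [weightProj_spec q a n k c hc]; simp [hkn]
  · have h : actR q (weightProj q a m) c = 0 := by
      refine actR_eq_zero_of_weight q a (n := k) (fun d hd => ?_) hc
      rw [weightProj_spec q a m k d hd, if_neg hk]
    rw [h, map_zero]
    split_ifs with h2
    · subst h2; rw [weightProj_spec q a m k c hc, if_neg hk]
    · rfl

/-! ### Coproducts of the generators of the Podleś sphere -/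

/-- The first legs are written in terms of X, X*, Y and 1, the form in which the exchange relation
can be applied. -/
theorem comul_podX (q : Set.Ioo (0 : ℝ) 1) (a : ℝ) : comulA q (podX q a) =
    podX q a ⊗ₜ (gen q .al * gen q .al) + podXs q a ⊗ₜ (qc q • (gen q .ga * gen q .ga)) +
    podY q a ⊗ₜ ((1 + qc q ^ 2) • (gen q .ga * gen q .al)) +
    1 ⊗ₜ ((-(Complex.I * qc q * dbr q a)) • (gen q .ga * gen q .al)) := by
  have hq := qc_ne_zero q
  have hI := Complex.I_sq
  simp only [podX, podXs, podY, map_add, map_sub, map_smul, map_mul, comulA_gen, comulGen,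
    mul_add, add_mul, mul_sub, sub_mul, smul_mul_assoc, mul_smul_comm,
    Algebra.TensorProduct.tmul_mul_tmul, rel₁', rel₂', rel₃, rel₄, rel₅, als_mul_ga, als_mul_gas,
    TensorProduct.tmul_smul, smul_tmul_out, TensorProduct.tmul_sub, TensorProduct.tmul_add,
    TensorProduct.sub_tmul, TensorProduct.add_tmul]
  match_scalars <;> field_simp <;> ring_nf

theorem comul_podXs (q : Set.Ioo (0 : ℝ) 1) (a : ℝ) : comulA q (podXs q a) =
    podX q a ⊗ₜ (qc q • (gen q .gas * gen q .gas)) + podXs q a ⊗ₜ (gen q .als * gen q .als) +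
    podY q a ⊗ₜ ((-(1 + qc q ^ 2)) • (gen q .als * gen q .gas)) +
    1 ⊗ₜ ((Complex.I * qc q * dbr q a) • (gen q .als * gen q .gas)) := by
  have hq := qc_ne_zero q
  have hI := Complex.I_sq
  simp only [podX, podXs, podY, map_add, map_sub, map_smul, map_mul, comulA_gen, comulGen,
    mul_add, add_mul, mul_sub, sub_mul, smul_mul_assoc, mul_smul_comm,
    Algebra.TensorProduct.tmul_mul_tmul, rel₁', rel₂', rel₃, rel₄, rel₅, als_mul_ga, als_mul_gas,
    TensorProduct.tmul_smul, smul_tmul_out, TensorProduct.tmul_sub, TensorProduct.tmul_add,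
    TensorProduct.sub_tmul, TensorProduct.add_tmul]
  match_scalars <;> field_simp <;> ring_nf

theorem comul_podY (q : Set.Ioo (0 : ℝ) 1) (a : ℝ) : comulA q (podY q a) =
    podX q a ⊗ₜ (-(gen q .al * gen q .gas)) + podXs q a ⊗ₜ (gen q .ga * gen q .als) +
    podY q a ⊗ₜ (gen q .al * gen q .als - gen q .ga * gen q .gas) +
    1 ⊗ₜ ((Complex.I * qc q * dbr q a) • (gen q .ga * gen q .gas)) := by
  have hq := qc_ne_zero q
  have hI := Complex.I_sq
  simp only [podX, podXs, podY, map_add, map_sub, map_smul, map_mul, comulA_gen, comulGen,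
    mul_add, add_mul, mul_sub, sub_mul, smul_mul_assoc, mul_smul_comm,
    Algebra.TensorProduct.tmul_mul_tmul, rel₁', rel₂', rel₃, rel₄, rel₅, als_mul_ga, als_mul_gas,
    TensorProduct.tmul_smul, smul_tmul_out, TensorProduct.tmul_sub, TensorProduct.tmul_add,
    TensorProduct.sub_tmul, TensorProduct.add_tmul, TensorProduct.tmul_neg,
    Algebra.TensorProduct.one_def]
  match_scalars <;> field_simp <;> ring_nf

/-! ### Relations in the Podleś sphere -/

theorem gen_assoc (q : Set.Ioo (0 : ℝ) 1) (c : OqSU2 q) :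
    gen q .als * (gen q .al * c) = c - gen q .ga * (gen q .gas * c) ∧
    gen q .al * (gen q .als * c) = c - (qc q) ^ 2 • (gen q .ga * (gen q .gas * c)) ∧
    gen q .gas * (gen q .ga * c) = gen q .ga * (gen q .gas * c) ∧
    gen q .al * (gen q .ga * c) = qc q • (gen q .ga * (gen q .al * c)) ∧
    gen q .al * (gen q .gas * c) = qc q • (gen q .gas * (gen q .al * c)) ∧
    gen q .als * (gen q .ga * c) = (qc q)⁻¹ • (gen q .ga * (gen q .als * c)) ∧
    gen q .als * (gen q .gas * c) = (qc q)⁻¹ • (gen q .gas * (gen q .als * c)) := by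
  simp only [← mul_assoc, rel₁', rel₂', rel₃, rel₄, rel₅, als_mul_ga, als_mul_gas, sub_mul,
    smul_mul_assoc, one_mul, and_self]

theorem pod_rel (q : Set.Ioo (0 : ℝ) 1) (a : ℝ) :
    podX q a * podY q a = qc q ^ 2 • (podY q a * podX q a) ∧
    podXs q a * podY q a = (qc q ^ 2)⁻¹ • (podY q a * podXs q a) ∧
    podX q a * podXs q a = 1 - (Complex.I * qc q * dbr q a) • podY q a
      + qc q ^ 2 • (podY q a * podY q a) ∧
    podXs q a * podX q a = 1 - (Complex.I * (qc q)⁻¹ * dbr q a) • podY q a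
      + (qc q ^ 2)⁻¹ • (podY q a * podY q a) := by
  have hq := qc_ne_zero q
  have hI := Complex.I_sq
  have hI3 : Complex.I ^ 3 = -Complex.I := by rw [pow_succ, hI]; ring
  have h1 := fun c => (gen_assoc q c).1
  have h2 := fun c => (gen_assoc q c).2.1
  have h3 := fun c => (gen_assoc q c).2.2.1
  have h4 := fun c => (gen_assoc q c).2.2.2.1
  have h5 := fun c => (gen_assoc q c).2.2.2.2.1
  have h6 := fun c => (gen_assoc q c).2.2.2.2.2.1
  have h7 := fun c => (gen_assoc q c).2.2.2.2.2.2
  refine ⟨?_, ?_, ?_, ?_⟩ <;>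
  · simp only [podX, podXs, podY, mul_add, add_mul, mul_sub, sub_mul, smul_mul_assoc, mul_smul_comm,
      mul_assoc, rel₁', rel₂', rel₃, rel₄, rel₅, als_mul_ga, als_mul_gas, h1, h2, h3, h4, h5, h6,
      h7, mul_one]
    match_scalars <;> field_simp <;> ring_nf

/-! ### The raising and lowering elements of the Podleś sphere -/

/-- The element `s X - s⁻¹ X* - √-1 (q + q⁻¹) Y - t` with `t = ⟦a⟧`. -/
def ladA (q : Set.Ioo (0 : ℝ) 1) (a : ℝ) (s : ℂ) : OqSU2 q :=
  s • podX q a - s⁻¹ • podXs q a - (Complex.I * (qc q + (qc q)⁻¹)) • podY q a - dbr q a • 1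

/-- `ladA` as an element of the Podleś sphere. -/
def ladB (q : Set.Ioo (0 : ℝ) 1) (a : ℝ) (s : ℂ) : podles q a :=
  ⟨ladA q a s, sub_mem (sub_mem (sub_mem (Subalgebra.smul_mem _ (podX_mem q a) _)
    (Subalgebra.smul_mem _ (podXs_mem q a) _)) (Subalgebra.smul_mem _ (podY_mem q a) _))
    (Subalgebra.smul_mem _ (one_mem _) _)⟩

/-- A_b is how the Casimir Ω acts at weight [b]. This is centrality of Ω seen along a ladder step,
which multiplies the weight parameter s by q². -/
theorem casA_mul_ladA (q : Set.Ioo (0 : ℝ) 1) (a : ℝ) {b b' : ℝ} {s : ℂ} (hs : s ≠ 0)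
    (hb : s - s⁻¹ = dbr q b) (hb' : qc q ^ 2 * s - (qc q ^ 2 * s)⁻¹ = dbr q b') :
    casA q a b' * ladA q a s = ladA q a s * casA q a b := by
  have hq := qc_ne_zero q
  have hI := Complex.I_sq
  obtain ⟨h1, h2, h3, h4⟩ := pod_rel q a
  simp only [casA, ladA, ← hb, ← hb', mul_add, add_mul, mul_sub, sub_mul, smul_mul_assoc,
    mul_smul_comm, h1, h2, h3, h4, mul_one, one_mul]
  match_scalars <;> field_simp <;> ring_nf <;> (try simp only [hI]) <;> (try ring1)

/-- The parameter -(q²s)⁻¹ is the one of the opposite direction at the new weight, so this is a step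
and its return. The result is a polynomial in A_b, hence a scalar on A_b-eigenvectors. -/
theorem ladA_mul_ladA (q : Set.Ioo (0 : ℝ) 1) (a : ℝ) {b : ℝ} {s : ℂ} (hs : s ≠ 0)
    (hb : s - s⁻¹ = dbr q b) :
    ladA q a (-(qc q ^ 2 * s)⁻¹) * ladA q a s =
      ((qc q * s) ^ 2 + ((qc q * s) ^ 2)⁻¹ + 2 + dbr q a ^ 2) • 1 - casA q a b * casA q a b
        - (dbr q a * (qc q * s - (qc q * s)⁻¹)) • casA q a b := by
  have hq := qc_ne_zero q
  have hI := Complex.I_sq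
  obtain ⟨h1, h2, h3, h4⟩ := pod_rel q a
  simp only [casA, ladA, ← hb, mul_add, add_mul, mul_sub, sub_mul, smul_mul_assoc,
    mul_smul_comm, h1, h2, h3, h4, mul_one, one_mul]
  match_scalars <;> field_simp <;> ring_nf <;> (try simp only [hI]) <;> (try ring1)

/-! ### Matrix coefficients of the action on weight vectors -/

/-- The elements whose translations preserve `Ic` contain 1 and are stable under left multiplication
by generators, because translating by gc is translating by g and then by c. -/
theorem transl_mem_Ic (q : Set.Ioo (0 : ℝ) 1) (a : ℝ) {x : Dual q} (hx : x ∈ Ic q a)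
    (c : OqSU2 q) : transl x c ∈ Ic q a := by
  let S : Submodule ℂ (OqSU2 q) :=
    { carrier := {c | ∀ x ∈ Ic q a, transl x c ∈ Ic q a}
      add_mem' := fun {c d} hc hd x hx => by
        have : transl x (c + d) = transl x c + transl x d := by
          refine congrArg WithConv.toConv (?_ : _ = x.ofConv ∘ₗ LinearMap.mulLeft ℂ c +
            x.ofConv ∘ₗ LinearMap.mulLeft ℂ d)
          ext e
          simp [add_mul]
        rw [this]; exact add_mem (hc x hx) (hd x hx)
      zero_mem' := fun x hx => by
        have : transl x 0 = 0 := by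
          simp only [transl, LinearMap.mulLeft_zero_eq_zero, LinearMap.comp_zero]; rfl
        rw [this]; exact zero_mem _
      smul_mem' := fun r c hc x hx => by
        have : transl x (r • c) = r • transl x c := by
          refine congrArg WithConv.toConv (?_ : _ = r • (x.ofConv ∘ₗ LinearMap.mulLeft ℂ c))
          ext e
          simp
        rw [this]; exact Submodule.smul_mem _ r (hc x hx) }
  have hS : S = ⊤ := by
    apply eq_top_of_gen_mul_mem
    · intro x hx
      rwa [transl_one]
    · intro g c hc x hx
      rw [transl_mul]
      exact hc _ (transl_gen_mem_Ic q a g hx)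
  have : c ∈ S := hS ▸ Submodule.mem_top
  exact this x hx

/-- Multiplying 1 by successive step elements reaches every weight without changing the counit. The
resulting vectors are dual to the Φ_m, so an element of `Ic` can be read off from its values on
them. -/
theorem exists_weight_vector (q : Set.Ioo (0 : ℝ) 1) (a : ℝ) (n : ℤ) :
    ∃ c : OqSU2 q, weightOp q a c = wt q a n • c ∧ counitA q c = 1 := by
  have step : ∀ (u : Bool) (k : ℕ), ∃ c : OqSU2 q,
      weightOp q a c = wt q a (dir u * k) • c ∧ counitA q c = 1 := by
    intro u k
    induction k with
    | zero =>
      refine ⟨1, ?_, map_one _⟩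
      simpa using mem_podles_iff.1 (one_mem (podles q a))
    | succ k ih =>
      obtain ⟨c, hc, h1⟩ := ih
      refine ⟨stepA q true (par q a u (dir u * k)) * c, ?_, ?_⟩
      · have h := weightOp_stepA_mul q a true (par_ne_zero q a u _) (by rwa [wtC_par])
        rw [← par_add_dir, wtC_par] at h
        rw [h]
        congr 2
        push_cast
        ring
      · rw [map_mul, counitA_stepA, h1, one_mul]
  obtain ⟨k, rfl | rfl⟩ := Int.eq_nat_or_neg n
  · simpa [dir] using step true k
  · simpa [dir] using step false k

/-- A vector of weight `[a + n]` in `O_q(SU(2))` with `ε = 1`. -/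
def wtVec (q : Set.Ioo (0 : ℝ) 1) (a : ℝ) (n : ℤ) : OqSU2 q := (exists_weight_vector q a n).choose

theorem weightProj_wtVec (q : Set.Ioo (0 : ℝ) 1) (a : ℝ) (m n : ℤ) :
    weightProj q a m (wtVec q a n) = if n = m then 1 else 0 := by
  obtain ⟨h1, h2⟩ := (exists_weight_vector q a n).choose_spec
  exact (weightProj_spec q a m n _ h1).trans (by rw [h2])

/-- The coefficient with which `Φ_m` acts on `c` times a vector of weight `[a + n]`. -/
def coefA (q : Set.Ioo (0 : ℝ) 1) (a : ℝ) (m n : ℤ) : OqSU2 q →ₗ[ℂ] ℂ :=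
  (weightProj q a m).ofConv ∘ₗ LinearMap.mulRight ℂ (wtVec q a n)

theorem coefA_gen_mul_gen (q : Set.Ioo (0 : ℝ) 1) (a : ℝ) (m n : ℤ) (g h : Gen) :
    coefA q a m n (gen q g * gen q h) =
      stepCoef q (par q a true (m - 1)) g *
        (stepCoef q (par q a true (m - 2)) h * (if n = m - 2 then 1 else 0) +
          stepCoef q (par q a false m) h * (if n = m then 1 else 0)) +
      stepCoef q (par q a false (m + 1)) g *
        (stepCoef q (par q a true m) h * (if n = m then 1 else 0) +
          stepCoef q (par q a false (m + 2)) h * (if n = m + 2 then 1 else 0)) := by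
  have h1 : coefA q a m n (gen q g * gen q h) =
    transl (transl (weightProj q a m) (gen q g)) (gen q h) (wtVec q a n) := by
    rw [← transl_mul]; rfl
  rw [h1, transl_weightProj_gen, transl_add, transl_smul, transl_smul, transl_weightProj_gen,
    transl_weightProj_gen]
  simp only [← weightProj_wtVec q a]
  have e1 : m - 1 - 1 = m - 2 := by ring
  have e2 : m - 1 + 1 = m := by ring
  have e3 : m + 1 - 1 = m := by ring
  have e4 : m + 1 + 1 = m + 2 := by ring
  rw [e1, e2, e3, e4]
  rfl

/-- Only one two-step path joins these weights: both steps go in direction `u`, the right factor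
first. -/
theorem coefA_raise (q : Set.Ioo (0 : ℝ) 1) (a : ℝ) (u : Bool) (n : ℤ) (g h : Gen) :
    coefA q a (n + 2 * dir u) n (gen q g * gen q h) =
      stepCoef q (qc q * par q a u n) g * stepCoef q (par q a u n) h := by
  rw [coefA_gen_mul_gen, ← par_add_dir]
  cases u
  · have e0 : n + 2 * dir false = n - 2 := by simp [dir]; ring
    have e1 : n + dir false = n - 1 := by simp [dir]; ring
    rw [e0, e1, if_neg (by omega), if_neg (by omega), if_pos (by omega)]
    have e2 : n - 2 + 1 = n - 1 := by ring
    have e3 : n - 2 + 2 = n := by ring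
    rw [e2, e3]
    ring
  · have e0 : n + 2 * dir true = n + 2 := by simp [dir]
    have e1 : n + dir true = n + 1 := by simp [dir]
    rw [e0, e1, if_pos (by omega), if_neg (by omega), if_neg (by omega)]
    have e2 : n + 2 - 1 = n + 1 := by ring
    have e3 : n + 2 - 2 = n := by ring
    rw [e2, e3]
    ring

/-- There are two loops of length two, through n - 1 (first term) and through n + 1 (second term).
-/
theorem coefA_diag (q : Set.Ioo (0 : ℝ) 1) (a : ℝ) (n : ℤ) (g h : Gen) :
    coefA q a n n (gen q g * gen q h) =
      stepCoef q (sig q a n / qc q) g * stepCoef q (-(sig q a n)⁻¹) h +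
      stepCoef q (-(qc q * sig q a n)⁻¹) g * stepCoef q (sig q a n) h := by
  rw [coefA_gen_mul_gen, if_neg (by omega), if_pos rfl, if_neg (by omega)]
  have e1 : par q a true (n - 1) = sig q a n / qc q := by
    simp only [par, if_true, sub_eq_add_neg, sig_add, zpow_neg, zpow_one]
    field_simp
  have e2 : par q a false (n + 1) = -(qc q * sig q a n)⁻¹ := by
    simp [par, sig_add]
  rw [e1, e2]
  simp only [par, if_true, Bool.false_eq_true, if_false]
  ring

/-! ### Structure of the double -/

/-- The inclusion `O_q(S_t²) → DAlg` as an algebra homomorphism. -/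
def incBHom (q : Set.Ioo (0 : ℝ) 1) (a : ℝ) : podles q a →ₐ[ℂ] DAlg q a :=
  AlgHom.ofLinearMap
    { toFun := incB q a
      map_add' := fun b c =>
        (RingQuot.mkAlgHom_rel ℂ (DRel.b_add b c)).trans (map_add _ _ _)
      map_smul' := fun r b => by
        rw [Algebra.smul_def, Algebra.smul_def]
        refine (RingQuot.mkAlgHom_rel ℂ (DRel.b_mul _ b)).trans ((map_mul _ _ _).trans ?_)
        refine congrArg (fun z : DAlg q a => z * incB q a b) ?_
        exact (RingQuot.mkAlgHom_rel ℂ (DRel.b_scalar r)).trans (AlgHom.commutes _ _) }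
    (by
      have h := RingQuot.mkAlgHom_rel ℂ (DRel.b_scalar (q := q) (a := a) 1)
      rw [map_one, map_one, map_one] at h
      exact h)
    (fun b c => (RingQuot.mkAlgHom_rel ℂ (DRel.b_mul b c)).trans (map_mul _ _ _))

theorem incBHom_apply (q : Set.Ioo (0 : ℝ) 1) (a : ℝ) (b : podles q a) :
    incBHom q a b = incB q a b := rfl

/-- The inclusion `I_c → DAlg` as a linear map. -/
def incILin (q : Set.Ioo (0 : ℝ) 1) (a : ℝ) : Ic q a →ₗ[ℂ] DAlg q a where
  toFun := incI q a
  map_add' x y := (RingQuot.mkAlgHom_rel ℂ (DRel.x_add x y)).trans (map_add _ _ _)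
  map_smul' r x := (RingQuot.mkAlgHom_rel ℂ (DRel.x_smul r x)).trans (map_smul _ _ _)

theorem incILin_apply (q : Set.Ioo (0 : ℝ) 1) (a : ℝ) (x : Ic q a) :
    incILin q a x = incI q a x := rfl

theorem incI_mul_incI (q : Set.Ioo (0 : ℝ) 1) (a : ℝ) (x y z : Ic q a)
    (h : (z : Dual q) = (x : Dual q) * (y : Dual q)) : incI q a x * incI q a y = incI q a z :=
  ((RingQuot.mkAlgHom_rel ℂ (DRel.x_mul x y z h)).trans (map_mul _ _ _)).symm

theorem incI_projI_mul (q : Set.Ioo (0 : ℝ) 1) (a : ℝ) (m n : ℤ) :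
    incI q a (projI q a m) * incI q a (projI q a n) =
      if m = n then incI q a (projI q a n) else 0 := by
  split_ifs with h
  · refine incI_mul_incI q a _ _ _ ?_
    change weightProj q a n = weightProj q a m * weightProj q a n
    rw [weightProj_mul, if_pos h]
  · rw [incI_mul_incI q a _ _ 0, ← incILin_apply, map_zero]
    change 0 = weightProj q a m * weightProj q a n
    rw [weightProj_mul, if_neg h]

theorem incI_mul_incB (q : Set.Ioo (0 : ℝ) 1) (a : ℝ) (x : Ic q a) (b : podles q a) {N : ℕ}
    (b₁ : Fin N → podles q a) (b₂ : Fin N → OqSU2 q)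
    (hb : comulA q (b : OqSU2 q) = ∑ i, (b₁ i : OqSU2 q) ⊗ₜ[ℂ] b₂ i) :
    incI q a x * incB q a b = ∑ i, incB q a (b₁ i) *
      incI q a ⟨transl (x : Dual q) (b₂ i), transl_mem_Ic q a x.2 (b₂ i)⟩ := by
  have h := RingQuot.mkAlgHom_rel ℂ (DRel.exchange x b N b₁ b₂
    (fun i => ⟨transl (x : Dual q) (b₂ i), transl_mem_Ic q a x.2 (b₂ i)⟩) hb (fun i => rfl))
  refine (map_mul _ _ _).symm.trans (h.trans ((map_sum _ _ _).trans ?_))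
  exact Finset.sum_congr rfl fun i _ => map_mul _ _ _

/-- The generators of the Podleś sphere as elements of it. -/
def xB (q : Set.Ioo (0 : ℝ) 1) (a : ℝ) : podles q a := ⟨podX q a, podX_mem q a⟩
/-- The element `X*` of the Podleś sphere. -/
def xsB (q : Set.Ioo (0 : ℝ) 1) (a : ℝ) : podles q a := ⟨podXs q a, podXs_mem q a⟩
/-- The element `Y` of the Podleś sphere. -/
def yB (q : Set.Ioo (0 : ℝ) 1) (a : ℝ) : podles q a := ⟨podY q a, podY_mem q a⟩

theorem ladB_eq (q : Set.Ioo (0 : ℝ) 1) (a : ℝ) (s : ℂ) :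
    ladB q a s = s • xB q a - s⁻¹ • xsB q a - (Complex.I * (qc q + (qc q)⁻¹)) • yB q a
      - dbr q a • 1 := rfl

theorem casB_eq (q : Set.Ioo (0 : ℝ) 1) (a b : ℝ) :
    casB q a b = (qc q)⁻¹ • xB q a + qc q • xsB q a + (Complex.I * dbr q b) • yB q a := rfl

section Module

variable {q : Set.Ioo (0 : ℝ) 1} {a : ℝ} {M : Type} [AddCommGroup M] [Module ℂ M]
  [Module (DAlg q a) M] [IsScalarTower ℂ (DAlg q a) M]

theorem incI_smul_of_weight {n : ℤ} {v : M} (hv : incI q a (projI q a n) • v = v) (x : Ic q a) :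
    incI q a x • v = (x : Dual q) (wtVec q a n) • v := by
  obtain ⟨x, hx⟩ := x
  induction hx using Submodule.span_induction with
  | mem x hx =>
    obtain ⟨m, rfl⟩ := hx
    change incI q a (projI q a m) • v = weightProj q a m (wtVec q a n) • v
    rw [← hv, ← mul_smul, incI_projI_mul, weightProj_wtVec]
    by_cases h : m = n
    · simp [h, hv]
    · simp [h, Ne.symm h]
  | zero =>
    have : incI q a ⟨0, zero_mem _⟩ = 0 := map_zero (incILin q a)
    rw [this]
    simp
  | add x y hx' hy' hx hy =>
    have : incI q a ⟨x + y, add_mem hx' hy'⟩ = incI q a ⟨x, hx'⟩ + incI q a ⟨y, hy'⟩ :=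
      map_add (incILin q a) ⟨x, hx'⟩ ⟨y, hy'⟩
    rw [this, add_smul, hx, hy, ← add_smul]
    rfl
  | smul r x hx' hx =>
    have : incI q a ⟨r • x, Submodule.smul_mem _ r hx'⟩ = r • incI q a ⟨x, hx'⟩ :=
      map_smul (incILin q a) r ⟨x, hx'⟩
    rw [this, smul_assoc, hx, smul_smul]
    rfl

theorem incI_smul_incB_smul {n : ℤ} {v : M} (hv : incI q a (projI q a n) • v = v) (m : ℤ)
    (b : podles q a) (c₁ c₂ c₃ c₄ : OqSU2 q)
    (hb : comulA q (b : OqSU2 q) =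
      podX q a ⊗ₜ c₁ + podXs q a ⊗ₜ c₂ + podY q a ⊗ₜ c₃ + 1 ⊗ₜ c₄) :
    incI q a (projI q a m) • incB q a b • v =
      (coefA q a m n c₁ • incB q a (xB q a) + coefA q a m n c₂ • incB q a (xsB q a) +
        coefA q a m n c₃ • incB q a (yB q a) + coefA q a m n c₄ • (1 : DAlg q a)) • v := by
  have h := incI_mul_incB q a (projI q a m) b ![xB q a, xsB q a, yB q a, 1] ![c₁, c₂, c₃, c₄]
    (by rw [hb]; simp [Fin.sum_univ_four, xB, xsB, yB])
  rw [← mul_smul, h, Fin.sum_univ_four]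
  have h1 : incB q a 1 = 1 := map_one (incBHom q a)
  simp only [Matrix.cons_val_zero, Matrix.cons_val_one, Matrix.cons_val, add_smul, mul_smul,
    incI_smul_of_weight hv, h1, smul_assoc, one_smul]
  simp only [smul_comm (_ : DAlg q a) (_ : ℂ) v]
  rfl

/-- By the exchange relation, Φ_{n±2} turns each of X, X*, Y, 1 acting on v into a combination of
the four with coefficients from `coefA_raise`. The vector of coefficients of E_s is fixed by this
transformation. -/
theorem weight_ladB_smul {n : ℤ} {v : M} (hv : incI q a (projI q a n) • v = v) (u : Bool) :
    incI q a (projI q a (n + 2 * dir u)) • incB q a (ladB q a (par q a u n)) • v =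
      incB q a (ladB q a (par q a u n)) • v := by
  set s := par q a u n with hs
  have hq := qc_ne_zero q
  have hs0 : s ≠ 0 := par_ne_zero q a u n
  have hs1 : s + s⁻¹ ≠ 0 := par_add_inv_ne_zero q a u n
  have hs2 : qc q * s + (qc q * s)⁻¹ ≠ 0 := by
    rw [hs, ← par_add_dir]; exact par_add_inv_ne_zero q a u _
  have h3 : s ^ 2 + 1 ≠ 0 := by
    have h := mul_ne_zero hs0 hs1
    rwa [mul_add, mul_inv_cancel₀ hs0, ← pow_two] at h
  have h4 : qc q ^ 2 * s ^ 2 + 1 ≠ 0 := by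
    have h := mul_ne_zero (mul_ne_zero hq hs0) hs2
    rwa [mul_add, mul_inv_cancel₀ (mul_ne_zero hq hs0), ← pow_two, mul_pow] at h
  have hI := Complex.I_sq
  have hI3 : Complex.I ^ 3 = -Complex.I := by rw [pow_succ, hI]; ring
  have hI4 : Complex.I ^ 4 = 1 := Complex.I_pow_four
  have h5 : s ^ 2 * qc q ^ 2 + 1 ≠ 0 := by rwa [mul_comm]
  have e1 : s + s⁻¹ = (s ^ 2 + 1) / s := by field_simp
  have e2 : qc q * s + (qc q * s)⁻¹ = (qc q ^ 2 * s ^ 2 + 1) / (qc q * s) := by field_simp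
  rw [incI_smul_incB_smul hv _ _
    (s • (gen q .al * gen q .al) - s⁻¹ • (qc q • (gen q .gas * gen q .gas)) -
      (Complex.I * (qc q + (qc q)⁻¹)) • (-(gen q .al * gen q .gas)))
    (s • (qc q • (gen q .ga * gen q .ga)) - s⁻¹ • (gen q .als * gen q .als) -
      (Complex.I * (qc q + (qc q)⁻¹)) • (gen q .ga * gen q .als))
    (s • ((1 + qc q ^ 2) • (gen q .ga * gen q .al)) -
      s⁻¹ • ((-(1 + qc q ^ 2)) • (gen q .als * gen q .gas)) -
      (Complex.I * (qc q + (qc q)⁻¹)) • (gen q .al * gen q .als - gen q .ga * gen q .gas))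
    (s • ((-(Complex.I * qc q * dbr q a)) • (gen q .ga * gen q .al)) -
      s⁻¹ • ((Complex.I * qc q * dbr q a) • (gen q .als * gen q .gas)) -
      (Complex.I * (qc q + (qc q)⁻¹)) • ((Complex.I * qc q * dbr q a) •
        (gen q .ga * gen q .gas)) -
      -- The unit is written as αα* + q²γγ*, since `coefA_raise` evaluates only products of two
      -- generators.
      dbr q a • (gen q .al * gen q .als + (qc q) ^ 2 • (gen q .ga * gen q .gas)))]
  · congr 1
    rw [← incBHom_apply q a (ladB q a s), ladB_eq]
    simp only [map_sub, map_smul, map_add, map_neg, coefA_raise, ← hs, smul_eq_mul,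
      stepCoef, map_one, e1, e2]
    simp only [incBHom_apply]
    match_scalars <;> field_simp <;> ring_nf <;> (try simp only [hI, hI3, hI4]) <;> (try ring1)
  · rw [rel₂]
    change comulA q (ladA q a s) = _
    simp only [ladA, map_sub, map_smul, comul_podX, comul_podXs, comul_podY, map_one,
      Algebra.TensorProduct.one_def, TensorProduct.tmul_sub, TensorProduct.tmul_smul,
      TensorProduct.tmul_neg]
    module

/-- The same computation with the coefficients of `coefA_diag`: A_b fixes the weight [b], so
imposing an A_b-eigenvalue on a weight vector is consistent. -/
theorem weight_casB_smul {n : ℤ} {v : M} (hv : incI q a (projI q a n) • v = v) :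
    incI q a (projI q a n) • incB q a (casB q a (a + n)) • v =
      incB q a (casB q a (a + n)) • v := by
  set s := sig q a n with hs
  have hq := qc_ne_zero q
  have hs0 : s ≠ 0 := sig_ne_zero q a n
  have hs1 : s + s⁻¹ ≠ 0 := sig_add_inv_ne_zero q a n
  have hs2 : qc q * s + (qc q * s)⁻¹ ≠ 0 := by
    have := sig_add_inv_ne_zero q a (n + 1)
    rwa [sig_add, zpow_one] at this
  have hs3 : s / qc q + (s / qc q)⁻¹ ≠ 0 := by
    have := sig_add_inv_ne_zero q a (n + (-1))
    rwa [sig_add, zpow_neg, zpow_one, mul_comm, ← div_eq_mul_inv] at this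
  have h3 : s ^ 2 + 1 ≠ 0 := by
    have h := mul_ne_zero hs0 hs1
    rwa [mul_add, mul_inv_cancel₀ hs0, ← pow_two] at h
  have h4 : qc q ^ 2 * s ^ 2 + 1 ≠ 0 := by
    have h := mul_ne_zero (mul_ne_zero hq hs0) hs2
    rwa [mul_add, mul_inv_cancel₀ (mul_ne_zero hq hs0), ← pow_two, mul_pow] at h
  have h5 : s ^ 2 + qc q ^ 2 ≠ 0 := by
    have h := mul_ne_zero (mul_ne_zero hq hs0) hs3
    field_simp at h
    exact h
  have hI := Complex.I_sq
  have hI3 : Complex.I ^ 3 = -Complex.I := by rw [pow_succ, hI]; ring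
  have hI4 : Complex.I ^ 4 = 1 := Complex.I_pow_four
  have e1 : -s⁻¹ + (-s⁻¹)⁻¹ = -(s ^ 2 + 1) / s := by field_simp; ring
  have e2 : -(qc q * s)⁻¹ + (-(qc q * s)⁻¹)⁻¹ = -(qc q ^ 2 * s ^ 2 + 1) / (qc q * s) := by
    field_simp; ring
  have e3 : s / qc q + (s / qc q)⁻¹ = (s ^ 2 + qc q ^ 2) / (qc q * s) := by field_simp
  have e4 : s + s⁻¹ = (s ^ 2 + 1) / s := by field_simp
  rw [incI_smul_incB_smul hv _ _
    ((qc q)⁻¹ • (gen q .al * gen q .al) + qc q • (qc q • (gen q .gas * gen q .gas)) +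
      (Complex.I * dbr q (a + n)) • (-(gen q .al * gen q .gas)))
    ((qc q)⁻¹ • (qc q • (gen q .ga * gen q .ga)) + qc q • (gen q .als * gen q .als) +
      (Complex.I * dbr q (a + n)) • (gen q .ga * gen q .als))
    ((qc q)⁻¹ • ((1 + qc q ^ 2) • (gen q .ga * gen q .al)) +
      qc q • ((-(1 + qc q ^ 2)) • (gen q .als * gen q .gas)) +
      (Complex.I * dbr q (a + n)) • (gen q .al * gen q .als - gen q .ga * gen q .gas))
    ((qc q)⁻¹ • ((-(Complex.I * qc q * dbr q a)) • (gen q .ga * gen q .al)) +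
      qc q • ((Complex.I * qc q * dbr q a) • (gen q .als * gen q .gas)) +
      (Complex.I * dbr q (a + n)) • ((Complex.I * qc q * dbr q a) •
        (gen q .ga * gen q .gas)))]
  · congr 1
    rw [← incBHom_apply q a (casB q a (a + n)), casB_eq]
    simp only [map_sub, map_smul, map_add, map_neg, coefA_diag, ← hs, smul_eq_mul,
      stepCoef, dbr_add_intCast, e1, e2, e3, e4]
    simp only [incBHom_apply]
    match_scalars <;> field_simp <;> ring_nf <;> (try simp only [hI, hI3, hI4]) <;> (try ring1)
  · change comulA q (casA q a _) = _
    simp only [casA, map_add, map_smul, comul_podX, comul_podXs, comul_podY,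
      TensorProduct.tmul_add, TensorProduct.tmul_smul]
    module

end Module

/-! ### The action of the double on `O_q(SU(2))` -/

/-- The left action `x ▷ c = c₍₁₎ x(c₍₂₎)`. -/
def actL (q : Set.Ioo (0 : ℝ) 1) (x : Dual q) : OqSU2 q →ₗ[ℂ] OqSU2 q :=
  (TensorProduct.rid ℂ (OqSU2 q)).toLinearMap ∘ₗ x.ofConv.lTensor (OqSU2 q) ∘ₗ Coalgebra.comul

theorem actL_eq (q : Set.Ioo (0 : ℝ) 1) (x : Dual q) (c : OqSU2 q) :
    actL q x c = TensorProduct.rid ℂ (OqSU2 q) (x.ofConv.lTensor (OqSU2 q) (comulA q c)) := rfl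

theorem actL_conv (q : Set.Ioo (0 : ℝ) 1) (x y : Dual q) (c : OqSU2 q) :
    actL q (x * y) c = actL q x (actL q y c) := by
  have h1 := Coalgebra.coassoc_apply (R := ℂ) c
  have h2 := congrArg ((TensorProduct.rid ℂ (OqSU2 q)).toLinearMap ∘ₗ
    (LinearMap.lTensor (OqSU2 q) (LinearMap.mul' ℂ ℂ ∘ₗ TensorProduct.map x.ofConv y.ofConv))) h1
  refine Eq.trans ?_ (h2.symm.trans ?_)
  · simp only [actL, LinearMap.comp_apply]
    generalize (Coalgebra.comul (R := ℂ) c) = Z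
    induction Z using TensorProduct.induction_on with
    | zero => simp
    | add x y hx hy => simp only [map_add, hx, hy]
    | tmul c d => simp [LinearMap.convMul_apply]
  · simp only [actL, LinearMap.comp_apply]
    generalize (Coalgebra.comul (R := ℂ) c) = Z
    induction Z using TensorProduct.induction_on with
    | zero => simp
    | add x y hx hy => simp only [map_add, hx, hy]
    | tmul c d =>
      simp only [LinearMap.lTensor_tmul, LinearMap.rTensor_tmul, LinearEquiv.coe_coe,
        TensorProduct.rid_tmul, map_smul]
      generalize (Coalgebra.comul (R := ℂ) c) = Z
      induction Z using TensorProduct.induction_on with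
      | zero => simp
      | add x y hx hy => simp only [map_add, TensorProduct.add_tmul, hx, hy, smul_add]
      | tmul x z => simp [smul_smul, mul_comm]

/-- This is the exchange relation in the regular representation, one tensor at a time. -/
theorem actL_tmul_mul (q : Set.Ioo (0 : ℝ) 1) (x : Dual q) (b₁ b₂ c : OqSU2 q) :
    TensorProduct.rid ℂ (OqSU2 q) (x.ofConv.lTensor (OqSU2 q) ((b₁ ⊗ₜ b₂) * comulA q c)) =
      b₁ * actL q (transl x b₂) c := by
  rw [actL_eq]
  generalize comulA q c = Z
  induction Z using TensorProduct.induction_on with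
  | zero => simp
  | add x y hx hy => simp only [map_add, mul_add, hx, hy]
  | tmul c d =>
    simp only [Algebra.TensorProduct.tmul_mul_tmul, LinearMap.lTensor_tmul,
      TensorProduct.rid_tmul, mul_smul_comm]
    rfl

/-- The representation of the double on `O_q(SU(2))`. -/
def regRep (q : Set.Ioo (0 : ℝ) 1) (a : ℝ) : DAlg q a →ₐ[ℂ] Module.End ℂ (OqSU2 q) :=
  RingQuot.liftAlgHom ℂ ⟨FreeAlgebra.lift ℂ
    (Sum.elim (fun b : podles q a => LinearMap.mulLeft ℂ (b : OqSU2 q))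
      (fun x : Ic q a => actL q (x : Dual q))), by
    intro u v h
    cases h with
    | b_scalar r => ext c; simp [Algebra.smul_def]
    | b_add b c => ext d; simp [add_mul]
    | b_mul b c => ext d; simp
    | x_smul r x => ext d; simp [actL, LinearMap.lTensor_smul]
    | x_add x y => ext d; simp [actL, LinearMap.lTensor_add]
    | x_mul x y z h => ext d; simp [h, actL_conv]
    | exchange x b n b₁ b₂ y hb hy =>
      ext c
      simp only [map_mul, map_sum, FreeAlgebra.lift_ι_apply, Sum.elim_inr, Sum.elim_inl, hy,
        Module.End.mul_apply, LinearMap.mulLeft_apply, LinearMap.sum_apply]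
      have hb' : comulA q (b : OqSU2 q) = ∑ i, (b₁ i : OqSU2 q) ⊗ₜ[ℂ] b₂ i := hb
      rw [actL_eq, map_mul, hb', Finset.sum_mul, map_sum, map_sum]
      exact Finset.sum_congr rfl fun i _ => actL_tmul_mul q x _ _ c⟩

theorem regRep_incB (q : Set.Ioo (0 : ℝ) 1) (a : ℝ) (b : podles q a) (c : OqSU2 q) :
    regRep q a (incB q a b) c = b * c := by
  unfold regRep incB
  exact (congrArg (fun f : Module.End ℂ (OqSU2 q) => f c)
    (RingQuot.liftAlgHom_mkAlgHom_apply ℂ _ _ _)).trans (by simp)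

theorem regRep_incI (q : Set.Ioo (0 : ℝ) 1) (a : ℝ) (x : Ic q a) (c : OqSU2 q) :
    regRep q a (incI q a x) c = actL q (x : Dual q) c := by
  unfold regRep incI
  exact (congrArg (fun f : Module.End ℂ (OqSU2 q) => f c)
    (RingQuot.liftAlgHom_mkAlgHom_apply ℂ _ _ _)).trans (by simp)

/-- The vector space `O_q(SU(2))`, as a module over the double. -/
def RegMod (q : Set.Ioo (0 : ℝ) 1) (_a : ℝ) : Type := OqSU2 q

instance (q : Set.Ioo (0 : ℝ) 1) (a : ℝ) : AddCommGroup (RegMod q a) :=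
  inferInstanceAs (AddCommGroup (OqSU2 q))

instance (q : Set.Ioo (0 : ℝ) 1) (a : ℝ) : Module ℂ (RegMod q a) :=
  inferInstanceAs (Module ℂ (OqSU2 q))

instance (q : Set.Ioo (0 : ℝ) 1) (a : ℝ) : Module (DAlg q a) (RegMod q a) :=
  Module.compHom (OqSU2 q) (regRep q a : DAlg q a →+* Module.End ℂ (OqSU2 q))

/-- The identification of `O_q(SU(2))` with the module `RegMod`. -/
def toReg (q : Set.Ioo (0 : ℝ) 1) (a : ℝ) : OqSU2 q ≃ₗ[ℂ] RegMod q a := LinearEquiv.refl ℂ _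

theorem smul_toReg (q : Set.Ioo (0 : ℝ) 1) (a : ℝ) (d : DAlg q a) (c : OqSU2 q) :
    d • toReg q a c = toReg q a (regRep q a d c) := rfl

instance (q : Set.Ioo (0 : ℝ) 1) (a : ℝ) : IsScalarTower ℂ (DAlg q a) (RegMod q a) where
  smul_assoc r d z := by
    obtain ⟨c, rfl⟩ := (toReg q a).surjective z
    rw [smul_toReg, smul_toReg, map_smul, LinearMap.smul_apply, map_smul]

section Module

variable {q : Set.Ioo (0 : ℝ) 1} {a : ℝ} {M : Type} [AddCommGroup M] [Module ℂ M]
  [Module (DAlg q a) M] [IsScalarTower ℂ (DAlg q a) M]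

/-- A subspace which is stable under `O_q(S_t²)` and `I_c` is a submodule. -/
theorem dalg_smul_mem (W : Submodule ℂ M) (hB : ∀ b, ∀ w ∈ W, incB q a b • w ∈ W)
    (hI : ∀ x, ∀ w ∈ W, incI q a x • w ∈ W) (d : DAlg q a) {w : M} (hw : w ∈ W) : d • w ∈ W := by
  let mk : FreeAlgebra ℂ (podles q a ⊕ Ic q a) →ₐ[ℂ] DAlg q a := RingQuot.mkAlgHom ℂ (DRel q a)
  have key : ∀ f, ∀ w ∈ W, mk f • w ∈ W := by
    intro f
    induction f using FreeAlgebra.induction with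
    | grade0 r =>
      intro w hw
      rw [AlgHom.commutes, algebraMap_smul]
      exact W.smul_mem r hw
    | grade1 g =>
      cases g with
      | inl b => exact hB b
      | inr x => exact hI x
    | mul f g hf hg =>
      intro w hw
      rw [map_mul, mul_smul]
      exact hf _ (hg _ hw)
    | add f g hf hg =>
      intro w hw
      rw [map_add, add_smul]
      exact add_mem (hf _ hw) (hg _ hw)
  obtain ⟨f, hf⟩ : ∃ f, mk f = d := RingQuot.mkAlgHom_surjective ℂ (DRel q a) d
  rw [← hf]
  exact key f w hw

end Module

/-! ### A left ideal of O_q(SU(2)) stable under the double, and a character that kills it -/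

theorem actL_weightProj_zero_one (q : Set.Ioo (0 : ℝ) 1) (a : ℝ) :
    actL q (weightProj q a 0) 1 = 1 := by
  rw [actL_eq, map_one, Algebra.TensorProduct.one_def, LinearMap.lTensor_tmul,
    TensorProduct.rid_tmul, weightProj_one, if_pos rfl, one_smul]

/-- The left ideal of `O_q(SU(2))` generated by `A_a - λ` is stable under the double. -/
theorem smul_mul_casA_sub (q : Set.Ioo (0 : ℝ) 1) (a : ℝ) (l : ℂ) (d : DAlg q a) (c : OqSU2 q) :
    ∃ e : OqSU2 q, regRep q a d (c * (casA q a a - algebraMap ℂ _ l)) =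
      e * (casA q a a - algebraMap ℂ _ l) := by
  set z := casA q a a - algebraMap ℂ (OqSU2 q) l with hz
  have hone : incI q a (projI q a 0) • toReg q a 1 = toReg q a 1 := by
    rw [smul_toReg, regRep_incI]
    exact congrArg _ (actL_weightProj_zero_one q a)
  have hcas := weight_casB_smul hone
  simp only [Int.cast_zero, add_zero] at hcas
  have hcas1 : incB q a (casB q a a) • toReg q a 1 = toReg q a (casA q a a) := by
    rw [smul_toReg, regRep_incB, mul_one]
    rfl
  -- Both 1 and A_a have weight [a] in the regular representation, so `y` multiplies each of them,
  -- and hence z, by the same scalar.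
  have hzw : ∀ y ∈ Ic q a, actL q y z = y (wtVec q a 0) • z := by
    intro y hy
    have h1 := incI_smul_of_weight hone ⟨y, hy⟩
    have h2 := incI_smul_of_weight hcas ⟨y, hy⟩
    rw [hcas1] at h2
    rw [smul_toReg, regRep_incI, ← map_smul, (toReg q a).injective.eq_iff] at h1 h2
    rw [hz, Algebra.algebraMap_eq_smul_one, map_sub, map_smul]
    simp only at h1 h2
    rw [h1, h2, smul_sub, smul_comm]
  have h := dalg_smul_mem (q := q) (a := a) (M := RegMod q a)
    ((LinearMap.range (LinearMap.mulRight ℂ z)).map (toReg q a).toLinearMap)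
    (by
      rintro b _ ⟨_, ⟨c, rfl⟩, rfl⟩
      refine ⟨b * (c * z), ⟨b * c, ?_⟩, ?_⟩
      · simp [mul_assoc]
      · exact congrArg (toReg q a) (regRep_incB q a b (c * z)).symm)
    (by
      rintro x _ ⟨_, ⟨c, rfl⟩, rfl⟩
      refine ⟨actL q (x : Dual q) (c * z), ?_, congrArg (toReg q a) (regRep_incI q a x _).symm⟩
      rw [actL_eq, map_mul, SetLike.mem_coe]
      generalize comulA q c = Z
      induction Z using TensorProduct.induction_on with
      | zero => rw [zero_mul, map_zero, map_zero]; exact zero_mem _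
      | add x y hx hy => rw [add_mul, map_add, map_add]; exact add_mem hx hy
      | tmul c d =>
        rw [actL_tmul_mul, hzw _ (transl_mem_Ic q a x.2 d)]
        exact ⟨(transl (x : Dual q) d (wtVec q a 0) : ℂ) • c, by
          rw [LinearMap.mulRight_apply, smul_mul_assoc, mul_smul_comm]⟩)
    d (w := toReg q a (c * z)) ⟨c * z, ⟨c, rfl⟩, rfl⟩
  obtain ⟨_, ⟨e, rfl⟩, he⟩ := h
  exact ⟨e, ((toReg q a).injective he).symm⟩

/-- The characters k and ε agree on every A_b but not on the ladder elements, by `kHom_ladA` and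
`counitA_ladA`. This gap is what prevents the splitting. -/
theorem kHom_casA (q : Set.Ioo (0 : ℝ) 1) (a b : ℝ) :
    kHom q (casA q a b) = qc q + (qc q)⁻¹ := by
  have hq := qc_ne_zero q
  simp only [casA, podX, podXs, podY, map_add, map_sub, map_smul, map_mul, kHom_gen, kGen,
    smul_eq_mul]
  field_simp
  ring

theorem kHom_ladA (q : Set.Ioo (0 : ℝ) 1) (a : ℝ) (s : ℂ) :
    kHom q (ladA q a s) = qc q ^ 2 * s - (qc q ^ 2 * s)⁻¹ - dbr q a := by
  simp only [ladA, podX, podXs, podY, map_add, map_sub, map_smul, map_mul, kHom_gen, kGen,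
    smul_eq_mul, map_one, mul_inv]
  ring

/-- The character `k` detects vectors of `M_{q+q⁻¹, a}`. -/
theorem kHom_eq_zero_of_smul_eVec (q : Set.Ioo (0 : ℝ) 1) (a : ℝ) (b : podles q a)
    (h : incB q a b • eVec q a (qc q + (qc q)⁻¹) 0 = 0) : kHom q b = 0 := by
  have hmem : incB q a b ∈ relIdeal q a (qc q + (qc q)⁻¹) 0 := by
    rw [eVec, ← Submodule.Quotient.mk_smul, smul_eq_mul, mul_one] at h
    exact (Submodule.Quotient.mk_eq_zero _).1 h
  have key : ∀ d ∈ relIdeal q a (qc q + (qc q)⁻¹) 0, ∃ e : OqSU2 q,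
      regRep q a d 1 = e * (casA q a a - algebraMap ℂ _ (qc q + (qc q)⁻¹)) := by
    intro d hd
    rw [relIdeal] at hd
    induction hd using Submodule.span_induction with
    | mem d hd =>
      simp only [Set.mem_insert_iff, Set.mem_singleton_iff] at hd
      rcases hd with rfl | rfl
      · refine ⟨0, ?_⟩
        rw [map_sub, map_one (regRep q a), LinearMap.sub_apply, regRep_incI, Module.End.one_apply]
        change actL q (weightProj q a 0) 1 - 1 = _
        rw [actL_weightProj_zero_one, sub_self, zero_mul]
      · refine ⟨1, ?_⟩
        rw [map_sub, AlgHom.commutes, LinearMap.sub_apply, regRep_incB, mul_one, one_mul]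
        simp [casB, Algebra.algebraMap_eq_smul_one]
    | zero => exact ⟨0, by simp⟩
    | add x y _ _ hx hy =>
      obtain ⟨e, he⟩ := hx
      obtain ⟨f, hf⟩ := hy
      exact ⟨e + f, by rw [map_add, LinearMap.add_apply, he, hf, add_mul]⟩
    | smul r x _ hx =>
      obtain ⟨e, he⟩ := hx
      rw [smul_eq_mul, map_mul, Module.End.mul_apply, he]
      exact smul_mul_casA_sub q a _ r e
  obtain ⟨e, he⟩ := key _ hmem
  rw [regRep_incB, mul_one] at he
  rw [he, map_mul, map_sub, kHom_casA, AlgHom.commutes]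
  simp

/-! ### Ladders of weight vectors -/

/-- Inverting a linear system whose determinants do not vanish shows that, on a ladder vector, X,
X*, Y only produce that vector and its two neighbours. -/
theorem generators_mem_ladder_span (q : Set.Ioo (0 : ℝ) 1) (a : ℝ) (n : ℤ) :
    xB q a ∈ Submodule.span ℂ {1, casB q a (a + n), ladB q a (par q a true n),
      ladB q a (par q a false n)} ∧
    xsB q a ∈ Submodule.span ℂ {1, casB q a (a + n), ladB q a (par q a true n),
      ladB q a (par q a false n)} ∧
    yB q a ∈ Submodule.span ℂ {1, casB q a (a + n), ladB q a (par q a true n),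
      ladB q a (par q a false n)} := by
  set S := Submodule.span ℂ {1, casB q a (a + n), ladB q a (par q a true n),
      ladB q a (par q a false n)}
  have m1 : 1 ∈ S := Submodule.subset_span (by simp)
  have m2 : casB q a (a + n) ∈ S := Submodule.subset_span (by simp)
  have m3 : ladB q a (par q a true n) ∈ S := Submodule.subset_span (by simp)
  have m4 : ladB q a (par q a false n) ∈ S := Submodule.subset_span (by simp)
  set s := sig q a n with hs
  have p1 : par q a true n = s := rfl
  have p2 : par q a false n = -s⁻¹ := rfl
  rw [p1] at m3
  rw [p2] at m4
  have hq := qc_ne_zero q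
  have hs0 : s ≠ 0 := sig_ne_zero q a n
  have hs1 : s + s⁻¹ ≠ 0 := sig_add_inv_ne_zero q a n
  have hI := Complex.I_sq
  -- The expression factors as (qs + (qs)⁻¹)(q⁻¹s + (q⁻¹s)⁻¹), whose factors are values of σ + σ⁻¹
  -- at the neighbouring weights.
  have hdet : (s - s⁻¹) ^ 2 + (qc q + (qc q)⁻¹) ^ 2 ≠ 0 := by
    have h2 := sig_add_inv_ne_zero q a (n + 1)
    have h3 := sig_add_inv_ne_zero q a (n + (-1))
    rw [sig_add, zpow_one, ← hs] at h2
    rw [sig_add, zpow_neg, zpow_one, ← hs] at h3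
    have h4 := mul_ne_zero h2 h3
    convert h4 using 1
    field_simp
    ring
  have hD : xB q a - xsB q a ∈ S := by
    refine (Submodule.smul_mem_iff S hs1).1 ?_
    convert sub_mem m3 m4 using 1
    rw [ladB_eq, ladB_eq, inv_neg, inv_inv]
    module
  have hXs : xsB q a ∈ S := by
    refine (Submodule.smul_mem_iff S hdet).1 ?_
    convert sub_mem (add_mem (add_mem (S.smul_mem (s - s⁻¹) m3)
      (S.smul_mem (qc q + (qc q)⁻¹) m2)) (S.smul_mem ((s - s⁻¹) * dbr q a) m1))
      (S.smul_mem (s * (s - s⁻¹) + (qc q + (qc q)⁻¹) * (qc q)⁻¹) hD) using 1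
    rw [ladB_eq, casB_eq, dbr_add_intCast, ← hs]
    match_scalars <;> field_simp <;> ring
  have hX : xB q a ∈ S := by simpa using add_mem hD hXs
  refine ⟨hX, hXs, ?_⟩
  have hk : Complex.I * (qc q + (qc q)⁻¹) ≠ 0 := by
    have h0 : ((q : ℝ) + (q : ℝ)⁻¹) ≠ 0 := by
      have := q.2.1
      positivity
    refine mul_ne_zero Complex.I_ne_zero ?_
    simp only [qc]
    exact_mod_cast h0
  refine (Submodule.smul_mem_iff S hk).1 ?_
  convert sub_mem (sub_mem (sub_mem (S.smul_mem s hX) (S.smul_mem s⁻¹ hXs))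
    (S.smul_mem (dbr q a) m1)) m3 using 1
  rw [ladB_eq]
  module

theorem incB_mul (q : Set.Ioo (0 : ℝ) 1) (a : ℝ) (b c : podles q a) :
    incB q a (b * c) = incB q a b * incB q a c := map_mul (incBHom q a) b c

/-- The product of `k` successive raising (or lowering) elements, starting at the weight
`[a + n]`. -/
def ladProd (q : Set.Ioo (0 : ℝ) 1) (a : ℝ) (u : Bool) (n : ℤ) : ℕ → podles q a
  | 0 => 1
  | k + 1 => ladB q a (par q a u (n + 2 * dir u * k)) * ladProd q a u n k

theorem ladProd_zero_smul {q : Set.Ioo (0 : ℝ) 1} {a : ℝ} {M : Type} [AddCommGroup M]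
    [Module (DAlg q a) M] (u : Bool) (n : ℤ) (v : M) : incB q a (ladProd q a u n 0) • v = v := by
  rw [ladProd, ← incBHom_apply, map_one, one_smul]

theorem ladProd_succ_smul {q : Set.Ioo (0 : ℝ) 1} {a : ℝ} {M : Type} [AddCommGroup M]
    [Module (DAlg q a) M] (u : Bool) (n : ℤ) (k : ℕ) (v : M) :
    incB q a (ladProd q a u n (k + 1)) • v =
      incB q a (ladB q a (par q a u (n + 2 * dir u * k))) • incB q a (ladProd q a u n k) • v := by
  rw [ladProd, incB_mul, mul_smul]

section Module

variable {q : Set.Ioo (0 : ℝ) 1} {a : ℝ} {M : Type} [AddCommGroup M] [Module ℂ M]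
  [Module (DAlg q a) M] [IsScalarTower ℂ (DAlg q a) M]

/-- A vector of weight `[a + n]` on which `A_{a+n}` acts as `q + q⁻¹`. -/
structure IsLadder (q : Set.Ioo (0 : ℝ) 1) (a : ℝ) {M : Type} [AddCommGroup M] [Module ℂ M]
    [Module (DAlg q a) M] (n : ℤ) (v : M) : Prop where
  weight : incI q a (projI q a n) • v = v
  cas : incB q a (casB q a (a + n)) • v = (qc q + (qc q)⁻¹) • v

theorem par_mul_sub_inv (q : Set.Ioo (0 : ℝ) 1) (a : ℝ) (u : Bool) (n : ℤ) :
    qc q ^ 2 * par q a u n - (qc q ^ 2 * par q a u n)⁻¹ =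
      dbr q (a + ((n + 2 * dir u : ℤ) : ℝ)) := by
  have h := par_add q a u n 2
  rw [mul_comm] at h
  rw [← par_sub_inv q a u, h]
  rfl

theorem IsLadder.step {n : ℤ} {v : M} (hv : IsLadder q a n v) (u : Bool) :
    IsLadder q a (n + 2 * dir u) (incB q a (ladB q a (par q a u n)) • v) where
  weight := weight_ladB_smul hv.weight u
  cas := by
    have h : casB q a (a + ((n + 2 * dir u : ℤ) : ℝ)) * ladB q a (par q a u n) =
        ladB q a (par q a u n) * casB q a (a + n) :=
      Subtype.ext (casA_mul_ladA q a (par_ne_zero q a u n) (par_sub_inv q a u n)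
        (par_mul_sub_inv q a u n))
    rw [← mul_smul, ← incB_mul, h, incB_mul, mul_smul, hv.cas, smul_algebra_smul_comm]

/-- The value λ = q + q⁻¹ makes the scalar of `ladA_mul_ladA` factor. The scalar vanishes exactly
when one end of the step has weight [a]. -/
theorem IsLadder.step_back {n : ℤ} {v : M} (hv : IsLadder q a n v) (u : Bool) :
    incB q a (ladB q a (par q a (!u) (n + 2 * dir u))) •
      incB q a (ladB q a (par q a u n)) • v =
      ((dbr q (a + ((n + 2 * dir u : ℤ) : ℝ)) - dbr q a) * (dbr q (a + n) - dbr q a)) • v := by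
  have hp : par q a (!u) (n + 2 * dir u) = -(qc q ^ 2 * par q a u n)⁻¹ := by
    have h := par_add q a u n 2
    rw [mul_comm] at h
    rw [par_not, h]
    rfl
  have hs := par_ne_zero q a u n
  have hq := qc_ne_zero q
  have h : ladB q a (par q a (!u) (n + 2 * dir u)) * ladB q a (par q a u n) =
      ((qc q * par q a u n) ^ 2 + ((qc q * par q a u n) ^ 2)⁻¹ + 2 + dbr q a ^ 2) • 1
        - casB q a (a + n) * casB q a (a + n)
        - (dbr q a * (qc q * par q a u n - (qc q * par q a u n)⁻¹)) • casB q a (a + n) := by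
    rw [hp]
    exact Subtype.ext (ladA_mul_ladA q a hs (par_sub_inv q a u n))
  rw [← mul_smul, ← incB_mul, h, ← incBHom_apply, map_sub, map_sub, map_smul, map_smul, map_mul,
    map_one, incBHom_apply, sub_smul, sub_smul, smul_assoc, smul_assoc, mul_smul, one_smul, hv.cas,
    smul_algebra_smul_comm, hv.cas, ← par_mul_sub_inv, ← par_sub_inv q a u]
  generalize par q a u n = s at *
  match_scalars
  field_simp
  ring

/-- A subspace spanned by ladder vectors is a submodule if it is stable under the raising and
lowering elements. -/
theorem span_ladder_stable {ι : Type} (n : ι → ℤ) (w : ι → M) (hw : ∀ i, IsLadder q a (n i) (w i))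
    (hs : ∀ i u, incB q a (ladB q a (par q a u (n i))) • w i ∈ Submodule.span ℂ (Set.range w))
    (d : DAlg q a) {v : M} (hv : v ∈ Submodule.span ℂ (Set.range w)) :
    d • v ∈ Submodule.span ℂ (Set.range w) := by
  set W := Submodule.span ℂ (Set.range w) with hW
  have hmem : ∀ i, w i ∈ W := fun i => Submodule.subset_span ⟨i, rfl⟩
  have ext : ∀ d : DAlg q a, (∀ i, d • w i ∈ W) → ∀ v ∈ W, d • v ∈ W := by
    intro d hd v hv
    induction hv using Submodule.span_induction with
    | mem v hv => obtain ⟨i, rfl⟩ := hv; exact hd i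
    | zero => rw [smul_zero]; exact zero_mem _
    | add x y _ _ hx hy => rw [smul_add]; exact add_mem hx hy
    | smul r x _ hx => rw [smul_algebra_smul_comm]; exact W.smul_mem r hx
  have four : ∀ i, ∀ b ∈ Submodule.span ℂ {1, casB q a (a + n i), ladB q a (par q a true (n i)),
      ladB q a (par q a false (n i))}, incB q a b • w i ∈ W := by
    intro i b hb
    rw [← incBHom_apply]
    induction hb using Submodule.span_induction with
    | mem b hb =>
      rcases hb with rfl | rfl | rfl | rfl
      · rw [map_one, one_smul]; exact hmem i
      · rw [incBHom_apply, (hw i).cas]; exact W.smul_mem _ (hmem i)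
      · exact hs i true
      · exact hs i false
    | zero => rw [map_zero, zero_smul]; exact zero_mem _
    | add x y _ _ hx hy => rw [map_add, add_smul]; exact add_mem hx hy
    | smul r x _ hx => rw [map_smul, smul_assoc]; exact W.smul_mem r hx
  refine dalg_smul_mem W ?_ ?_ d hv
  · rintro ⟨b, hb⟩
    -- Arbitrary elements of the Podleś sphere reduce to X, X*, Y, whose action on ladder vectors is
    -- controlled by `four`.
    have hb' : b ∈ podGen q a := podles_eq_podGen q a ▸ hb
    rw [← incBHom_apply]
    induction hb' using Algebra.adjoin_induction with
    | mem c hc =>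
      rw [incBHom_apply]
      rcases hc with rfl | rfl | rfl
      · exact ext _ fun i => four i _ (generators_mem_ladder_span q a (n i)).1
      · exact ext _ fun i => four i _ (generators_mem_ladder_span q a (n i)).2.1
      · exact ext _ fun i => four i _ (generators_mem_ladder_span q a (n i)).2.2
    | algebraMap r =>
      intro v hv
      have : incBHom q a ⟨algebraMap ℂ _ r, hb⟩ = algebraMap ℂ _ r := (incBHom q a).commutes r
      rw [this, algebraMap_smul]
      exact W.smul_mem r hv
    | add x y hx hy ihx ihy =>
      intro v hv
      have hx' := podGen_le_podles q a hx
      have hy' := podGen_le_podles q a hy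
      have : incBHom q a ⟨x + y, hb⟩ = incBHom q a ⟨x, hx'⟩ + incBHom q a ⟨y, hy'⟩ :=
        map_add (incBHom q a) ⟨x, hx'⟩ ⟨y, hy'⟩
      rw [this, add_smul]
      exact add_mem (ihx hx' v hv) (ihy hy' v hv)
    | mul x y hx hy ihx ihy =>
      intro v hv
      have hx' := podGen_le_podles q a hx
      have hy' := podGen_le_podles q a hy
      have : incBHom q a ⟨x * y, hb⟩ = incBHom q a ⟨x, hx'⟩ * incBHom q a ⟨y, hy'⟩ :=
        map_mul (incBHom q a) ⟨x, hx'⟩ ⟨y, hy'⟩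
      rw [this, mul_smul]
      exact ihx hx' _ (ihy hy' v hv)
  · intro x
    refine ext _ fun i => ?_
    rw [incI_smul_of_weight (hw i).weight]
    exact W.smul_mem _ (hmem i)

/-- Applying Φ to a linear relation isolates the term of that weight. -/
theorem linearIndependent_of_weight {ι : Type} (n : ι → ℤ) (hn : Function.Injective n) (w : ι → M)
    (hw : ∀ i, incI q a (projI q a (n i)) • w i = w i) (h0 : ∀ i, w i ≠ 0) :
    LinearIndependent ℂ w := by
  rw [linearIndependent_iff']
  intro s g hg i hi
  have h := congrArg (fun v => incI q a (projI q a (n i)) • v) hg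
  simp only [Finset.smul_sum, smul_zero] at h
  rw [Finset.sum_eq_single i] at h
  · rw [smul_algebra_smul_comm, hw] at h
    exact (smul_eq_zero.1 h).resolve_right (h0 i)
  · intro j _ hj
    rw [smul_algebra_smul_comm, ← hw j, ← mul_smul, incI_projI_mul,
      if_neg (fun h => hj (hn h).symm), zero_smul, smul_zero]
  · exact fun h => absurd hi h

theorem IsLadder.ladProd_smul {n : ℤ} {v : M} (hv : IsLadder q a n v) (u : Bool) (k : ℕ) :
    IsLadder q a (n + 2 * dir u * k) (incB q a (ladProd q a u n k) • v) := by
  induction k with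
  | zero =>
    rw [ladProd_zero_smul]
    simpa using hv
  | succ k ih =>
    rw [ladProd_succ_smul]
    convert ih.step u using 1
    push_cast
    ring

theorem IsLadder.ladProd_back {n : ℤ} {v : M} (hv : IsLadder q a n v) (u : Bool) (k : ℕ) :
    incB q a (ladB q a (par q a (!u) (n + 2 * dir u * (k + 1 : ℕ)))) •
      incB q a (ladProd q a u n (k + 1)) • v =
      ((dbr q (a + ((n + 2 * dir u * (k + 1 : ℕ) : ℤ) : ℝ)) - dbr q a) *
        (dbr q (a + ((n + 2 * dir u * k : ℤ) : ℝ)) - dbr q a)) •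
        incB q a (ladProd q a u n k) • v := by
  have h := (hv.ladProd_smul u k).step_back u
  have e : n + 2 * dir u * k + 2 * dir u = n + 2 * dir u * (k + 1 : ℕ) := by push_cast; ring
  rw [e] at h
  rw [ladProd_succ_smul, h]

end Module

/-! ### The structure of the modules `M_{q+q⁻¹, b}` and of their irreducible quotients -/

/-- The module `M_{q+q⁻¹, a+m}`. -/
abbrev CMod (q : Set.Ioo (0 : ℝ) 1) (a : ℝ) (m : ℤ) : Type := MMod q a (qc q + (qc q)⁻¹) m

/-- The generating vector of `M_{q+q⁻¹, a+m}`. -/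
abbrev cVec (q : Set.Ioo (0 : ℝ) 1) (a : ℝ) (m : ℤ) : CMod q a m := eVec q a (qc q + (qc q)⁻¹) m

theorem isLadder_cVec (q : Set.Ioo (0 : ℝ) 1) (a : ℝ) (m : ℤ) : IsLadder q a m (cVec q a m) where
  weight := projI_eVec q a _ m
  cas := by
    rw [← sub_eq_zero, ← algebraMap_smul (DAlg q a) (qc q + (qc q)⁻¹) (cVec q a m), ← sub_smul,
      cVec, eVec, ← Submodule.Quotient.mk_smul, Submodule.Quotient.mk_eq_zero, smul_eq_mul, mul_one]
    exact Submodule.subset_span (by simp)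

theorem dbr_sub_ne_zero (q : Set.Ioo (0 : ℝ) 1) (a : ℝ) {n : ℤ} (hn : n ≠ 0) :
    dbr q (a + n) - dbr q a ≠ 0 := by
  intro h
  have h1 := dbr_injective q (sub_eq_zero.1 h)
  simp [hn] at h1

theorem dir_mul_ne_zero (u : Bool) {k : ℤ} (hk : k ≠ 0) : 2 * dir u * k ≠ 0 := by
  cases u <;> simp [dir, hk]

theorem dir_mul_injective (u : Bool) (n : ℤ) : Function.Injective fun k : ℕ => n + 2 * dir u * k := by
  intro k l h
  cases u <;> simp [dir] at h <;> omega

theorem kHom_ladProd_ne_zero (q : Set.Ioo (0 : ℝ) 1) (a : ℝ) (u : Bool) (k : ℕ) :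
    kHom q (ladProd q a u 0 k) ≠ 0 := by
  induction k with
  | zero => simp [ladProd]
  | succ k ih =>
    have h : ((ladProd q a u 0 (k + 1) : podles q a) : OqSU2 q) =
      ladA q a (par q a u (0 + 2 * dir u * k)) * ladProd q a u 0 k := rfl
    rw [h, map_mul, kHom_ladA, par_mul_sub_inv]
    refine mul_ne_zero (dbr_sub_ne_zero q a ?_) ih
    have := dir_mul_ne_zero u (k := k + 1) (by omega)
    rwa [mul_add, mul_one, ← zero_add (2 * dir u * (k : ℤ))] at this

theorem ladProd_smul_cVec_ne_zero (q : Set.Ioo (0 : ℝ) 1) (a : ℝ) (u : Bool) (k : ℕ) :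
    incB q a (ladProd q a u 0 k) • cVec q a 0 ≠ 0 :=
  fun h => kHom_ladProd_ne_zero q a u k (kHom_eq_zero_of_smul_eVec q a _ h)

theorem weight_ne {q : Set.Ioo (0 : ℝ) 1} {a : ℝ} {M : Type} [AddCommGroup M]
    [Module (DAlg q a) M] {n m : ℤ} (hnm : n ≠ m) {v : M} (hv : incI q a (projI q a n) • v = v) :
    incI q a (projI q a m) • v = 0 := by
  rw [← hv, ← mul_smul, incI_projI_mul, if_neg hnm.symm, zero_smul]

section Module

variable {q : Set.Ioo (0 : ℝ) 1} {a : ℝ} {M : Type} [AddCommGroup M] [Module ℂ M]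
  [Module (DAlg q a) M] [IsScalarTower ℂ (DAlg q a) M]

/-- By universality there is a module map taking the generator to `v`. -/
theorem IsLadder.eq_zero_of_cVec {m : ℤ} {v : M} (hv : IsLadder q a m v) (h : cVec q a m = 0) :
    v = 0 := by
  have h1 : (1 : DAlg q a) ∈ relIdeal q a (qc q + (qc q)⁻¹) m := by
    rwa [cVec, eVec, Submodule.Quotient.mk_eq_zero] at h
  have h2 : relIdeal q a (qc q + (qc q)⁻¹) m ≤
      LinearMap.ker (LinearMap.toSpanSingleton (DAlg q a) M v) := by
    rw [relIdeal, Submodule.span_le]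
    intro d hd
    rw [SetLike.mem_coe, LinearMap.mem_ker, LinearMap.toSpanSingleton_apply]
    rcases hd with rfl | rfl
    · rw [sub_smul, hv.weight, one_smul, sub_self]
    · rw [sub_smul, hv.cas, algebraMap_smul, sub_self]
  simpa using h2 h1

/-- The ladders through a generating ladder vector span the module. -/
theorem IsLadder.span_eq_top {n : ℤ} {v : M} (hv : IsLadder q a n v)
    (hgen : ∀ w : M, ∃ d : DAlg q a, w = d • v) :
    Submodule.span ℂ (Set.range fun p : Bool × ℕ => incB q a (ladProd q a p.1 n p.2) • v) = ⊤ := by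
  set W := Submodule.span ℂ (Set.range fun p : Bool × ℕ => incB q a (ladProd q a p.1 n p.2) • v)
  have hmem : ∀ u k, incB q a (ladProd q a u n k) • v ∈ W :=
    fun u k => Submodule.subset_span ⟨(u, k), rfl⟩
  have hstable := span_ladder_stable (q := q) (a := a)
    (fun p : Bool × ℕ => n + 2 * dir p.1 * p.2)
    (fun p : Bool × ℕ => incB q a (ladProd q a p.1 n p.2) • v)
    (fun p => hv.ladProd_smul p.1 p.2) (by
      rintro ⟨u, k⟩ u'
      rcases eq_or_ne u' u with rfl | hu
      · have := hmem u' (k + 1)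
        rwa [ladProd_succ_smul] at this
      · obtain rfl : u' = !u := by cases u <;> cases u' <;> simp_all
        cases k with
        | zero =>
          have := hmem (!u) 1
          rw [ladProd_succ_smul, ladProd_zero_smul] at this
          simpa [ladProd_zero_smul] using this
        | succ k =>
          have h := hv.ladProd_back u k
          simp only at h ⊢
          rw [h]
          exact W.smul_mem _ (hmem u k))
  rw [eq_top_iff]
  intro w _
  obtain ⟨d, rfl⟩ := hgen w
  refine hstable d ?_
  have := hmem true 0
  rwa [ladProd_zero_smul] at this

/-- The weight space of a generating ladder vector is one-dimensional. -/
theorem IsLadder.weight_mem_span {n : ℤ} {v : M} (hv : IsLadder q a n v)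
    (hgen : ∀ w : M, ∃ d : DAlg q a, w = d • v) (w : M) :
    ∃ c : ℂ, incI q a (projI q a n) • w = c • v := by
  have hw : w ∈ Submodule.span ℂ
    (Set.range fun p : Bool × ℕ => incB q a (ladProd q a p.1 n p.2) • v) :=
    hv.span_eq_top hgen ▸ Submodule.mem_top
  induction hw using Submodule.span_induction with
  | mem w hw =>
    obtain ⟨⟨u, k⟩, rfl⟩ := hw
    cases k with
    | zero => exact ⟨1, by simp only [ladProd_zero_smul, hv.weight, one_smul]⟩
    | succ k =>
      refine ⟨0, ?_⟩
      rw [zero_smul]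
      refine weight_ne (n := n + 2 * dir u * (k + 1 : ℕ)) ?_ (hv.ladProd_smul u (k + 1)).weight
      have := dir_mul_ne_zero u (k := (k + 1 : ℕ)) (by omega)
      omega
  | zero => exact ⟨0, by simp⟩
  | add x y _ _ hx hy =>
    obtain ⟨c, hc⟩ := hx
    obtain ⟨d, hd⟩ := hy
    exact ⟨c + d, by rw [smul_add, hc, hd, add_smul]⟩
  | smul r x _ hx =>
    obtain ⟨c, hc⟩ := hx
    exact ⟨r * c, by rw [smul_algebra_smul_comm, hc, smul_smul]⟩

/-! ### Comparison of `Ic`-representations through weight bases -/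

theorem exists_weight_basis {ι : Type} (n : ι → ℤ) (hn : Function.Injective n) (w : ι → M)
    (hw : ∀ i, incI q a (projI q a (n i)) • w i = w i) (h0 : ∀ i, w i ≠ 0)
    (hspan : ⊤ ≤ Submodule.span ℂ (Set.range w)) :
    ∃ b : Module.Basis ι ℂ M, ∀ i (x : Ic q a),
      incI q a x • b i = (x : Dual q) (wtVec q a (n i)) • b i := by
  refine ⟨Module.Basis.mk (linearIndependent_of_weight n hn w hw h0) hspan, fun i x => ?_⟩
  rw [Module.Basis.mk_apply, incI_smul_of_weight (hw i)]

end Module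

theorem exists_intertwiner {q : Set.Ioo (0 : ℝ) 1} {a : ℝ} {M N P Q : Type}
    [AddCommGroup M] [Module ℂ M] [Module (DAlg q a) M] [IsScalarTower ℂ (DAlg q a) M]
    [AddCommGroup N] [Module ℂ N] [Module (DAlg q a) N] [IsScalarTower ℂ (DAlg q a) N]
    [AddCommGroup P] [Module ℂ P] [Module (DAlg q a) P] [IsScalarTower ℂ (DAlg q a) P]
    [AddCommGroup Q] [Module ℂ Q] [Module (DAlg q a) Q] [IsScalarTower ℂ (DAlg q a) Q]
    {ι κ τ : Type} (n : (ι ⊕ κ) ⊕ τ → ℤ) (b : Module.Basis ((ι ⊕ κ) ⊕ τ) ℂ M)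
    (bN : Module.Basis ι ℂ N) (bP : Module.Basis κ ℂ P) (bQ : Module.Basis τ ℂ Q)
    (hb : ∀ i (x : Ic q a), incI q a x • b i = (x : Dual q) (wtVec q a (n i)) • b i)
    (hN : ∀ i (x : Ic q a), incI q a x • bN i =
      (x : Dual q) (wtVec q a (n (.inl (.inl i)))) • bN i)
    (hP : ∀ i (x : Ic q a), incI q a x • bP i =
      (x : Dual q) (wtVec q a (n (.inl (.inr i)))) • bP i)
    (hQ : ∀ i (x : Ic q a), incI q a x • bQ i = (x : Dual q) (wtVec q a (n (.inr i))) • bQ i) :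
    ∃ F : M ≃ₗ[ℂ] (N × P) × Q, ∀ (x : Ic q a) (v : M), F (incI q a x • v) =
      ((incI q a x • (F v).1.1, incI q a x • (F v).1.2), incI q a x • (F v).2) := by
  let F : M ≃ₗ[ℂ] (N × P) × Q := b.equiv ((bN.prod bP).prod bQ) (Equiv.refl _)
  refine ⟨F, fun x v => ?_⟩
  have h : F.toLinearMap ∘ₗ Algebra.lsmul ℂ ℂ M (incI q a x) =
      (LinearMap.prodMap (LinearMap.prodMap (Algebra.lsmul ℂ ℂ N (incI q a x))
        (Algebra.lsmul ℂ ℂ P (incI q a x))) (Algebra.lsmul ℂ ℂ Q (incI q a x))) ∘ₗ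
          F.toLinearMap := by
    refine b.ext fun i => ?_
    have hF : F (b i) = ((bN.prod bP).prod bQ) i := by
      simp only [F, Module.Basis.equiv_apply, Equiv.refl_apply]
    simp only [LinearMap.comp_apply, LinearEquiv.coe_coe, hF, Algebra.lsmul_coe, hb, map_smul]
    rcases i with ((i | i) | i)
    · simp [hN]
    · simp [hP]
    · simp [hQ, Prod.zero_eq_mk]
  exact congrArg (fun g => g v) h

/-- The weights of `M_{q+q⁻¹, a}`. -/
def critWt : (ℕ ⊕ ℕ) ⊕ Unit → ℤ
  | .inl (.inl k) => 2 * dir true + 2 * dir true * k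
  | .inl (.inr k) => 2 * dir false + 2 * dir false * k
  | .inr _ => 0

theorem critWt_injective : Function.Injective critWt := by
  rintro ((k | k) | k) ((l | l) | l) h <;> simp [critWt, dir] at h ⊢ <;> omega

theorem exists_basis_crit (q : Set.Ioo (0 : ℝ) 1) (a : ℝ) :
    ∃ b : Module.Basis ((ℕ ⊕ ℕ) ⊕ Unit) ℂ (CMod q a 0), ∀ i (x : Ic q a),
      incI q a x • b i = (x : Dual q) (wtVec q a (critWt i)) • b i := by
  -- The exponent k + 1 starts each branch at weight [a±2], where the discrete series begin; e_a
  -- itself is the `Unit` entry, written as an empty product so that one non-vanishing lemma covers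
  -- all cases.
  let w : (ℕ ⊕ ℕ) ⊕ Unit → CMod q a 0
    | .inl (.inl k) => incB q a (ladProd q a true 0 (k + 1)) • cVec q a 0
    | .inl (.inr k) => incB q a (ladProd q a false 0 (k + 1)) • cVec q a 0
    | .inr _ => incB q a (ladProd q a true 0 0) • cVec q a 0
  have hl := isLadder_cVec q a 0
  refine exists_weight_basis critWt critWt_injective w ?_ ?_ ?_
  · rintro ((k | k) | k)
    · convert (hl.ladProd_smul true (k + 1)).weight using 4
      simp only [critWt, dir]; push_cast; ring
    · convert (hl.ladProd_smul false (k + 1)).weight using 4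
      simp only [critWt, dir]; push_cast; ring
    · convert (hl.ladProd_smul true 0).weight using 3
      simp [critWt]
  · rintro ((k | k) | k) <;> exact ladProd_smul_cVec_ne_zero q a _ _
  · rw [← hl.span_eq_top (eVec_cyclic q a _ 0), Submodule.span_le]
    rintro _ ⟨⟨u, k⟩, rfl⟩
    apply Submodule.subset_span
    cases k with
    | zero => exact ⟨.inr (), by simp only [w, ladProd_zero_smul]⟩
    | succ k =>
      cases u
      · exact ⟨.inl (.inr k), rfl⟩
      · exact ⟨.inl (.inl k), rfl⟩

/-! ### The irreducible quotients L_{q+q⁻¹,a±2} -/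

/-- The irreducible quotient of `M_{q+q⁻¹, a+m}`. -/
abbrev LMod (q : Set.Ioo (0 : ℝ) 1) (a : ℝ) (m : ℤ) : Type :=
  CMod q a m ⧸ maxSub q a (qc q + (qc q)⁻¹) m

/-- M_{q+q⁻¹,a} contains a nonzero ladder vector of this weight, namely the first step from e_a. -/
theorem cVec_two_ne_zero (q : Set.Ioo (0 : ℝ) 1) (a : ℝ) (u : Bool) : cVec q a (2 * dir u) ≠ 0 := by
  intro h
  have hl := (isLadder_cVec q a 0).ladProd_smul u 1
  have e : (0 : ℤ) + 2 * dir u * (1 : ℕ) = 2 * dir u := by simp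
  rw [e] at hl
  exact ladProd_smul_cVec_ne_zero q a u 1 (hl.eq_zero_of_cVec h)

/-- The weight space of the generator is a line, so a proper submodule meets it trivially. All
proper submodules then lie in the single submodule `K`, which omits the generator. -/
theorem cVec_notMem_maxSub (q : Set.Ioo (0 : ℝ) 1) (a : ℝ) {m : ℤ} (h0 : cVec q a m ≠ 0) :
    cVec q a m ∉ maxSub q a (qc q + (qc q)⁻¹) m := by
  have hl := isLadder_cVec q a m
  let K : Submodule (DAlg q a) (CMod q a m) :=
    { carrier := {w | ∀ d : DAlg q a, incI q a (projI q a m) • d • w = 0}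
      add_mem' := fun {v w} hv hw d => by rw [smul_add, smul_add, hv, hw, add_zero]
      zero_mem' := fun d => by rw [smul_zero, smul_zero]
      smul_mem' := fun c w hw d => by rw [← mul_smul d]; exact hw _ }
  have hK : maxSub q a (qc q + (qc q)⁻¹) m ≤ K := by
    refine sSup_le fun N hN w hw d => ?_
    obtain ⟨c, hc⟩ := hl.weight_mem_span (eVec_cyclic q a _ m) (d • w)
    by_cases h : c = 0
    · rw [hc, h, zero_smul]
    · refine absurd ?_ hN
      have h1 : cVec q a m ∈ N := by
        have h2 : c • cVec q a m ∈ N := hc ▸ N.smul_mem _ (N.smul_mem _ hw)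
        have h3 := N.smul_mem (algebraMap ℂ (DAlg q a) c⁻¹) h2
        rwa [algebraMap_smul, smul_smul, inv_mul_cancel₀ h, one_smul] at h3
      rw [eq_top_iff]
      intro x _
      obtain ⟨d, rfl⟩ := eVec_cyclic q a _ m x
      exact N.smul_mem d h1
  intro h
  have h1 := hK h 1
  rw [one_smul, hl.weight] at h1
  exact h0 h1

/-- The ladder vectors strictly on the side of weight [a] span a submodule, since the return step
from [a] to the generator has coefficient zero. It has no component in the weight of the generator,
so it is proper. -/
theorem ladB_smul_mem_maxSub (q : Set.Ioo (0 : ℝ) 1) (a : ℝ) (u : Bool) :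
    incB q a (ladB q a (par q a (!u) (2 * dir u))) • cVec q a (2 * dir u) ∈
      maxSub q a (qc q + (qc q)⁻¹) (2 * dir u) := by
  set m := 2 * dir u with hm
  have hl := isLadder_cVec q a m
  let w : ℕ → CMod q a m := fun k => incB q a (ladProd q a (!u) m (k + 1)) • cVec q a m
  set W := Submodule.span ℂ (Set.range w) with hW
  have hmem : ∀ k, w k ∈ W := fun k => Submodule.subset_span ⟨k, rfl⟩
  have hstable := span_ladder_stable (q := q) (a := a)
    (fun k : ℕ => m + 2 * dir (!u) * (k + 1 : ℕ)) w (fun k => hl.ladProd_smul (!u) (k + 1)) (by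
      intro k u'
      rcases eq_or_ne u' (!u) with rfl | hu
      · have := hmem (k + 1)
        simp only [w] at this
        rwa [ladProd_succ_smul] at this
      · obtain rfl : u' = !!u := by cases u <;> cases u' <;> simp_all
        have h := hl.ladProd_back (!u) k
        simp only [w]
        rw [h]
        cases k with
        | zero =>
          -- The first vector of this ladder has weight [a], where ⟦a⟧ - t = 0 kills the return.
          have e : m + 2 * dir (!u) * (0 + 1 : ℕ) = 0 := by rw [dir_not, hm]; push_cast; ring
          rw [e, Int.cast_zero, add_zero, sub_self, zero_mul, zero_smul]
          exact zero_mem _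
        | succ k => exact W.smul_mem _ (hmem k))
  let N : Submodule (DAlg q a) (CMod q a m) :=
    { W with smul_mem' := fun d v hv => hstable d hv }
  have hN : N ≤ maxSub q a (qc q + (qc q)⁻¹) m := by
    refine le_sSup fun htop => ?_
    have h1 : ∀ v ∈ W, incI q a (projI q a m) • v = 0 := by
      intro v hv
      induction hv using Submodule.span_induction with
      | mem v hv =>
        obtain ⟨k, rfl⟩ := hv
        refine weight_ne (n := m + 2 * dir (!u) * (k + 1 : ℕ)) ?_ (hl.ladProd_smul (!u) (k + 1)).weight
        have := dir_mul_ne_zero (!u) (k := (k + 1 : ℕ)) (by omega)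
        omega
      | zero => rw [smul_zero]
      | add x y _ _ hx hy => rw [smul_add, hx, hy, add_zero]
      | smul r x _ hx => rw [smul_algebra_smul_comm, hx, smul_zero]
    have h2 : cVec q a m ∈ N := htop ▸ Submodule.mem_top
    have h3 := h1 _ h2
    rw [hl.weight] at h3
    exact cVec_two_ne_zero q a u h3
  have h := hN (hmem 0 : w 0 ∈ N)
  simp only [w] at h
  rw [ladProd_succ_smul, ladProd_zero_smul] at h
  simpa using h

/-- In the quotient the step towards weight [a] vanishes, leaving one ladder. It never stops:
weights stay away from [a], so each return factor is nonzero and each step is injective on its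
vector. -/
theorem exists_basis_LMod (q : Set.Ioo (0 : ℝ) 1) (a : ℝ) (u : Bool) :
    ∃ b : Module.Basis ℕ ℂ (LMod q a (2 * dir u)), ∀ k (x : Ic q a),
      incI q a x • b k = (x : Dual q) (wtVec q a (2 * dir u + 2 * dir u * k)) • b k := by
  set m := 2 * dir u with hm
  let e : LMod q a m := Submodule.Quotient.mk (cVec q a m)
  have hl : IsLadder q a m e := by
    have h := isLadder_cVec q a m
    constructor
    · rw [← Submodule.Quotient.mk_smul, h.weight]
    · rw [← Submodule.Quotient.mk_smul, h.cas]
      rfl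
  have he : e ≠ 0 := by
    intro h
    exact cVec_notMem_maxSub q a (cVec_two_ne_zero q a u) ((Submodule.Quotient.mk_eq_zero _).1 h)
  have hback : incB q a (ladB q a (par q a (!u) m)) • e = 0 := by
    rw [← Submodule.Quotient.mk_smul, Submodule.Quotient.mk_eq_zero]
    exact ladB_smul_mem_maxSub q a u
  let w : ℕ → LMod q a m := fun k => incB q a (ladProd q a u m k) • e
  set W := Submodule.span ℂ (Set.range w) with hW
  have hmem : ∀ k, w k ∈ W := fun k => Submodule.subset_span ⟨k, rfl⟩
  have hstable := span_ladder_stable (q := q) (a := a)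
    (fun k : ℕ => m + 2 * dir u * k) w (fun k => hl.ladProd_smul u k) (by
      intro k u'
      rcases eq_or_ne u' u with rfl | hu
      · have := hmem (k + 1)
        simp only [w] at this
        rwa [ladProd_succ_smul] at this
      · obtain rfl : u' = !u := by cases u <;> cases u' <;> simp_all
        cases k with
        | zero =>
          simp only [w, ladProd_zero_smul, Nat.cast_zero, mul_zero, add_zero, hback]
          exact zero_mem _
        | succ k =>
          simp only [w]
          rw [hl.ladProd_back u k]
          exact W.smul_mem _ (hmem k))
  refine exists_weight_basis (fun k : ℕ => m + 2 * dir u * k) (dir_mul_injective u m) w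
    (fun k => (hl.ladProd_smul u k).weight) ?_ ?_
  · intro k
    induction k with
    | zero => simpa only [w, ladProd_zero_smul] using he
    | succ k ih =>
      intro h
      have hb := hl.ladProd_back u k
      simp only [w] at h ih
      rw [h, smul_zero] at hb
      have e1 : m + 2 * dir u * (k + 1 : ℕ) = 2 * dir u * ((k : ℤ) + 2) := by
        rw [hm]; push_cast; ring
      have e2 : m + 2 * dir u * k = 2 * dir u * ((k : ℤ) + 1) := by rw [hm]; ring
      refine ih ((smul_eq_zero.1 hb.symm).resolve_left (mul_ne_zero ?_ ?_))
      · rw [e1]; exact dbr_sub_ne_zero q a (dir_mul_ne_zero u (by omega))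
      · rw [e2]; exact dbr_sub_ne_zero q a (dir_mul_ne_zero u (by omega))
  · intro x _
    obtain ⟨x, rfl⟩ := Submodule.Quotient.mk_surjective _ x
    obtain ⟨d, rfl⟩ := eVec_cyclic q a _ m x
    rw [Submodule.Quotient.mk_smul]
    refine hstable d ?_
    have := hmem 0
    simpa only [w, ladProd_zero_smul] using this

theorem exists_basis_Triv (q : Set.Ioo (0 : ℝ) 1) (a : ℝ) :
    ∃ b : Module.Basis Unit ℂ (Triv q a), ∀ k (x : Ic q a),
      incI q a x • b k = (x : Dual q) (wtVec q a 0) • b k := by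
  refine ⟨Module.Basis.singleton Unit ℂ, fun k x => incI_smul_of_weight ?_ x⟩
  rw [triv_smul, counitD_incI]
  change weightProj q a 0 1 • _ = _
  rw [weightProj_one, if_pos rfl, one_smul]

/-- At weight [a] one has s - s⁻¹ = t, so the ladder elements there annihilate the trivial
representation. -/
theorem counitA_ladA (q : Set.Ioo (0 : ℝ) 1) (a : ℝ) (u : Bool) :
    counitA q (ladA q a (par q a u 0)) = 0 := by
  have h := par_sub_inv q a u 0
  simp only [Int.cast_zero, add_zero] at h
  simp only [ladA, podX, podXs, podY, map_add, map_sub, map_smul, map_mul, counitA_gen, counitGen,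
    smul_eq_mul, map_one, ← h]
  ring

end QuantumSL2R
end

/-! ### Proof of the proposition -/

open CategoryTheory QuantumSL2R

theorem mainTheorem6 (q : Set.Ioo (0 : ℝ) 1) (a : ℝ) :
    (¬ ∃ s : trivialRep q a ⟶ Mcrit q a, s ≫ aug q a = 𝟙 (trivialRep q a)) ∧
    (∃ F : (Mcrit q a).V ≃ₗ[ℂ] ((D2plus q a).V × (D2minus q a).V) × (trivialRep q a).V,
      ∀ (x : Ic q a) (v : (Mcrit q a).V),
        F ((Mcrit q a).actI x v) =
          (((D2plus q a).actI x (F v).1.1, (D2minus q a).actI x (F v).1.2),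
            (trivialRep q a).actI x (F v).2)) := by
  constructor
  · rintro ⟨s, hs⟩
    let f : Triv q a →ₗ[ℂ] CMod q a 0 := NRep.Hom.lin s
    have hf : ∀ d ∈ Cc q a, ∀ z : Triv q a, f (d • z) = d • f z :=
      fun d hd z => NRep.Hom.comm s ⟨d, hd⟩ z
    have hs1 : augLin q a (f (Triv.one q a)) = Triv.one q a :=
      congrArg (fun g : trivialRep q a ⟶ trivialRep q a => (NRep.Hom.lin g) (Triv.one q a)) hs
    have hl := isLadder_cVec q a 0
    have hPhi : incI q a (projI q a 0) ∈ Cc q a := (incIc q a (projI q a 0)).2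
    have hone : incI q a (projI q a 0) • Triv.one q a = Triv.one q a := by
      rw [triv_smul, counitD_incI]
      change weightProj q a 0 1 • _ = _
      rw [weightProj_one, if_pos rfl, one_smul]
    have hw : incI q a (projI q a 0) • f (Triv.one q a) = f (Triv.one q a) := by
      rw [← hf _ hPhi, hone]
    obtain ⟨c, hc⟩ := hl.weight_mem_span (eVec_cyclic q a _ 0) (f (Triv.one q a))
    rw [hw] at hc
    -- The raising element is multiplied by Φ_0, which fixes both vectors, because `Cc` consists of
    -- multiples of `Ic` and a morphism need only respect `Cc`.
    have hE := hf (incB q a (ladB q a (par q a true 0)) * incI q a (projI q a 0))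
      (Submodule.smul_mem _ _ (Submodule.subset_span ⟨_, rfl⟩)) (Triv.one q a)
    have hcu : counitA q (ladB q a (par q a true 0) : OqSU2 q) = 0 := counitA_ladA q a true
    rw [mul_smul, mul_smul, hone, hw, triv_smul, counitD_incB, hcu, zero_smul, map_zero, hc,
      smul_algebra_smul_comm] at hE
    have h1 := ladProd_smul_cVec_ne_zero q a true 1
    rw [ladProd_succ_smul, ladProd_zero_smul] at h1
    simp only [Nat.cast_zero, mul_zero, add_zero] at h1
    have hc0 : c = 0 := (smul_eq_zero.1 hE.symm).resolve_right h1
    rw [hc, hc0, zero_smul, map_zero] at hs1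
    exact one_ne_zero (α := ℂ) hs1.symm
  · obtain ⟨b, hb⟩ := exists_basis_crit q a
    obtain ⟨bp, hbp⟩ := exists_basis_LMod q a true
    obtain ⟨bm, hbm⟩ := exists_basis_LMod q a false
    obtain ⟨bt, hbt⟩ := exists_basis_Triv q a
    -- The expressions `2 * dir true` and `2 * dir false` compute to 2 and -2, so these are the
    -- spaces of `D2plus` and `D2minus` by unfolding.
    have key : ∃ F : CMod q a 0 ≃ₗ[ℂ] (LMod q a (2 * dir true) × LMod q a (2 * dir false)) × Triv q a,
        ∀ (x : Ic q a) (v : CMod q a 0), F (incI q a x • v) =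
          ((incI q a x • (F v).1.1, incI q a x • (F v).1.2), incI q a x • (F v).2) :=
      exists_intertwiner critWt b bp bm bt hb hbp hbm hbt
    exact key
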